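/- Let $\mathcal O$ be a complete discrete valuation ring with residue field $k$ of characteristic $p>0$ ($k$ need not be algebraically closed). Let $H$ be a normal subgroup of a finite group $G$, let $\bar G=G/H$ and $\bar g=gH$, and let $b$ be a $G$-invariant block of $\mathcal OH$. Put $A=\mathcal OGb$, a $\bar G$-graded algebra with identity component $B=\mathcal OHb$. Let $P$ be a $p$-subgroup of $G$, let $P_\gamma$ be a local pointed group on $B$ (that is, $\gamma$ is a $(B^P)^\times$-conjugacy class of primitive idempotents of the algebra $B^P$ of $P$-fixed points with $\mathrm{Br}_P(\gamma)\neq 0$), and let $i\in\gamma$. *The groups.* Let $E=N_G(P_\gamma)/C_H(P)$, where $N_G(P_\gamma)$ is the group of all $g\in N_G(P)$ with $g\gamma g^{-1}=\gamma$. Let $F$ be the group of all $(\varphi,\bar g)\in\mathrm{Aut}(P)\times\bar G$ such that $\overline{\varphi(u)}=\bar g\bar u\bar g^{-1}$ for all $u\in P$ and such that $Ai\simeq (Ai)(\bar g^{-1})_\varphi$ as $\bar G$-graded $(A,\mathcal OP)$-bimodules; here $M(y)_x=M_{xy}$, and $M_\varphi$ is $M$ with right action $m\cdot u=m\varphi(u)$.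 *The algebra $\overline{\mathcal E}$.* Let $m_\gamma$ be the maximal two-sided ideal of $B^P$ not containing $\gamma$, let $B(P_\gamma)=B^P/m_\gamma$ (a simple $k$-algebra) and let $V_\gamma$ be its simple module, which is unique up to isomorphism. Let $B(P_\gamma)*E=B(P_\gamma)\otimes_{\mathcal OC_H(P)}\mathcal ON_G(P_\gamma)$ be the $E$-graded crossed product with multiplication $(a\otimes g)(a'\otimes h)=a\,({}^ga')\otimes gh$, let $M=(B(P_\gamma)*E)\otimes_{B(P_\gamma)}V_\gamma$ with the induced $E$-grading, and put $$\overline{\mathcal E}=\mathrm{End}_{B(P_\gamma)*E}(M)^{\mathrm{op}},\qquad \overline{\mathcal E}_e=\{f: f(M_x)\subseteq M_{xe}\text{ for all }x\in E\}.$$ *The algebra $\overline{\mathcal F}$.* Let $C=\mathcal OP*F$ be the skew group algebra of $F$ over $\mathcal OP$, where $F$ acts on $P$ through its first component. It is $F$-graded, and it is $\bar G$-graded with $u\otimes(\varphi,\bar g)$ of degree $\bar u\bar g$. Let $N=Ai\otimes_{\mathcal OP}C$, a $\bar G$-graded $(A,C)$-bimodule (with the tensor product grading) that is also $F$-graded through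 $C$, and let $\mathcal F$ be the algebra of all endomorphisms of the $(A,C)$-bimodule $N$ that preserve the $\bar G$-grading, with the opposite of composition as multiplication and with $\mathcal F_\varphi=\{f: f(N_\psi)\subseteq N_{\varphi^{-1}\psi}\text{ for all }\psi\in F\}$. Put $\overline{\mathcal F}=\mathcal F/J_{\mathrm{gr}}(\mathcal F)$, where $J_{\mathrm{gr}}$ is the graded Jacobson radical (the intersection of the annihilators of all graded simple modules), and let $\overline{\mathcal F}_\varphi$ be the image of $\mathcal F_\varphi$. Then $\overline{\mathcal E}=\bigoplus_{e\in E}\overline{\mathcal E}_e$ and $\overline{\mathcal F}=\bigoplus_{\varphi\in F}\overline{\mathcal F}_\varphi$ are group graded $k$-algebras, the map $gC_H(P)\mapsto(u\mapsto gug^{-1},\,\bar g)$ is a well-defined group isomorphism $\theta:E\to F$, and there is an isomorphism of $k$-algebras $\Phi:\overline{\mathcal E}\to\overline{\mathcal F}$ with $\Phi(\overline{\mathcal E}_e)=\overline{\mathcal F}_{\theta(e)}$ for all $e\in E$. That is, $\overline{\mathcal E}\simeq\overline{\mathcal F}$ as $E\simeq F$-graded $k$-algebras. -/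

import Mathlib

noncomputable section

namespace BlockExtension

open scoped TensorProduct Pointwise

universe u v w

section Generalities

/-- A primitive idempotent of a ring: a nonzero idempotent `e` such that `eRe` contains no
idempotents besides `0` and `e`. -/
structure IsPrimitiveIdem {R : Type u} [Ring R] (e : R) : Prop where
  idem : e * e = e
  ne_zero : e ≠ 0
  prim : ∀ f : R, f * f = f → e * f = f → f * e = f → f = 0 ∨ f = e

/-- A point of a ring: a conjugacy class (under the unit group) of primitive idempotents. -/
def IsPoint {R : Type u} [Ring R] (γ : Set R) : Prop :=
  ∃ e : R, IsPrimitiveIdem e ∧ γ = {f | ∃ x : Rˣ, f = ↑x * e * ↑x⁻¹}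

/-- The submodules `𝒜 x` form a grading of the algebra `R` by the group `X`. -/
structure IsAlgebraGrading {K : Type u} {R : Type v} {X : Type w} [CommRing K] [Ring R]
    [Algebra K R] [Group X] (𝒜 : X → Submodule K R) : Prop where
  one_mem : (1 : R) ∈ 𝒜 1
  mul_mem : ∀ x y : X, ∀ a ∈ 𝒜 x, ∀ c ∈ 𝒜 y, a * c ∈ 𝒜 (x * y)
  iSup_eq_top : ⨆ x, 𝒜 x = ⊤
  indep : iSupIndep 𝒜

/-- A left ideal is graded if it is generated additively by its homogeneous elements. -/
def IsGradedLeftIdeal {K : Type u} {R : Type v} {X : Type w} [CommRing K] [Ring R]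
    [Algebra K R] (𝒜 : X → Submodule K R) (I : Ideal R) : Prop :=
  I.restrictScalars K ≤ ⨆ x, I.restrictScalars K ⊓ 𝒜 x

/-- Maximal elements among the proper graded left ideals. -/
def IsMaximalGradedLeftIdeal {K : Type u} {R : Type v} {X : Type w} [CommRing K] [Ring R]
    [Algebra K R] (𝒜 : X → Submodule K R) (I : Ideal R) : Prop :=
  Maximal (fun J : Ideal R => IsGradedLeftIdeal 𝒜 J ∧ J ≠ ⊤) I

/-- The graded Jacobson radical `J_gr(R)`: the intersection of the annihilators of the graded
simple modules `R ⧸ 𝔪`, where `𝔪` runs over the maximal graded left ideals. -/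
def gradedJacobson {K : Type u} {R : Type v} {X : Type w} [CommRing K] [Ring R]
    [Algebra K R] (𝒜 : X → Submodule K R) : Ideal R where
  carrier := {r | ∀ 𝔪 : Ideal R, IsMaximalGradedLeftIdeal 𝒜 𝔪 → ∀ s : R, r * s ∈ 𝔪}
  add_mem' := fun ha hb 𝔪 h𝔪 s => by
    rw [add_mul]; exact 𝔪.add_mem (ha 𝔪 h𝔪 s) (hb 𝔪 h𝔪 s)
  zero_mem' := fun 𝔪 _ s => by rw [zero_mul]; exact 𝔪.zero_mem
  smul_mem' := fun c r hr 𝔪 h𝔪 s => by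
    rw [smul_eq_mul, mul_assoc]; exact 𝔪.mul_mem_left c (hr 𝔪 h𝔪 s)

instance gradedJacobson_isTwoSided {K : Type u} {R : Type v} {X : Type w} [CommRing K] [Ring R]
    [Algebra K R] (𝒜 : X → Submodule K R) : (gradedJacobson 𝒜).IsTwoSided where
  mul_mem_of_left := fun b hr 𝔪 h𝔪 s => by
    rw [mul_assoc]; exact hr 𝔪 h𝔪 (b * s)

/-- If the maximal ideal of `O` acts as zero on the `O`-algebra `S`, then `S` is naturally an
algebra over the residue field. -/
abbrev residueAlgebra {O : Type u} [CommRing O] [IsLocalRing O] {S : Type v} [Ring S] [Algebra O S]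
    (h : ∀ r ∈ IsLocalRing.maximalIdeal O, algebraMap O S r = 0) :
    Algebra (IsLocalRing.ResidueField O) S :=
  RingHom.toAlgebra' (Ideal.Quotient.lift (IsLocalRing.maximalIdeal O) (algebraMap O S) h)
    (fun c x => by
      obtain ⟨r, rfl⟩ := IsLocalRing.residue_surjective c
      exact Algebra.commutes r x)

/-- For a point `γ` of `R`, the maximal two-sided ideal `m_γ` of `R` that does not contain `γ`: it is
the largest among the two-sided ideals of `R` that do not contain `γ`. -/
def pointIdeal {R : Type u} [Ring R] (γ : Set R) : Ideal R :=
  sSup {I : Ideal R | I.IsTwoSided ∧ ¬ γ ⊆ I}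

theorem pointIdeal_induction {R : Type u} [Ring R] {γ : Set R} {p : R → Prop}
    (hmem : ∀ I : Ideal R, I.IsTwoSided → ¬ γ ⊆ I → ∀ x ∈ I, p x)
    (hzero : p 0) (hadd : ∀ x y, p x → p y → p (x + y)) {a : R} (ha : a ∈ pointIdeal γ) : p a := by
  unfold pointIdeal at ha
  rw [sSup_eq_iSup'] at ha
  exact Submodule.iSup_induction (motive := p) _ ha
    (fun I x hx => hmem I.1 I.2.1 I.2.2 x hx) hzero hadd

instance pointIdeal_isTwoSided {R : Type u} [Ring R] (γ : Set R) : (pointIdeal γ).IsTwoSided where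
  mul_mem_of_left := fun {a} c ha => by
    refine pointIdeal_induction (p := fun x => x * c ∈ pointIdeal γ) ?_ ?_ ?_ ha
    · intro I hI hI' x hx
      have h1 : I ≤ pointIdeal γ := le_sSup ⟨hI, hI'⟩
      exact h1 (I.mul_mem_right c hx)
    · rw [zero_mul]; exact zero_mem _
    · intro x y hx hy
      rw [add_mul]; exact add_mem hx hy

theorem smul_mem_pointIdeal {R : Type u} {N : Type v} [Ring R] [Group N] [MulSemiringAction N R]
    {γ : Set R} (n : N) (hγ : ∀ j ∈ γ, n • j ∈ γ) {a : R} (ha : a ∈ pointIdeal γ) :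
    n • a ∈ pointIdeal γ := by
  refine pointIdeal_induction (p := fun x => n • x ∈ pointIdeal γ) ?_ ?_ ?_ ha
  · intro I hI hI' x hx
    let f := MulSemiringAction.toRingHom N R n⁻¹
    have h1 : I.comap f ≤ pointIdeal γ := by
      refine le_sSup ⟨inferInstance, fun h => hI' fun j hj => ?_⟩
      have h2 := h (hγ j hj)
      have h3 : n⁻¹ • n • j ∈ I := h2
      rwa [inv_smul_smul] at h3
    refine h1 ?_
    change n⁻¹ • n • x ∈ I
    rwa [inv_smul_smul]
  · rw [smul_zero]; exact zero_mem _
  · intro x y hx hy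
    rw [smul_add]; exact add_mem hx hy

/-- The left ideal `J(O) R`. -/
def residueIdeal (O : Type u) [CommRing O] [IsLocalRing O] (R : Type v) [Ring R] [Algebra O R] :
    Ideal R where
  carrier := (IsLocalRing.maximalIdeal O • ⊤ : Submodule O R)
  add_mem' := fun hx hy => add_mem (S := Submodule O R) hx hy
  zero_mem' := zero_mem (S := Submodule O R) _
  smul_mem' := fun c x hx => by
    refine Submodule.smul_induction_on
      (p := fun x => c • x ∈ (IsLocalRing.maximalIdeal O • ⊤ : Submodule O R)) hx ?_ ?_
    · intro s hs y _
      rw [smul_comm]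
      exact Submodule.smul_mem_smul hs trivial
    · intro x y hx hy
      rw [smul_add]; exact add_mem hx hy

theorem mem_residueIdeal {O : Type u} [CommRing O] [IsLocalRing O] {R : Type v} [Ring R]
    [Algebra O R] {x : R} :
    x ∈ residueIdeal O R ↔ x ∈ (IsLocalRing.maximalIdeal O • ⊤ : Submodule O R) := Iff.rfl

theorem algebraMap_mem_residueIdeal {O : Type u} [CommRing O] [IsLocalRing O] {R : Type v} [Ring R]
    [Algebra O R] {r : O} (hr : r ∈ IsLocalRing.maximalIdeal O) :
    algebraMap O R r ∈ residueIdeal O R := by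
  rw [Algebra.algebraMap_eq_smul_one, mem_residueIdeal]
  exact Submodule.smul_mem_smul hr trivial

theorem mul_mem_residueIdeal {O : Type u} [CommRing O] [IsLocalRing O] {R : Type v} [Ring R]
    [Algebra O R] {x : R} (hx : x ∈ (IsLocalRing.maximalIdeal O • ⊤ : Submodule O R)) (c : R) :
    x * c ∈ (IsLocalRing.maximalIdeal O • ⊤ : Submodule O R) := by
  refine Submodule.smul_induction_on
    (p := fun x => x * c ∈ (IsLocalRing.maximalIdeal O • ⊤ : Submodule O R)) hx ?_ ?_
  · intro s hs y _
    rw [smul_mul_assoc]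
    exact Submodule.smul_mem_smul hs trivial
  · intro x y hx hy
    rw [add_mul]; exact add_mem hx hy

instance residueIdeal_isTwoSided (O : Type u) [CommRing O] [IsLocalRing O] (R : Type v) [Ring R]
    [Algebra O R] : (residueIdeal O R).IsTwoSided where
  mul_mem_of_left := fun c hx => mul_mem_residueIdeal hx c

theorem eq_zero_of_mem_residueIdeal {O : Type u} [CommRing O] [IsLocalRing O] [IsNoetherianRing O]
    {R : Type v} [Ring R] [Algebra O R] [Module.Finite O R] {j : R} (hjj : j * j = j)
    (hj : j ∈ residueIdeal O R) : j = 0 := by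
  have key : ∀ n : ℕ, j ∈ (IsLocalRing.maximalIdeal O ^ n • ⊤ : Submodule O R) := by
    intro n
    induction n with
    | zero => simp
    | succ n ih =>
      have h3 : j * j ∈ (IsLocalRing.maximalIdeal O ^ (n + 1) • ⊤ : Submodule O R) := by
        refine Submodule.smul_induction_on (p := fun x => x * j ∈
            (IsLocalRing.maximalIdeal O ^ (n + 1) • ⊤ : Submodule O R)) ih ?_ ?_
        · intro s hs y _
          have h2 : y * j ∈ (IsLocalRing.maximalIdeal O • ⊤ : Submodule O R) :=
            (residueIdeal O R).mul_mem_left y hj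
          rw [smul_mul_assoc, pow_succ, Submodule.mul_smul]
          exact Submodule.smul_mem_smul hs h2
        · intro x y hx hy
          rw [add_mul]; exact add_mem hx hy
      rwa [hjj] at h3
  have h0 := Ideal.iInf_pow_smul_eq_bot_of_isLocalRing (M := R)
    (IsLocalRing.maximalIdeal O) (IsLocalRing.maximalIdeal.isMaximal O).ne_top
  have h4 : j ∈ (⨅ n : ℕ, IsLocalRing.maximalIdeal O ^ n • ⊤ : Submodule O R) :=
    (Submodule.mem_iInf _).2 key
  rw [h0] at h4
  exact h4

theorem IsPoint.exists_mem {R : Type u} [Ring R] {γ : Set R} (hγ : IsPoint γ) :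
    ∃ j ∈ γ, j * j = j ∧ j ≠ 0 := by
  obtain ⟨e, he, rfl⟩ := hγ
  exact ⟨e, ⟨1, by simp⟩, he.idem, he.ne_zero⟩

theorem algebraMap_mem_pointIdeal {O : Type u} [CommRing O] [IsLocalRing O] [IsNoetherianRing O]
    {R : Type v} [Ring R] [Algebra O R] [Module.Finite O R] {γ : Set R} (hγ : IsPoint γ)
    {r : O} (hr : r ∈ IsLocalRing.maximalIdeal O) : algebraMap O R r ∈ pointIdeal γ := by
  have h1 : residueIdeal O R ≤ pointIdeal γ := by
    refine le_sSup ⟨inferInstance, fun h => ?_⟩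
    obtain ⟨j, hj, hjj, hj0⟩ := hγ.exists_mem
    exact hj0 (eq_zero_of_mem_residueIdeal hjj (h hj))
  exact h1 (algebraMap_mem_residueIdeal hr)

/-- The relations `(τ c) ⊗ 1 = 1 ⊗ c` that turn the skew group algebra of `N` over `B` into the
crossed product `B ⊗_{OC} ON`. -/
def crossedCon {B : Type u} {N : Type v} [Ring B] [Group N] [MulSemiringAction N B]
    (C : Subgroup N) (τ : C → B) : RingCon (SkewMonoidAlgebra B N) :=
  ringConGen fun x y =>
    ∃ c : C, x = SkewMonoidAlgebra.single 1 (τ c) ∧ y = SkewMonoidAlgebra.single (c : N) 1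

/-- The crossed product `B * (N ⧸ C) = B ⊗_{OC} ON` of a `C`-interior `N`-algebra `B` (with
structural map `τ`), with multiplication `(a ⊗ g)(a' ⊗ h) = a (ᵍa') ⊗ gh`. -/
def CrossedProduct {B : Type u} {N : Type v} [Ring B] [Group N] [MulSemiringAction N B]
    (C : Subgroup N) (τ : C → B) : Type (max u v) :=
  (crossedCon C τ).Quotient

namespace CrossedProduct

variable {B : Type u} {N : Type v} [Ring B] [Group N] [MulSemiringAction N B]
  (C : Subgroup N) (τ : C → B)

instance : Ring (CrossedProduct C τ) := inferInstanceAs (Ring (crossedCon C τ).Quotient)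

instance {K : Type w} [CommRing K] [Algebra K B] [SMulCommClass N K B] :
    Algebra K (CrossedProduct C τ) := inferInstanceAs (Algebra K (crossedCon C τ).Quotient)

/-- The quotient map from the skew group algebra of `N` over `B` onto the crossed product. -/
def mk : SkewMonoidAlgebra B N →+* CrossedProduct C τ := (crossedCon C τ).mk'

/-- The structural map `B → B * (N ⧸ C)`, `a ↦ a ⊗ 1`. -/
def incl : B →+* CrossedProduct C τ :=
  (mk C τ).comp SkewMonoidAlgebra.singleOneRingHom

/-- The component of degree `e ∈ N ⧸ C` of the crossed product: all sums of elements `a ⊗ n`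
with `n ∈ e`. -/
def component (e : N ⧸ C) : AddSubgroup (CrossedProduct C τ) :=
  AddSubgroup.closure
    {x | ∃ (n : N) (a : B), (n : N ⧸ C) = e ∧ x = mk C τ (SkewMonoidAlgebra.single n a)}

theorem smul_mem_component {K : Type w} [CommRing K] [Algebra K B] [SMulCommClass N K B]
    (e : N ⧸ C) (c : K) {x : CrossedProduct C τ} (hx : x ∈ component C τ e) :
    c • x ∈ component C τ e := by
  refine AddSubgroup.closure_induction (p := fun x _ => c • x ∈ component C τ e) ?_ ?_ ?_ ?_ hx
  · rintro _ ⟨n, a, hn, rfl⟩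
    refine AddSubgroup.subset_closure ⟨n, c • a, hn, ?_⟩
    rw [← SkewMonoidAlgebra.smul_single]
    rfl
  · rw [smul_zero]; exact zero_mem _
  · intro x y _ _ hx hy
    rw [smul_add]; exact add_mem hx hy
  · intro x _ hx
    rw [smul_neg]; exact neg_mem hx

end CrossedProduct

/-- The `R`-submodule of `R ⊗_ℤ V` spanned by the elements `(x · ι s) ⊗ v - x ⊗ (s v)`. -/
def inducedRel {R : Type u} {S : Type v} [Ring R] [Ring S] (ι : S →+* R) (V : Type w)
    [AddCommGroup V] [Module S V] : Submodule R (R ⊗[ℤ] V) :=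
  Submodule.span R {t | ∃ (x : R) (s : S) (y : V), t = (x * ι s) ⊗ₜ[ℤ] y - x ⊗ₜ[ℤ] (s • y)}

/-- The induced left `R`-module `R ⊗_S V`, where `R` is a right `S`-module through `ι`. -/
def Induced {R : Type u} {S : Type v} [Ring R] [Ring S] (ι : S →+* R) (V : Type w)
    [AddCommGroup V] [Module S V] : Type (max u w) :=
  (R ⊗[ℤ] V) ⧸ inducedRel ι V

namespace Induced

variable {R : Type u} {S : Type v} [Ring R] [Ring S] (ι : S →+* R) (V : Type w)
  [AddCommGroup V] [Module S V]

instance : AddCommGroup (Induced ι V) := inferInstanceAs (AddCommGroup ((R ⊗[ℤ] V) ⧸ inducedRel ι V))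
instance : Module R (Induced ι V) := inferInstanceAs (Module R ((R ⊗[ℤ] V) ⧸ inducedRel ι V))

/-- If `R` is a `K`-algebra, then `K` acts on `R ⊗_S V` through `R`. -/
instance {K : Type*} [CommRing K] [Algebra K R] : Module K (Induced ι V) :=
  Module.compHom _ (algebraMap K R)

theorem smul_def {K : Type*} [CommRing K] [Algebra K R] (c : K) (m : Induced ι V) :
    c • m = algebraMap K R c • m := rfl

instance {K : Type*} [CommRing K] [Algebra K R] : IsScalarTower K R (Induced ι V) where
  smul_assoc c x m := by rw [smul_def, Algebra.smul_def, mul_smul]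

instance {K : Type*} [CommRing K] [Algebra K R] : SMulCommClass R K (Induced ι V) where
  smul_comm x c m := by rw [smul_def, smul_def, ← mul_smul, ← mul_smul, Algebra.commutes]

/-- The element `x ⊗ y` of `R ⊗_S V`. -/
def tmul (x : R) (y : V) : Induced ι V := (inducedRel ι V).mkQ (x ⊗ₜ[ℤ] y)

theorem smul_tmul (r x : R) (y : V) : r • tmul ι V x y = tmul ι V (r * x) y := rfl

end Induced

/-- If `R` is a finitely generated `O`-module which is the sum of the `𝒜 x`, then `J(O)` is contained
in the graded Jacobson radical of `R`. -/
theorem algebraMap_mem_gradedJacobson {O : Type u} [CommRing O] [IsLocalRing O] {R : Type v}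
    [Ring R] [Algebra O R] [Module.Finite O R] {X : Type w} (𝒜 : X → Submodule O R)
    (h𝒜 : ⨆ x, 𝒜 x = ⊤) {r : O} (hr : r ∈ IsLocalRing.maximalIdeal O) :
    algebraMap O R r ∈ gradedJacobson 𝒜 := by
  intro 𝔪 h𝔪 s
  by_contra hs
  let J : Ideal R := 𝔪 ⊔ Ideal.span {algebraMap O R r}
  have hJ : IsGradedLeftIdeal 𝒜 J := by
    intro x hx
    obtain ⟨y, hy, z, hz, rfl⟩ := Submodule.mem_sup.1 (show x ∈ J from hx)
    obtain ⟨t, rfl⟩ := Submodule.mem_span_singleton.1 hz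
    refine add_mem ?_ ?_
    · have h1 := h𝔪.prop.1 (show y ∈ 𝔪.restrictScalars O from hy)
      have h2 : 𝔪.restrictScalars O ≤ J.restrictScalars O := fun a ha => le_sup_left (a := 𝔪) ha
      exact (iSup_mono fun x => inf_le_inf_right (𝒜 x) h2 :
        (⨆ x, 𝔪.restrictScalars O ⊓ 𝒜 x) ≤ ⨆ x, J.restrictScalars O ⊓ 𝒜 x) h1
    · have ht : t ∈ ⨆ x, 𝒜 x := by rw [h𝒜]; trivial
      refine Submodule.iSup_induction 𝒜 (motive := fun t => t • algebraMap O R r ∈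
        ⨆ x, J.restrictScalars O ⊓ 𝒜 x) ht ?_ ?_ ?_
      · intro x a ha
        refine Submodule.mem_iSup_of_mem x ⟨?_, ?_⟩
        · exact J.smul_mem a (le_sup_right (a := 𝔪) (Ideal.subset_span rfl))
        · rw [smul_eq_mul, ← Algebra.commutes, ← Algebra.smul_def]
          exact (𝒜 x).smul_mem r ha
      · rw [zero_smul]; exact zero_mem _
      · intro x y hx hy
        rw [add_smul]; exact add_mem hx hy
  have hle : 𝔪 ≤ J := le_sup_left
  have hsJ : algebraMap O R r * s ∈ J := by
    rw [Algebra.commutes]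
    exact J.mul_mem_left s (le_sup_right (a := 𝔪) (Ideal.subset_span rfl))
  have htop : J = ⊤ := by
    by_contra hne
    exact hs (h𝔪.le_of_ge ⟨hJ, hne⟩ hle hsJ)
  refine h𝔪.prop.2 ?_
  have h2 : (⊤ : Submodule O R) ≤ 𝔪.restrictScalars O := by
    refine Submodule.le_of_le_smul_of_le_jacobson_bot Module.Finite.fg_top
      (IsLocalRing.maximalIdeal_le_jacobson (⊥ : Ideal O)) ?_
    intro x _
    have hx : x ∈ J := by rw [htop]; trivial
    obtain ⟨y, hy, z, hz, rfl⟩ := Submodule.mem_sup.1 hx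
    obtain ⟨t, rfl⟩ := Submodule.mem_span_singleton.1 hz
    refine Submodule.add_mem_sup hy ?_
    rw [smul_eq_mul, ← Algebra.commutes, ← Algebra.smul_def]
    exact Submodule.smul_mem_smul hr trivial
  exact eq_top_iff.2 fun x hx => h2 (show x ∈ (⊤ : Submodule O R) from trivial)

end Generalities

section Block

/-- The inclusion `OH → OG`. -/
def inclGroupAlg (O : Type u) {G : Type v} [CommRing O] [Group G] (H : Subgroup G) :
    MonoidAlgebra O H →ₐ[O] MonoidAlgebra O G :=
  MonoidAlgebra.mapDomainAlgHom O O H.subtype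

/-- A `G`-invariant block of `OH`: a primitive idempotent of the center of `OH` which is fixed by
conjugation with the elements of `G`. -/
structure InvariantBlock (O : Type u) {G : Type v} [CommRing O] [Group G] (H : Subgroup G) where
  block : Subalgebra.center O (MonoidAlgebra O H)
  primitive : IsPrimitiveIdem block
  invariant : ∀ g : G, MonoidAlgebra.of O G g * inclGroupAlg O H (block : MonoidAlgebra O H) =
    inclGroupAlg O H (block : MonoidAlgebra O H) * MonoidAlgebra.of O G g

variable {O : Type u} {G : Type v} [CommRing O] [Group G] {H : Subgroup G}

/-- The block as an element of `OG`. -/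
def InvariantBlock.val (b : InvariantBlock O H) : MonoidAlgebra O G :=
  inclGroupAlg O H (b.block : MonoidAlgebra O H)

theorem InvariantBlock.val_mul_val (b : InvariantBlock O H) : b.val * b.val = b.val := by
  have h := congrArg (Subtype.val) b.primitive.idem
  unfold InvariantBlock.val
  rw [← map_mul]
  exact congrArg _ h

theorem InvariantBlock.comm (b : InvariantBlock O H) (x : MonoidAlgebra O G) :
    x * b.val = b.val * x := by
  induction x using MonoidAlgebra.induction_on with
  | of m => exact b.invariant m
  | add x y hx hy => rw [add_mul, mul_add, hx, hy]
  | smul r x hx => rw [smul_mul_assoc, mul_smul_comm, hx]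

/-- The ideal `OGb` of `OG`. -/
def InvariantBlock.ideal (b : InvariantBlock O H) : Submodule O (MonoidAlgebra O G) where
  carrier := {x | b.val * x = x}
  add_mem' := fun {x y} hx hy => by
    change b.val * (x + y) = x + y
    rw [mul_add, hx, hy]
  zero_mem' := mul_zero _
  smul_mem' := fun c x hx => by
    change b.val * (c • x) = c • x
    rw [mul_smul_comm, hx]

/-- The block extension `A = OGb`, an `O`-algebra with identity element `b`. -/
def BlockExt (b : InvariantBlock O H) : Type (max u v) := ↥b.ideal

namespace BlockExt

variable (b : InvariantBlock O H)

instance : AddCommGroup (BlockExt b) := inferInstanceAs (AddCommGroup ↥b.ideal)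
instance : Module O (BlockExt b) := inferInstanceAs (Module O ↥b.ideal)

variable {b}

/-- An element of `A = OGb` as an element of `OG`. -/
def val (a : BlockExt b) : MonoidAlgebra O G := Subtype.val a

theorem val_injective : Function.Injective (val (b := b)) := Subtype.val_injective

theorem block_mul_val (a : BlockExt b) : b.val * a.val = a.val := Subtype.property a

variable (b)

instance : Ring (BlockExt b) where
  __ := (inferInstance : AddCommGroup (BlockExt b))
  mul x y := ⟨x.val * y.val, by
    change b.val * (x.val * y.val) = x.val * y.val
    rw [← mul_assoc, block_mul_val]⟩
  one := ⟨b.val, b.val_mul_val⟩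
  mul_assoc x y z := val_injective (mul_assoc x.val y.val z.val)
  one_mul x := val_injective (block_mul_val x)
  mul_one x := val_injective ((b.comm x.val).trans (block_mul_val x))
  left_distrib x y z := val_injective (mul_add x.val y.val z.val)
  right_distrib x y z := val_injective (add_mul x.val y.val z.val)
  zero_mul x := val_injective (zero_mul x.val)
  mul_zero x := val_injective (mul_zero x.val)

instance : Algebra O (BlockExt b) :=
  Algebra.ofModule (fun r x y => val_injective (smul_mul_assoc r x.val y.val))
    (fun r x y => val_injective (mul_smul_comm r x.val y.val))

theorem val_mul (x y : BlockExt b) : (x * y).val = x.val * y.val := rfl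
theorem val_one : (1 : BlockExt b).val = b.val := rfl
theorem val_add (x y : BlockExt b) : (x + y).val = x.val + y.val := rfl
theorem val_zero : (0 : BlockExt b).val = 0 := rfl
theorem val_smul (r : O) (x : BlockExt b) : (r • x).val = r • x.val := rfl

instance [IsNoetherianRing O] [Finite G] : Module.Finite O (BlockExt b) :=
  inferInstanceAs (Module.Finite O ↥b.ideal)

/-- The structural map `G → A`, `g ↦ gb`. -/
def str : G →* BlockExt b where
  toFun g := ⟨b.val * MonoidAlgebra.of O G g, by
    change b.val * (b.val * MonoidAlgebra.of O G g) = b.val * MonoidAlgebra.of O G g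
    rw [← mul_assoc, b.val_mul_val]⟩
  map_one' := val_injective (by
    change b.val * MonoidAlgebra.of O G 1 = b.val
    rw [map_one, mul_one])
  map_mul' g h := val_injective (by
    change b.val * MonoidAlgebra.of O G (g * h) =
      (b.val * MonoidAlgebra.of O G g) * (b.val * MonoidAlgebra.of O G h)
    rw [mul_assoc, ← mul_assoc (MonoidAlgebra.of O G g), b.comm, mul_assoc, ← mul_assoc b.val b.val,
      b.val_mul_val, map_mul])

theorem val_str (g : G) : (str b g).val = b.val * MonoidAlgebra.of O G g := rfl

theorem str_mul_inv (g : G) : str b g * str b g⁻¹ = 1 := by rw [← map_mul, mul_inv_cancel, map_one]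
theorem str_inv_mul (g : G) : str b g⁻¹ * str b g = 1 := by rw [← map_mul, inv_mul_cancel, map_one]

/-- `G` acts on `A = OGb` by conjugation. -/
instance : MulSemiringAction G (BlockExt b) where
  smul g a := str b g * a * str b g⁻¹
  one_smul a := by
    change str b 1 * a * str b 1⁻¹ = a
    rw [inv_one, map_one, one_mul, mul_one]
  mul_smul g h a := by
    change str b (g * h) * a * str b (g * h)⁻¹ = str b g * (str b h * a * str b h⁻¹) * str b g⁻¹
    rw [mul_inv_rev, map_mul, map_mul]
    simp only [mul_assoc]
  smul_zero g := by
    change str b g * 0 * str b g⁻¹ = 0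
    rw [mul_zero, zero_mul]
  smul_add g x y := by
    change str b g * (x + y) * str b g⁻¹ = str b g * x * str b g⁻¹ + str b g * y * str b g⁻¹
    rw [mul_add, add_mul]
  smul_one g := by
    change str b g * 1 * str b g⁻¹ = 1
    rw [mul_one, str_mul_inv]
  smul_mul g x y := by
    change str b g * (x * y) * str b g⁻¹ =
      (str b g * x * str b g⁻¹) * (str b g * y * str b g⁻¹)
    have : (str b g * x * str b g⁻¹) * (str b g * y * str b g⁻¹) =
      str b g * x * (str b g⁻¹ * str b g) * y * str b g⁻¹ := by simp only [mul_assoc]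
    rw [this, str_inv_mul, mul_one]
    simp only [mul_assoc]

theorem conj_def (g : G) (a : BlockExt b) : g • a = str b g * a * str b g⁻¹ := rfl

instance : SMulCommClass G O (BlockExt b) where
  smul_comm g r a := by
    rw [conj_def, conj_def, mul_smul_comm, smul_mul_assoc]

/-- The `G ⧸ H`-grading of `A = OGb`: the component of degree `x` consists of the elements supported
on the coset `x`. -/
def component (x : G ⧸ H) : Submodule O (BlockExt b) where
  carrier := {a | ∀ g : G, a.val.coeff g ≠ 0 → (g : G ⧸ H) = x}
  add_mem' := fun {a c} ha hc g hg => by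
    by_cases h : a.val.coeff g = 0
    · refine hc g fun h' => hg ?_
      rw [val_add, MonoidAlgebra.coeff_add, Finsupp.add_apply, h, h', add_zero]
    · exact ha g h
  zero_mem' := fun g hg => absurd (by rw [val_zero]; rfl) hg
  smul_mem' := fun r a ha g hg => ha g fun h => hg (by
    rw [val_smul, MonoidAlgebra.coeff_smul, Finsupp.smul_apply, h, smul_zero])

theorem coeff_conj (g x : G) (a : BlockExt b) :
    (g • a).val.coeff x = a.val.coeff (g⁻¹ * x * g) := by
  have h : (g • a).val = MonoidAlgebra.single g 1 * a.val * MonoidAlgebra.single g⁻¹ 1 := by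
    rw [conj_def, val_mul, val_mul, val_str, val_str]
    have h1 : b.val * MonoidAlgebra.of O G g * a.val * (b.val * MonoidAlgebra.of O G g⁻¹) =
      b.val * (MonoidAlgebra.of O G g * (a.val * b.val) * MonoidAlgebra.of O G g⁻¹) := by
        simp only [mul_assoc]
    rw [h1, b.comm a.val, block_mul_val, ← mul_assoc, ← mul_assoc, ← b.comm, mul_assoc _ b.val,
      block_mul_val]
    rfl
  rw [h]
  simp [MonoidAlgebra.coeff_mul_single_apply, MonoidAlgebra.coeff_single_mul_apply, mul_assoc]

variable [H.Normal]

theorem mul_mem_component {x y : G ⧸ H} {a c : BlockExt b} (ha : a ∈ component b x)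
    (hc : c ∈ component b y) : a * c ∈ component b (x * y) := by
  classical
  intro g hg
  rw [val_mul, MonoidAlgebra.coeff_mul] at hg
  obtain ⟨g₁, hg₁, h1⟩ := Finset.exists_ne_zero_of_sum_ne_zero hg
  obtain ⟨g₂, hg₂, h2⟩ := Finset.exists_ne_zero_of_sum_ne_zero h1
  have h3 : g₁ * g₂ = g := by
    by_contra h3
    exact h2 (if_neg h3)
  rw [← h3, QuotientGroup.mk_mul, ha g₁ (Finsupp.mem_support_iff.1 hg₁),
    hc g₂ (Finsupp.mem_support_iff.1 hg₂)]

theorem one_mem_component : (1 : BlockExt b) ∈ component b 1 := by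
  intro g hg
  rw [QuotientGroup.eq_one_iff]
  by_contra hgH
  refine hg ?_
  change (MonoidAlgebra.mapDomain H.subtype (b.block : MonoidAlgebra O H)).coeff g = 0
  rw [MonoidAlgebra.coeff_mapDomain]
  exact Finsupp.mapDomain_of_notMem_range _ _ (by simpa using hgH)

theorem str_mem_component (g : G) : str b g ∈ component b (g : G ⧸ H) := by
  intro x hx
  have h : b.val.coeff (x * g⁻¹) ≠ 0 := by
    intro h
    refine hx ?_
    rw [val_str, MonoidAlgebra.of_apply, MonoidAlgebra.coeff_mul_single_apply, h, zero_mul]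
  have h2 := one_mem_component b (x * g⁻¹) h
  rw [QuotientGroup.mk_mul, QuotientGroup.mk_inv, mul_inv_eq_one] at h2
  exact h2

theorem smul_mem_component_one (g : G) {a : BlockExt b} (ha : a ∈ component b 1) :
    g • a ∈ component b 1 := by
  intro x hx
  rw [coeff_conj] at hx
  have h := ha _ hx
  rw [QuotientGroup.eq_one_iff] at h ⊢
  have h2 := (inferInstance : H.Normal).conj_mem _ h g
  simpa [mul_assoc] using h2

end BlockExt

section Points

variable (b : InvariantBlock O H) [H.Normal]

/-- The algebra `B^P` of `P`-fixed elements of `B = OHb`. -/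
def fixedSubalgebra (P : Subgroup G) : Subalgebra O (BlockExt b) where
  carrier := {a | a ∈ BlockExt.component b 1 ∧ ∀ u ∈ P, u • a = a}
  mul_mem' := fun {x y} hx hy => ⟨by
      have h := BlockExt.mul_mem_component b hx.1 hy.1
      rwa [one_mul] at h,
    fun u hu => by rw [smul_mul', hx.2 u hu, hy.2 u hu]⟩
  add_mem' := fun hx hy => ⟨add_mem hx.1 hy.1,
    fun u hu => by rw [smul_add, hx.2 u hu, hy.2 u hu]⟩
  algebraMap_mem' := fun r => by
    rw [Algebra.algebraMap_eq_smul_one]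
    exact ⟨Submodule.smul_mem _ r (BlockExt.one_mem_component b),
      fun u hu => by rw [smul_comm, smul_one]⟩

/-- The algebra `B^P`, as a type. -/
def FixedAlg (P : Subgroup G) : Type (max u v) := ↥(fixedSubalgebra b P)

namespace FixedAlg

variable {b} {P : Subgroup G}

instance : Ring (FixedAlg b P) := inferInstanceAs (Ring ↥(fixedSubalgebra b P))
instance : Algebra O (FixedAlg b P) := inferInstanceAs (Algebra O ↥(fixedSubalgebra b P))

/-- The inclusion `B^P → A`. -/
def val : FixedAlg b P →ₐ[O] BlockExt b := (fixedSubalgebra b P).val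

theorem val_injective : Function.Injective (val : FixedAlg b P → BlockExt b) :=
  Subtype.val_injective

theorem val_mem (a : FixedAlg b P) : val a ∈ BlockExt.component b 1 := a.2.1

theorem conj_val {u : G} (hu : u ∈ P) (a : FixedAlg b P) : u • val a = val a := a.2.2 u hu

theorem val_mul_str {u : G} (hu : u ∈ P) (a : FixedAlg b P) :
    val a * BlockExt.str b u = BlockExt.str b u * val a := by
  have h := conj_val hu a
  rw [BlockExt.conj_def] at h
  calc val a * BlockExt.str b u
      = BlockExt.str b u * val a * BlockExt.str b u⁻¹ * BlockExt.str b u := by rw [h]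
    _ = BlockExt.str b u * val a := by rw [mul_assoc _ _ (BlockExt.str b u), BlockExt.str_inv_mul,
        mul_one]

instance [IsNoetherianRing O] [Finite G] : Module.Finite O (FixedAlg b P) :=
  inferInstanceAs (Module.Finite O (Subalgebra.toSubmodule (fixedSubalgebra b P)))

end FixedAlg

/-- The relative trace `Tr_Q^P(a) = ∑_{u ∈ P ⧸ Q} u a u⁻¹` for `Q ≤ P` and a `Q`-fixed `a`. -/
def relTrace (P : Subgroup G) (Q : Subgroup P) (a : BlockExt b) : BlockExt b :=
  ∑ᶠ c : P ⧸ Q, (c.out : G) • a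

/-- The kernel of the Brauer map `Br_P : B^P → B(P)`: the `O`-module generated by the relative
traces `Tr_Q^P(a)`, for proper subgroups `Q` of `P` and `a ∈ B^Q`, and by `J(O) B^P`. -/
def brauerKer [IsLocalRing O] (P : Subgroup G) : Submodule O (BlockExt b) :=
  Submodule.span O
    ({x | ∃ Q : Subgroup P, Q ≠ ⊤ ∧ ∃ a ∈ fixedSubalgebra b (Q.map P.subtype), x = relTrace b P Q a} ∪
     {x | ∃ r ∈ IsLocalRing.maximalIdeal O, ∃ a ∈ fixedSubalgebra b P, x = r • a})

/-- A local point of `P` on `B = OHb`, that is, a local pointed group `P_γ` on `B`: a point `γ` of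
`B^P` with `Br_P(γ) ≠ 0`. -/
structure LocalPoint [IsLocalRing O] (P : Subgroup G) where
  carrier : Set (FixedAlg b P)
  isPoint : IsPoint carrier
  isLocal : ∀ j ∈ carrier, FixedAlg.val j ∉ brauerKer b P

variable {b}
variable {P : Subgroup G}

variable [IsLocalRing O] (γ : LocalPoint b P)

/-- The normalizer `N_G(P_γ)` of a pointed group. -/
def normalizerPt : Subgroup G :=
  Subgroup.normalizer (P : Set G) ⊓
    MulAction.stabilizer G (FixedAlg.val '' γ.carrier : Set (BlockExt b))

/-- `C_H(P)`, as a subgroup of `N_G(P_γ)`. -/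
def centralizerIn : Subgroup (normalizerPt γ) :=
  (H ⊓ Subgroup.centralizer (P : Set G)).subgroupOf (normalizerPt γ)

instance : (centralizerIn γ).Normal where
  conj_mem := fun c hc g => by
    have hc' := Subgroup.mem_subgroupOf.1 hc
    refine Subgroup.mem_subgroupOf.2 ⟨?_, ?_⟩
    · exact (inferInstance : H.Normal).conj_mem _ hc'.1 g
    · refine Subgroup.mem_centralizer_iff.2 ?_
      intro u hu
      have hg : (g : G) ∈ Subgroup.normalizer (P : Set G) := g.2.1
      have h1 : (g : G)⁻¹ * u * g ∈ P := by
        have := (Subgroup.mem_normalizer_iff.1 (inv_mem hg) u).1 hu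
        simpa using this
      have h2 := Subgroup.mem_centralizer_iff.1 hc'.2 _ h1
      have h3 : u * ((g : G) * c * (g : G)⁻¹) =
        g * (((g : G)⁻¹ * u * g) * c) * (g : G)⁻¹ := by group
      change u * ((g : G) * c * (g : G)⁻¹) = ((g : G) * c * (g : G)⁻¹) * u
      rw [h3, h2]; group

/-- The group `E = E_G^{G/H}(P_γ) = N_G(P_γ) ⧸ C_H(P)`. -/
abbrev GroupE : Type v := normalizerPt γ ⧸ centralizerIn γ

/-- `N_G(P_γ)` acts on `B^P` by conjugation. -/
instance : MulSemiringAction (normalizerPt γ) (FixedAlg b P) where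
  smul n a := ⟨(n : G) • FixedAlg.val a,
    BlockExt.smul_mem_component_one b _ a.val_mem, fun u hu => by
      have h : (n : G)⁻¹ * u * n ∈ P := by
        have := (Subgroup.mem_normalizer_iff.1 (inv_mem n.2.1) u).1 hu
        simpa using this
      have h2 : u * (n : G) = n * ((n : G)⁻¹ * u * n) := by group
      rw [← mul_smul, h2, mul_smul, FixedAlg.conj_val h]⟩
  one_smul a := FixedAlg.val_injective (one_smul G (FixedAlg.val a))
  mul_smul m n a := FixedAlg.val_injective (mul_smul (m : G) (n : G) (FixedAlg.val a))
  smul_zero n := FixedAlg.val_injective (smul_zero (n : G))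
  smul_add n x y := FixedAlg.val_injective (smul_add (n : G) (FixedAlg.val x) (FixedAlg.val y))
  smul_one n := FixedAlg.val_injective (smul_one (n : G))
  smul_mul n x y := FixedAlg.val_injective (smul_mul' (n : G) (FixedAlg.val x) (FixedAlg.val y))

theorem val_conj (n : normalizerPt γ) (a : FixedAlg b P) :
    FixedAlg.val (n • a) = (n : G) • FixedAlg.val a := rfl

instance : SMulCommClass (normalizerPt γ) O (FixedAlg b P) where
  smul_comm n r a := FixedAlg.val_injective (smul_comm (n : G) r (FixedAlg.val a))

theorem conj_mem_carrier (n : normalizerPt γ) (j : FixedAlg b P) (hj : j ∈ γ.carrier) :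
    n • j ∈ γ.carrier := by
  have h := MulAction.mem_stabilizer_iff.1 n.2.2
  have h2 : (n : G) • FixedAlg.val j ∈ (FixedAlg.val '' γ.carrier : Set (BlockExt b)) := by
    rw [← h]
    exact Set.smul_mem_smul_set ⟨j, hj, rfl⟩
  obtain ⟨j', hj', h3⟩ := h2
  have : n • j = j' := FixedAlg.val_injective h3.symm
  rw [this]; exact hj'

/-- The simple quotient `B(P_γ) = B^P ⧸ m_γ` of `B^P`. -/
def SimpleQuot : Type (max u v) := FixedAlg b P ⧸ pointIdeal γ.carrier

namespace SimpleQuot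

instance : Ring (SimpleQuot γ) := inferInstanceAs (Ring (FixedAlg b P ⧸ pointIdeal γ.carrier))

/-- The quotient map `B^P → B(P_γ)`. -/
def mk : FixedAlg b P →+* SimpleQuot γ := Ideal.Quotient.mk (pointIdeal γ.carrier)

theorem mk_surjective : Function.Surjective (mk γ) := Ideal.Quotient.mk_surjective

/-- The conjugation with an element of `N_G(P_γ)` on `B(P_γ)`. -/
def conj (n : normalizerPt γ) : SimpleQuot γ →+* SimpleQuot γ :=
  Ideal.quotientMap (pointIdeal γ.carrier)
    (MulSemiringAction.toRingHom (normalizerPt γ) (FixedAlg b P) n)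
    (fun _ ha => smul_mem_pointIdeal n (conj_mem_carrier γ n) ha)

theorem conj_mk (n : normalizerPt γ) (a : FixedAlg b P) : conj γ n (mk γ a) = mk γ (n • a) := rfl

/-- `N_G(P_γ)` acts on `B(P_γ)`. -/
instance : MulSemiringAction (normalizerPt γ) (SimpleQuot γ) where
  smul n x := conj γ n x
  one_smul x := by
    obtain ⟨a, rfl⟩ := mk_surjective γ x
    change conj γ 1 (mk γ a) = mk γ a
    rw [conj_mk, one_smul]
  mul_smul m n x := by
    obtain ⟨a, rfl⟩ := mk_surjective γ x
    change conj γ (m * n) (mk γ a) = conj γ m (conj γ n (mk γ a))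
    rw [conj_mk, conj_mk, conj_mk, mul_smul]
  smul_zero n := map_zero (conj γ n)
  smul_add n := map_add (conj γ n)
  smul_one n := map_one (conj γ n)
  smul_mul n := map_mul (conj γ n)

theorem smul_mk (n : normalizerPt γ) (a : FixedAlg b P) : n • mk γ a = mk γ (n • a) := rfl

instance algebraBase : Algebra O (SimpleQuot γ) :=
  inferInstanceAs (Algebra O (FixedAlg b P ⧸ pointIdeal γ.carrier))

theorem algebraMap_eq_zero [IsNoetherianRing O] [Finite G] (r : O)
    (hr : r ∈ IsLocalRing.maximalIdeal O) : algebraMap O (SimpleQuot γ) r = 0 :=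
  Ideal.Quotient.eq_zero_iff_mem.2 (algebraMap_mem_pointIdeal γ.isPoint hr)

/-- `B(P_γ)` is an algebra over the residue field `k` of `O`. -/
instance algebraResidue [IsNoetherianRing O] [Finite G] :
    Algebra (IsLocalRing.ResidueField O) (SimpleQuot γ) :=
  residueAlgebra (algebraMap_eq_zero γ)

theorem residue_smul_mk [IsNoetherianRing O] [Finite G] (r : O) (a : FixedAlg b P) :
    IsLocalRing.residue O r • mk γ a = mk γ (r • a) := by
  rw [Algebra.smul_def, Algebra.smul_def, map_mul]
  rfl

instance [IsNoetherianRing O] [Finite G] :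
    SMulCommClass (normalizerPt γ) (IsLocalRing.ResidueField O) (SimpleQuot γ) where
  smul_comm n c x := by
    obtain ⟨r, rfl⟩ := IsLocalRing.residue_surjective c
    obtain ⟨a, rfl⟩ := mk_surjective γ x
    rw [residue_smul_mk, smul_mk, smul_mk, residue_smul_mk, smul_comm]

/-- The structural map `C_H(P) → B(P_γ)`, `c ↦ c b`. -/
def str (c : centralizerIn γ) : SimpleQuot γ :=
  mk γ ⟨BlockExt.str b (c : normalizerPt γ), by
    have hc := Subgroup.mem_subgroupOf.1 c.2
    refine ⟨?_, fun u hu => ?_⟩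
    · have h := BlockExt.str_mem_component b (H := H) ((c : normalizerPt γ) : G)
      rwa [(QuotientGroup.eq_one_iff _).2 hc.1] at h
    · rw [BlockExt.conj_def, ← map_mul, ← map_mul, Subgroup.mem_centralizer_iff.1 hc.2 u hu,
        mul_inv_cancel_right]⟩

end SimpleQuot

/-- The crossed product `B(P_γ) * E`. -/
abbrev CrossedE : Type (max u v) := CrossedProduct (centralizerIn γ) (SimpleQuot.str γ)

variable (V : Type w) [AddCommGroup V] [Module (SimpleQuot γ) V]

/-- The `B(P_γ) * E`-module `(B(P_γ) * E) ⊗_{B(P_γ)} V`. -/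
abbrev InducedE : Type (max (max u v) w) :=
  Induced (CrossedProduct.incl (centralizerIn γ) (SimpleQuot.str γ)) V

/-- The component of degree `e` of `(B(P_γ) * E) ⊗_{B(P_γ)} V`. -/
def inducedComponent (e : GroupE γ) : AddSubgroup (InducedE γ V) :=
  AddSubgroup.closure
    {m | ∃ x ∈ CrossedProduct.component (centralizerIn γ) (SimpleQuot.str γ) e, ∃ y : V,
      m = Induced.tmul _ V x y}

/-- The `k`-algebra `Ē = End_{B(P_γ) * E}((B(P_γ) * E) ⊗_{B(P_γ)} V)ᵒᵖ`. -/
abbrev BarE : Type (max (max u v) w) := (Module.End (CrossedE γ) (InducedE γ V))ᵐᵒᵖ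

theorem smul_mem_inducedComponent [IsNoetherianRing O] [Finite G] (e : GroupE γ)
    (c : IsLocalRing.ResidueField O) {m : InducedE γ V} (hm : m ∈ inducedComponent γ V e) :
    c • m ∈ inducedComponent γ V e := by
  refine AddSubgroup.closure_induction (p := fun m _ => c • m ∈ inducedComponent γ V e)
    ?_ ?_ ?_ ?_ hm
  · rintro _ ⟨x, hx, y, rfl⟩
    refine AddSubgroup.subset_closure ⟨c • x, CrossedProduct.smul_mem_component _ _ e c hx, y, ?_⟩
    rw [Induced.smul_def, Induced.smul_tmul, Algebra.smul_def]
  · rw [smul_zero]; exact zero_mem _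
  · intro x y _ _ hx hy
    rw [smul_add]; exact add_mem hx hy
  · intro x _ hx
    rw [smul_neg]; exact neg_mem hx

/-- The component of degree `e` of `Ē`: the endomorphisms which map the component of degree `x` of
the induced module to the component of degree `x e`, for all `x ∈ E`. -/
def barEComponent [IsNoetherianRing O] [Finite G] (e : GroupE γ) :
    Submodule (IsLocalRing.ResidueField O) (BarE γ V) where
  carrier := {f | ∀ x : GroupE γ, ∀ m ∈ inducedComponent γ V x,
    f.unop m ∈ inducedComponent γ V (x * e)}
  add_mem' := fun hf hg x m hm => add_mem (hf x m hm) (hg x m hm)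
  zero_mem' := fun _ _ _ => zero_mem _
  smul_mem' := fun c _ hf x m hm => smul_mem_inducedComponent γ V _ c (hf x m hm)

end Points

section Fusions

variable {b : InvariantBlock O H} [H.Normal] {P : Subgroup G} (i : FixedAlg b P)

/-- The left `A`-module `Ai`. -/
def leftMod : Submodule (BlockExt b) (BlockExt b) :=
  Submodule.span (BlockExt b) {FixedAlg.val i}

theorem mul_str_mem {u : G} (hu : u ∈ P) {a : BlockExt b} (ha : a ∈ leftMod i) :
    a * BlockExt.str b u ∈ leftMod i := by
  obtain ⟨c, rfl⟩ := Submodule.mem_span_singleton.1 ha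
  refine Submodule.mem_span_singleton.2 ⟨c * BlockExt.str b u, ?_⟩
  rw [smul_eq_mul, smul_eq_mul, mul_assoc, mul_assoc, FixedAlg.val_mul_str hu]

/-- The right multiplication with `u ∈ P` on `Ai`. -/
def rightMul (u : P) : leftMod i →ₗ[BlockExt b] leftMod i where
  toFun a := ⟨(a : BlockExt b) * BlockExt.str b (u : G), mul_str_mem i u.2 a.2⟩
  map_add' x y := Subtype.ext (add_mul (x : BlockExt b) y _)
  map_smul' c x := Subtype.ext (mul_assoc c (x : BlockExt b) _)

/-- `f` is an isomorphism `Ai ≃ (Ai)(x⁻¹)_φ` of `G ⧸ H`-graded `(A, OP)`-bimodules. Here `M_φ` has the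
right action `m · u = m φ(u)`, and `M(x⁻¹)` has the components `M(x⁻¹)_y = M_{y x⁻¹}`. -/
def IsFusionIso (φ : MulAut P) (x : G ⧸ H) (f : leftMod i ≃ₗ[BlockExt b] leftMod i) : Prop :=
  (∀ (u : P) (m : leftMod i), f (rightMul i u m) = rightMul i (φ u) (f m)) ∧
  ∀ (y : G ⧸ H) (m : leftMod i), (m : BlockExt b) ∈ BlockExt.component b y ↔
    (f m : BlockExt b) ∈ BlockExt.component b (y * x⁻¹)

/-- The group `F = F_A^{G/H}(P_γ)` of `(A, G ⧸ H)`-fusions of `P_γ`, for `i ∈ γ`: the pairs `(φ, x)` in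
`Aut(P) × G ⧸ H` with `φ(u) H = x (u H) x⁻¹` for `u ∈ P`, such that `Ai ≃ (Ai)(x⁻¹)_φ` as
`G ⧸ H`-graded `(A, OP)`-bimodules. -/
def GroupF : Subgroup (MulAut P × G ⧸ H) where
  carrier := {s | (∀ u : P, (((s.1 u : P) : G) : G ⧸ H) = s.2 * ((u : G) : G ⧸ H) * s.2⁻¹) ∧
    ∃ f : leftMod i ≃ₗ[BlockExt b] leftMod i, IsFusionIso i s.1 s.2 f}
  mul_mem' := by
    rintro ⟨φ, x⟩ ⟨ψ, y⟩ ⟨h1, f, hf1, hf2⟩ ⟨h2, g, hg1, hg2⟩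
    refine ⟨fun u => ?_, g.trans f, fun u m => ?_, fun z m => ?_⟩
    · have h3 := h1 (ψ u)
      have h4 := h2 u
      dsimp only [Prod.fst_mul, Prod.snd_mul, MulAut.mul_apply] at h3 h4 ⊢
      rw [h3, h4]; group
    · change f (g (rightMul i u m)) = rightMul i (φ (ψ u)) (f (g m))
      rw [hg1, hf1]
    · rw [hg2, hf2]
      dsimp only [Prod.snd_mul]
      rw [mul_inv_rev, mul_assoc]
      rfl
  one_mem' := by
    refine ⟨fun u => by simp, LinearEquiv.refl _ _, fun u m => rfl, fun z m => ?_⟩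
    dsimp only [Prod.snd_one]
    rw [inv_one, mul_one]
    rfl
  inv_mem' := by
    rintro ⟨φ, x⟩ ⟨h1, f, hf1, hf2⟩
    refine ⟨fun u => ?_, f.symm, fun u m => ?_, fun z m => ?_⟩
    · have h3 := h1 (φ⁻¹ u)
      dsimp only [Prod.fst_inv, Prod.snd_inv] at h3 ⊢
      rw [MulAut.apply_inv_self] at h3
      rw [h3]; group
    · dsimp only [Prod.fst_inv]
      rw [LinearEquiv.symm_apply_eq, hf1, MulAut.apply_inv_self, LinearEquiv.apply_symm_apply]
    · have h3 := hf2 (z * x) (f.symm m)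
      rw [LinearEquiv.apply_symm_apply, mul_inv_cancel_right] at h3
      dsimp only [Prod.snd_inv]
      rw [inv_inv]
      exact h3.symm

/-- The action of `F` on `P` through the first component. -/
def actF : GroupF i →* MulAut P :=
  (MonoidHom.fst (MulAut P) (G ⧸ H)).comp (GroupF i).subtype

/-- The skew group algebra `C = OP * F`, realized as the group algebra of the semidirect product
`P ⋊ F`: the element `u ⊗ φ` of `OP * F` is the group element `(u, φ)`. -/
abbrev AlgC : Type (max u v) := MonoidAlgebra O (P ⋊[actF i] GroupF i)

/-- The degree of `(u, (φ, x))` in `G ⧸ H` is `(u H) x`; this makes `C` a `G ⧸ H`-graded algebra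
which contains `OP` as a graded subalgebra. -/
def degC (s : P ⋊[actF i] GroupF i) : G ⧸ H := ((s.left : G) : G ⧸ H) * (s.right : MulAut P × G ⧸ H).2

/-- The `A`-submodule of `Ai ⊗_O C` spanned by the elements `(m u) ⊗ c - m ⊗ (u c)` with `u ∈ P`. -/
def tensorRel : Submodule (BlockExt b) (leftMod i ⊗[O] AlgC i) :=
  Submodule.span (BlockExt b) {t | ∃ (m : leftMod i) (u : P) (c : AlgC i),
    t = rightMul i u m ⊗ₜ[O] c - m ⊗ₜ[O] (MonoidAlgebra.single (SemidirectProduct.inl u) 1 * c)}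

/-- The left `A`-module `Ai ⊗_{OP} C`. -/
def TensorC : Type (max u v) := (leftMod i ⊗[O] AlgC i) ⧸ tensorRel i

namespace TensorC

instance : AddCommGroup (TensorC i) :=
  inferInstanceAs (AddCommGroup ((leftMod i ⊗[O] AlgC i) ⧸ tensorRel i))
instance : Module (BlockExt b) (TensorC i) :=
  inferInstanceAs (Module (BlockExt b) ((leftMod i ⊗[O] AlgC i) ⧸ tensorRel i))
instance : Module O (TensorC i) :=
  inferInstanceAs (Module O ((leftMod i ⊗[O] AlgC i) ⧸ tensorRel i))
instance : IsScalarTower O (BlockExt b) (TensorC i) :=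
  inferInstanceAs (IsScalarTower O (BlockExt b) ((leftMod i ⊗[O] AlgC i) ⧸ tensorRel i))
instance : SMulCommClass (BlockExt b) O (TensorC i) := inferInstance

instance [IsNoetherianRing O] [Finite G] : Module.Finite O (TensorC i) := by
  have h1 : Module.Finite O (leftMod i) :=
    inferInstanceAs (Module.Finite O ((leftMod i).restrictScalars O))
  have h2 : Finite (P ⋊[actF i] GroupF i) := Finite.of_equiv _ SemidirectProduct.equivProd.symm
  have h3 : Module.Finite O (leftMod i ⊗[O] AlgC i) := inferInstance
  exact inferInstanceAs
    (Module.Finite O ((leftMod i ⊗[O] AlgC i) ⧸ (tensorRel i).restrictScalars O))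

/-- The element `m ⊗ c` of `Ai ⊗_{OP} C`. -/
def tmul (m : leftMod i) (c : AlgC i) : TensorC i := (tensorRel i).mkQ (m ⊗ₜ[O] c)

/-- The `A`-linear endomorphism `m ⊗ c ↦ m ⊗ h c` of `Ai ⊗_{OP} C` induced by an `O`-linear map `h`
which commutes with the left multiplications by the elements of `P`. -/
def lift (h : AlgC i →ₗ[O] AlgC i)
    (hh : ∀ (u : P) (c : AlgC i), h (MonoidAlgebra.single (SemidirectProduct.inl u) 1 * c) =
      MonoidAlgebra.single (SemidirectProduct.inl u) 1 * h c) :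
    TensorC i →ₗ[BlockExt b] TensorC i :=
  Submodule.mapQ (tensorRel i) (tensorRel i)
    (TensorProduct.AlgebraTensorModule.lTensor (BlockExt b) (leftMod i) h) (by
      refine Submodule.span_le.2 ?_
      rintro _ ⟨m, u, c, rfl⟩
      refine Submodule.subset_span ⟨m, u, h c, ?_⟩
      rw [map_sub]
      change rightMul i u m ⊗ₜ[O] h c - m ⊗ₜ[O] h _ = _
      rw [hh])

theorem lift_tmul (h : AlgC i →ₗ[O] AlgC i) (hh) (m : leftMod i) (c : AlgC i) :
    lift i h hh (tmul i m c) = tmul i m (h c) := rfl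

/-- The right multiplication with `c ∈ C` on `Ai ⊗_{OP} C`. -/
def rightMulC (c : AlgC i) : TensorC i →ₗ[BlockExt b] TensorC i :=
  lift i (LinearMap.mulRight O c) (fun _ _ => mul_assoc _ _ _)

theorem rightMulC_tmul (m : leftMod i) (c d : AlgC i) :
    rightMulC i c (tmul i m d) = tmul i m (d * c) := rfl

theorem induction {p : TensorC i → Prop} (h0 : p 0) (hadd : ∀ x y, p x → p y → p (x + y))
    (hsmul : ∀ (r : O) x, p x → p (r • x))
    (htmul : ∀ (m : leftMod i) (s : P ⋊[actF i] GroupF i), p (tmul i m (MonoidAlgebra.single s 1)))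
    (t : TensorC i) : p t := by
  obtain ⟨t, rfl⟩ := (tensorRel i).mkQ_surjective t
  induction t using TensorProduct.induction_on with
  | zero => exact h0
  | add x y hx hy => rw [map_add]; exact hadd _ _ hx hy
  | tmul m c =>
    induction c using MonoidAlgebra.induction_on with
    | of s => exact htmul m s
    | add x y hx hy => rw [TensorProduct.tmul_add, map_add]; exact hadd _ _ hx hy
    | smul r x hx =>
      rw [TensorProduct.tmul_smul, LinearMap.map_smul_of_tower]; exact hsmul _ _ hx

/-- The component of degree `ψ ∈ F` of `Ai ⊗_{OP} C`, spanned by the elements `m ⊗ (u, ψ)`. -/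
def componentF (ψ : GroupF i) : Submodule O (TensorC i) :=
  Submodule.span O {t | ∃ (m : leftMod i) (s : P ⋊[actF i] GroupF i), s.right = ψ ∧
    t = tmul i m (MonoidAlgebra.single s 1)}

/-- The component of degree `x ∈ G ⧸ H` of the graded `(A, C)`-bimodule `Ai ⊗_{OP} C`, spanned by the
elements `m ⊗ s`, with homogeneous `m ∈ Ai` and `s ∈ P ⋊ F` whose degrees have product `x`. -/
def componentG (x : G ⧸ H) : Submodule O (TensorC i) :=
  Submodule.span O {t | ∃ (m : leftMod i) (y : G ⧸ H) (s : P ⋊[actF i] GroupF i),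
    (m : BlockExt b) ∈ BlockExt.component b y ∧ y * degC i s = x ∧
    t = tmul i m (MonoidAlgebra.single s 1)}

open Classical in
/-- The projection of `C` onto the span of the elements `(u, ψ)`, for a given `ψ`. -/
def projC (ψ : GroupF i) : AlgC i →ₗ[O] AlgC i :=
  (Finsupp.lsum O fun s : P ⋊[actF i] GroupF i =>
    if s.right = ψ then (MonoidAlgebra.coeffLinearEquiv O).symm.toLinearMap ∘ₗ Finsupp.lsingle s
    else 0) ∘ₗ (MonoidAlgebra.coeffLinearEquiv O).toLinearMap

open Classical in
theorem projC_single (ψ : GroupF i) (s : P ⋊[actF i] GroupF i) (r : O) :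
    projC i ψ (MonoidAlgebra.single s r) =
      if s.right = ψ then MonoidAlgebra.single s r else 0 := by
  have h : (MonoidAlgebra.coeffLinearEquiv O (MonoidAlgebra.single s r)) =
    Finsupp.single s r := rfl
  change Finsupp.lsum O _ (MonoidAlgebra.coeffLinearEquiv O (MonoidAlgebra.single s r)) = _
  rw [h, Finsupp.lsum_single]
  split_ifs <;> rfl

theorem projC_inl_mul (ψ : GroupF i) (u : P) (c : AlgC i) :
    projC i ψ (MonoidAlgebra.single (SemidirectProduct.inl u) 1 * c) =
      MonoidAlgebra.single (SemidirectProduct.inl u) 1 * projC i ψ c := by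
  induction c using MonoidAlgebra.induction_on with
  | of s =>
    rw [MonoidAlgebra.of_apply, MonoidAlgebra.single_mul_single, projC_single, projC_single,
      SemidirectProduct.mul_right, SemidirectProduct.right_inl, one_mul]
    split_ifs
    · rw [MonoidAlgebra.single_mul_single]
    · rw [mul_zero]
  | add x y hx hy => rw [mul_add, map_add, map_add, mul_add, hx, hy]
  | smul r x hx => rw [mul_smul_comm, map_smul, map_smul, mul_smul_comm, hx]

/-- The projection of `Ai ⊗_{OP} C` onto its component of degree `ψ ∈ F`. -/
def proj (ψ : GroupF i) : TensorC i →ₗ[BlockExt b] TensorC i :=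
  lift i (projC i ψ) (projC_inl_mul i ψ)

open Classical in
theorem proj_tmul (ψ : GroupF i) (m : leftMod i) (s : P ⋊[actF i] GroupF i) :
    proj i ψ (tmul i m (MonoidAlgebra.single s 1)) =
      if s.right = ψ then tmul i m (MonoidAlgebra.single s 1) else 0 := by
  change tmul i m (projC i ψ (MonoidAlgebra.single s 1)) = _
  rw [projC_single]
  split_ifs
  · rfl
  · change (tensorRel i).mkQ (m ⊗ₜ[O] 0) = 0
    rw [TensorProduct.tmul_zero, map_zero]

theorem proj_mem (ψ : GroupF i) (t : TensorC i) : proj i ψ t ∈ componentF i ψ := by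
  classical
  induction t using TensorC.induction with
  | h0 => rw [map_zero]; exact zero_mem _
  | hadd x y hx hy => rw [map_add]; exact add_mem hx hy
  | hsmul r x hx => rw [LinearMap.map_smul_of_tower]; exact Submodule.smul_mem _ r hx
  | htmul m s =>
    rw [proj_tmul]
    split_ifs with h
    · exact Submodule.subset_span ⟨m, s, h, rfl⟩
    · exact zero_mem _

open Classical in
theorem proj_of_mem (ψ χ : GroupF i) {t : TensorC i} (ht : t ∈ componentF i χ) :
    proj i ψ t = if χ = ψ then t else 0 := by
  refine Submodule.span_induction (p := fun t _ => proj i ψ t = if χ = ψ then t else 0)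
    ?_ ?_ ?_ ?_ ht
  · rintro _ ⟨m, s, rfl, rfl⟩
    exact proj_tmul i ψ m s
  · rw [map_zero, ite_self]
  · intro x y _ _ hx hy
    rw [map_add, hx, hy]
    split_ifs
    · rfl
    · rw [add_zero]
  · intro r x _ hx
    rw [LinearMap.map_smul_of_tower, hx]
    split_ifs
    · rfl
    · rw [smul_zero]

theorem proj_mem_componentG (ψ : GroupF i) (x : G ⧸ H) {t : TensorC i}
    (ht : t ∈ componentG i x) : proj i ψ t ∈ componentG i x := by
  classical
  refine Submodule.span_induction (p := fun t _ => proj i ψ t ∈ componentG i x) ?_ ?_ ?_ ?_ ht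
  · rintro _ ⟨m, y, s, hm, hx, rfl⟩
    rw [proj_tmul]
    split_ifs
    · exact Submodule.subset_span ⟨m, y, s, hm, hx, rfl⟩
    · exact zero_mem _
  · rw [map_zero]; exact zero_mem _
  · intro x y _ _ hx hy
    rw [map_add]; exact add_mem hx hy
  · intro r x _ hx
    rw [LinearMap.map_smul_of_tower]; exact Submodule.smul_mem _ r hx

theorem sum_proj [Fintype (GroupF i)] (t : TensorC i) : ∑ ψ, proj i ψ t = t := by
  classical
  induction t using TensorC.induction with
  | h0 => simp
  | hadd x y hx hy => simp only [map_add, Finset.sum_add_distrib, hx, hy]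
  | hsmul r x hx =>
    simp only [LinearMap.map_smul_of_tower]
    rw [← Finset.smul_sum, hx]
  | htmul m s =>
    simp only [proj_tmul]
    rw [Finset.sum_ite_eq, if_pos (Finset.mem_univ _)]

theorem proj_rightMulC (ψ : GroupF i) (s : P ⋊[actF i] GroupF i) (t : TensorC i) :
    proj i ψ (rightMulC i (MonoidAlgebra.single s 1) t) =
      rightMulC i (MonoidAlgebra.single s 1) (proj i (ψ * s.right⁻¹) t) := by
  classical
  induction t using TensorC.induction with
  | h0 => simp
  | hadd x y hx hy => simp only [map_add, hx, hy]
  | hsmul r x hx => simp only [LinearMap.map_smul_of_tower, hx]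
  | htmul m s' =>
    rw [rightMulC_tmul, MonoidAlgebra.single_mul_single, mul_one, proj_tmul, proj_tmul,
      SemidirectProduct.mul_right]
    by_cases h : s'.right = ψ * s.right⁻¹
    · rw [if_pos h, if_pos (by rw [h, inv_mul_cancel_right]), rightMulC_tmul,
        MonoidAlgebra.single_mul_single, mul_one]
    · rw [if_neg h, if_neg (fun h' => h (by rw [← h', mul_inv_cancel_right])), map_zero]

theorem rightMulC_add (c d : AlgC i) (t : TensorC i) :
    rightMulC i (c + d) t = rightMulC i c t + rightMulC i d t := by
  induction t using TensorC.induction with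
  | h0 => simp
  | hadd x y hx hy => simp only [map_add, hx, hy]; abel
  | hsmul r x hx => simp only [LinearMap.map_smul_of_tower, hx, smul_add]
  | htmul m s =>
    rw [rightMulC_tmul, rightMulC_tmul, rightMulC_tmul, mul_add]
    change (tensorRel i).mkQ (m ⊗ₜ[O] _) = _
    rw [TensorProduct.tmul_add, map_add]
    rfl

theorem rightMulC_smul (r : O) (c : AlgC i) (t : TensorC i) :
    rightMulC i (r • c) t = r • rightMulC i c t := by
  induction t using TensorC.induction with
  | h0 => simp
  | hadd x y hx hy => simp only [map_add, hx, hy, smul_add]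
  | hsmul r x hx => simp only [LinearMap.map_smul_of_tower, hx]; exact smul_comm _ _ _
  | htmul m s =>
    rw [rightMulC_tmul, rightMulC_tmul, mul_smul_comm]
    change (tensorRel i).mkQ (m ⊗ₜ[O] _) = _
    rw [TensorProduct.tmul_smul, LinearMap.map_smul_of_tower]
    rfl

end TensorC

/-- The algebra `𝓕` of the `(A, C)`-bimodule endomorphisms of `Ai ⊗_{OP} C` that preserve the
`G ⧸ H`-grading, with the opposite multiplication. -/
def frakFSubalgebra : Subalgebra O (Module.End (BlockExt b) (TensorC i))ᵐᵒᵖ where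
  carrier := {f | (∀ (c : AlgC i) (t : TensorC i),
      f.unop (TensorC.rightMulC i c t) = TensorC.rightMulC i c (f.unop t)) ∧
    ∀ (x : G ⧸ H), ∀ t ∈ TensorC.componentG i x, f.unop t ∈ TensorC.componentG i x}
  mul_mem' := fun {f g} hf hg => ⟨fun c t => by
      change g.unop (f.unop _) = _
      rw [hf.1, hg.1]; rfl,
    fun x t ht => hg.2 x _ (hf.2 x t ht)⟩
  add_mem' := fun {f g} hf hg => ⟨fun c t => by
      change f.unop _ + g.unop _ = TensorC.rightMulC i c (f.unop t + g.unop t)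
      rw [hf.1, hg.1, map_add],
    fun x t ht => add_mem (hf.2 x t ht) (hg.2 x t ht)⟩
  algebraMap_mem' := fun r => ⟨fun c t => by
      change r • TensorC.rightMulC i c t = TensorC.rightMulC i c (r • t)
      rw [LinearMap.map_smul_of_tower],
    fun x t ht => Submodule.smul_mem _ r ht⟩

/-- The `O`-algebra `𝓕 = End_{A-Gr ⊗ C^op}(Ai ⊗_{OP} C)ᵒᵖ`. -/
def FrakF : Type (max u v) := ↥(frakFSubalgebra i)

namespace FrakF

instance : Ring (FrakF i) := inferInstanceAs (Ring ↥(frakFSubalgebra i))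
instance : Algebra O (FrakF i) := inferInstanceAs (Algebra O ↥(frakFSubalgebra i))

variable {i}

/-- An element of `𝓕` as an endomorphism of `Ai ⊗_{OP} C`. -/
def toEnd (f : FrakF i) : TensorC i →ₗ[BlockExt b] TensorC i := f.1.unop

theorem toEnd_mul (f g : FrakF i) : toEnd (f * g) = toEnd g ∘ₗ toEnd f := rfl

variable (i)

/-- The component of degree `φ ∈ F` of `𝓕`: the endomorphisms which map the component of degree `ψ`
of `Ai ⊗_{OP} C` to the component of degree `φ⁻¹ ψ`, for all `ψ ∈ F`. Since multiplication in `𝓕` is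
opposite to composition, the product of elements of degrees `φ` and `φ'` has degree `φ φ'`. -/
def component (φ : GroupF i) : Submodule O (FrakF i) where
  carrier := {f | ∀ ψ : GroupF i, ∀ t ∈ TensorC.componentF i ψ,
    toEnd f t ∈ TensorC.componentF i (φ⁻¹ * ψ)}
  add_mem' := fun hf hg ψ t ht => add_mem (hf ψ t ht) (hg ψ t ht)
  zero_mem' := fun _ _ _ => zero_mem _
  smul_mem' := fun r _ hf ψ t ht => Submodule.smul_mem _ r (hf ψ t ht)

instance [IsNoetherianRing O] [Finite G] : Module.Finite O (FrakF i) := by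
  let h : FrakF i →ₗ[O] (TensorC i →ₗ[O] TensorC i) :=
    { toFun := fun f => (toEnd f).restrictScalars O
      map_add' := fun _ _ => rfl
      map_smul' := fun _ _ => rfl }
  refine Module.Finite.of_injective h fun f g hfg => ?_
  refine Subtype.ext (MulOpposite.unop_injective (LinearMap.ext fun t => ?_))
  exact LinearMap.congr_fun hfg t

theorem unop_eq_sum [Fintype (GroupF i)] (f : FrakF i) (t : TensorC i) :
    ∑ φ : GroupF i, ∑ ψ : GroupF i, TensorC.proj i (φ⁻¹ * ψ) (toEnd f (TensorC.proj i ψ t)) =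
      toEnd f t := by
  rw [Finset.sum_comm]
  have h : ∀ ψ : GroupF i, ∑ φ : GroupF i,
      TensorC.proj i (φ⁻¹ * ψ) (toEnd f (TensorC.proj i ψ t)) =
        toEnd f (TensorC.proj i ψ t) := by
    intro ψ
    rw [← TensorC.sum_proj i (toEnd f (TensorC.proj i ψ t))]
    refine Fintype.sum_equiv ((Equiv.inv _).trans (Equiv.mulRight ψ)) _ _ fun φ => ?_
    rw [TensorC.sum_proj]
    rfl
  rw [Finset.sum_congr rfl fun ψ _ => h ψ, ← map_sum, TensorC.sum_proj]

/-- The homogeneous part of degree `φ` of an element of `𝓕`. -/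
def part [Fintype (GroupF i)] (φ : GroupF i) (f : FrakF i) : FrakF i :=
  ⟨MulOpposite.op (∑ ψ : GroupF i, TensorC.proj i (φ⁻¹ * ψ) ∘ₗ toEnd f ∘ₗ TensorC.proj i ψ), by
    constructor
    · intro c t
      change (∑ ψ : GroupF i, TensorC.proj i (φ⁻¹ * ψ) ∘ₗ toEnd f ∘ₗ TensorC.proj i ψ) _ =
        TensorC.rightMulC i c
          ((∑ ψ : GroupF i, TensorC.proj i (φ⁻¹ * ψ) ∘ₗ toEnd f ∘ₗ TensorC.proj i ψ) t)
      have hf : ∀ (c : AlgC i) (t : TensorC i),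
        toEnd f (TensorC.rightMulC i c t) = TensorC.rightMulC i c (toEnd f t) := f.2.1
      induction c using MonoidAlgebra.induction_on with
      | of s =>
        simp only [LinearMap.sum_apply, LinearMap.comp_apply, MonoidAlgebra.of_apply, map_sum]
        refine Fintype.sum_equiv (Equiv.mulRight s.right⁻¹) _ _ fun ψ => ?_
        rw [TensorC.proj_rightMulC, hf, TensorC.proj_rightMulC, Equiv.coe_mulRight, mul_assoc]
      | add x y hx hy =>
        rw [TensorC.rightMulC_add, TensorC.rightMulC_add, map_add, hx, hy]
      | smul r x hx =>
        rw [TensorC.rightMulC_smul, TensorC.rightMulC_smul, LinearMap.map_smul_of_tower, hx]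
    · intro x t ht
      change (∑ ψ : GroupF i, TensorC.proj i (φ⁻¹ * ψ) ∘ₗ toEnd f ∘ₗ TensorC.proj i ψ) t ∈ _
      rw [LinearMap.sum_apply]
      exact sum_mem fun ψ _ => TensorC.proj_mem_componentG i _ x
        (f.2.2 x _ (TensorC.proj_mem_componentG i ψ x ht))⟩

theorem toEnd_part [Fintype (GroupF i)] (φ : GroupF i) (f : FrakF i) (t : TensorC i) :
    toEnd (part i φ f) t =
      ∑ ψ : GroupF i, TensorC.proj i (φ⁻¹ * ψ) (toEnd f (TensorC.proj i ψ t)) := by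
  change (∑ ψ : GroupF i, TensorC.proj i (φ⁻¹ * ψ) ∘ₗ toEnd f ∘ₗ TensorC.proj i ψ) t = _
  rw [LinearMap.sum_apply]
  rfl

theorem part_mem [Fintype (GroupF i)] (φ : GroupF i) (f : FrakF i) :
    part i φ f ∈ component i φ := by
  classical
  intro χ t ht
  rw [toEnd_part, Finset.sum_eq_single χ]
  · exact TensorC.proj_mem i _ _
  · intro ψ _ hψ
    rw [TensorC.proj_of_mem i ψ χ ht, if_neg (Ne.symm hψ), map_zero, map_zero]
  · intro h
    exact absurd (Finset.mem_univ χ) h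

/-- The inclusion of `𝓕` into the endomorphisms, as an additive map. -/
def toEndHom : FrakF i →+ (TensorC i →ₗ[BlockExt b] TensorC i) where
  toFun := toEnd
  map_zero' := rfl
  map_add' _ _ := rfl

theorem sum_part [Fintype (GroupF i)] (f : FrakF i) : ∑ φ, part i φ f = f := by
  refine Subtype.ext (MulOpposite.unop_injective (LinearMap.ext fun t => ?_))
  change toEndHom i (∑ φ, part i φ f) t = toEnd f t
  rw [map_sum, LinearMap.sum_apply, ← unop_eq_sum]
  exact Finset.sum_congr rfl fun φ _ => toEnd_part i φ f t

theorem iSup_component [Finite G] : ⨆ φ, component i φ = ⊤ := by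
  have := Fintype.ofFinite (GroupF i)
  refine eq_top_iff.2 fun f _ => ?_
  rw [← sum_part i f]
  exact sum_mem fun φ _ => Submodule.mem_iSup_of_mem φ (part_mem i φ f)

end FrakF

/-- The algebra `F̄ = 𝓕 ⧸ J_gr(𝓕)`. -/
def BarF : Type (max u v) := FrakF i ⧸ gradedJacobson (FrakF.component i)

namespace BarF

instance : Ring (BarF i) := inferInstanceAs (Ring (FrakF i ⧸ gradedJacobson (FrakF.component i)))

instance algebraBase : Algebra O (BarF i) :=
  inferInstanceAs (Algebra O (FrakF i ⧸ gradedJacobson (FrakF.component i)))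

/-- The quotient map `𝓕 → 𝓕 ⧸ J_gr(𝓕)`. -/
def mk : FrakF i →ₐ[O] BarF i := Ideal.Quotient.mkₐ O (gradedJacobson (FrakF.component i))

theorem algebraMap_eq_zero [IsLocalRing O] [IsNoetherianRing O] [Finite G] (r : O)
    (hr : r ∈ IsLocalRing.maximalIdeal O) : algebraMap O (BarF i) r = 0 :=
  Ideal.Quotient.eq_zero_iff_mem.2
    (algebraMap_mem_gradedJacobson _ (FrakF.iSup_component i) hr)

/-- `F̄` is an algebra over the residue field `k` of `O`. -/
instance algebraResidue [IsLocalRing O] [IsNoetherianRing O] [Finite G] :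
    Algebra (IsLocalRing.ResidueField O) (BarF i) :=
  residueAlgebra (algebraMap_eq_zero i)

theorem residue_smul [IsLocalRing O] [IsNoetherianRing O] [Finite G] (r : O) (x : BarF i) :
    IsLocalRing.residue O r • x = r • x := by
  rw [Algebra.smul_def, Algebra.smul_def]
  rfl

/-- The component of degree `φ ∈ F` of `F̄`: the image of the component of degree `φ` of `𝓕`. -/
def component [IsLocalRing O] [IsNoetherianRing O] [Finite G] (φ : GroupF i) :
    Submodule (IsLocalRing.ResidueField O) (BarF i) where
  carrier := {x | ∃ f ∈ FrakF.component i φ, mk i f = x}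
  add_mem' := by
    rintro _ _ ⟨f, hf, rfl⟩ ⟨g, hg, rfl⟩
    exact ⟨f + g, add_mem hf hg, map_add _ _ _⟩
  zero_mem' := ⟨0, zero_mem _, map_zero _⟩
  smul_mem' := by
    rintro c _ ⟨f, hf, rfl⟩
    obtain ⟨r, rfl⟩ := IsLocalRing.residue_surjective c
    exact ⟨r • f, Submodule.smul_mem _ r hf, by rw [residue_smul, map_smul]⟩

end BarF

end Fusions

end Block

end BlockExtension

end

/-! Write N = Ai ⊗_{OP} C, and let T (`TensorC.fixed`) be the set of all t in N of degree 1 in G/H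
with ut = tu for u in P. The proof compares both algebras through the quotient T/m_γT (`BrauerMod`).

The bimodule N is generated by i ⊗ 1, which lies in T. Evaluation at i ⊗ 1 therefore identifies 𝓕
with iT (`FrakF.ext_gen`, `FrakF.ofFixed`). On the other side, T is a B^P-module on which N_G(P_γ)
acts semilinearly by t ↦ g t θ(g)⁻¹. For c in C_H(P) the factor θ(c) is trivial, so c acts as the
element cb of B^P. Hence T/m_γT is a B(P_γ) * E-module, and 𝓕 acts on it by commuting endomorphisms.

The map θ comes from a homomorphism on N_G(P_γ) whose kernel is C_H(P) by inspection. Surjectivity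
(`thetaHom_surjective`) is the Brauer-type step. A fusion is right multiplication by an invertible
element of iAi. Expanding its inverse r over G writes i as a sum of terms permuted by P. Since i is
local with Br_P(i) ≠ 0, some P-fixed term must be invertible in the corner, and its group element g
realizes the fusion.

Because θ is onto, the part of T of degree θ(g)⁻¹ is the g-twist of B^P (i ⊗ 1), a copy of B^P i.
Completeness of O makes the corner ring i B^P i local (`isLocalIdem_of_isPrimitiveIdem`). So modulo
m_γ the module B^P i becomes the simple module V_γ, and T/m_γT is isomorphic to the induced module
M, with degree e in M matching degree θ(e)⁻¹ (`nonempty_comparison`).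

This gives a homomorphism 𝓕 → Ē (`Comparison.barHom`). It is onto, since every element of T
prescribes an element of 𝓕. Its kernel is a graded ideal, and a homogeneous element outside it has a
left inverse by locality (`FrakF.exists_mul_eq_one`). The kernel is thus the largest proper graded
left ideal, which is J_gr(𝓕) (`Comparison.gradedJacobson_eq`). No splitting of the residue field is
needed, because no dimensions are compared. -/

noncomputable section

namespace BlockExtension

open scoped TensorProduct Pointwise

universe u v w

/-! ### Idempotents in finite commutative algebras over a complete local ring. -/

section CompleteAlgebras

/-- A finitely generated module over a complete ring is complete. -/
theorem isPrecomplete_of_finite {O : Type u} [CommRing O] (I : Ideal O) [IsAdicComplete I O]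
    (M : Type v) [AddCommGroup M] [Module O M] [Module.Finite O M] : IsPrecomplete I M := by
  rw [← AdicCompletion.of_surjective_iff]
  intro x
  -- The completion of a finite module M is a quotient of Ô ⊗ M, and Ô is reached from O because O
  -- is complete.
  obtain ⟨t, rfl⟩ := AdicCompletion.ofTensorProduct_surjective_of_finite I M x
  induction t using TensorProduct.induction_on with
  | zero => exact ⟨0, by rw [map_zero, map_zero]⟩
  | add x y hx hy =>
    obtain ⟨a, ha⟩ := hx
    obtain ⟨c, hc⟩ := hy
    exact ⟨a + c, by rw [map_add, map_add, ha, hc]⟩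
  | tmul r m =>
    obtain ⟨s, rfl⟩ := AdicCompletion.of_surjective I O r
    refine ⟨s • m, ?_⟩
    rw [AdicCompletion.ofTensorProduct_tmul, map_smul]
    ext n
    rfl

theorem isAdicComplete_map_algebraMap {O : Type u} [CommRing O] [IsLocalRing O] [IsNoetherianRing O]
    [IsAdicComplete (IsLocalRing.maximalIdeal O) O] (S : Type v) [CommRing S] [Algebra O S]
    [Module.Finite O S] :
    IsAdicComplete ((IsLocalRing.maximalIdeal O).map (algebraMap O S)) S := by
  have h1 := isPrecomplete_of_finite (IsLocalRing.maximalIdeal O) S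
  exact
    { toIsHausdorff := (IsHausdorff.map_algebraMap_iff).2 inferInstance
      toIsPrecomplete := (IsPrecomplete.map_algebraMap_iff).2 h1 }

/-- An element of a commutative Artinian ring is, up to an idempotent, invertible or nilpotent. -/
theorem exists_idempotent_of_isArtinianRing {Q : Type u} [CommRing Q] [IsArtinianRing Q] (x : Q) :
    ∃ (y : Q) (n : ℕ), (x * y) * (x * y) = x * y ∧ x ^ n * (1 - x * y) = 0 := by
  -- The chain of ideals (xⁿ) becomes stationary. The idempotent will be (xz)^(n+1); the exponent n
  -- + 1 rather than n keeps it a multiple of x even for n = 0.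
  obtain ⟨n, z, hz⟩ := IsArtinian.exists_pow_succ_smul_dvd x (1 : Q)
  simp only [smul_eq_mul, mul_one, Nat.succ_eq_add_one] at hz
  have h2 : ∀ m, x ^ n = x ^ (n + m) * z ^ m := by
    intro m
    induction m with
    | zero => simp
    | succ m ih =>
      calc x ^ n = x ^ n * x ^ m * z ^ m := by rw [← pow_add]; exact ih
        _ = x ^ (n + (m + 1)) * z ^ (m + 1) := by rw [← hz]; ring
  have h3 : x ^ (n + 1) * (x * z) ^ (n + 1) = x ^ (n + 1) := by
    have := h2 (n + 1)
    calc x ^ (n + 1) * (x * z) ^ (n + 1) = x * (x ^ (n + (n + 1)) * z ^ (n + 1)) := by ring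
      _ = x ^ (n + 1) := by rw [← this]; ring
  have h4 : x * (z * (x * z) ^ n) = (x * z) ^ (n + 1) := by ring
  refine ⟨z * (x * z) ^ n, n + 1, ?_, ?_⟩
  · rw [h4]
    calc (x * z) ^ (n + 1) * (x * z) ^ (n + 1)
        = (x ^ (n + 1) * (x * z) ^ (n + 1)) * z ^ (n + 1) := by ring
      _ = (x * z) ^ (n + 1) := by rw [h3]; ring
  · rw [h4, mul_sub, h3, mul_one, sub_self]

/-- Hensel's lemma for X² - X. -/
theorem exists_idempotent_lift {S : Type u} [CommRing S] {I : Ideal S} [HenselianRing S I] (a : S)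
    (ha : a * a - a ∈ I) : ∃ e : S, e * e = e ∧ e - a ∈ I := by
  have hmonic : (Polynomial.X ^ 2 - Polynomial.X : Polynomial S).Monic := by
    nontriviality S
    exact Polynomial.monic_X_pow_sub (n := 2) (by simp)
  have ha' : (Ideal.Quotient.mk I a) * Ideal.Quotient.mk I a = Ideal.Quotient.mk I a := by
    rw [← map_mul, ← sub_eq_zero, ← map_sub, Ideal.Quotient.eq_zero_iff_mem]
    exact ha
  obtain ⟨e, he, hee⟩ := HenselianRing.is_henselian (I := I) (Polynomial.X ^ 2 - Polynomial.X)
    hmonic a (by simpa [pow_two] using ha) (by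
      -- The derivative 2a - 1 is its own inverse modulo I, since (2a - 1)² = 1 + 4(a² - a).
      refine IsUnit.of_mul_eq_one (2 * Ideal.Quotient.mk I a - 1) ?_
      simp only [Polynomial.derivative_X_pow, Polynomial.derivative_X,
        Polynomial.eval_sub, Polynomial.eval_mul, Polynomial.eval_pow, Polynomial.eval_X,
        Polynomial.eval_one, map_sub, map_mul, map_one]
      have h2 : Ideal.Quotient.mk I 2 = 2 := map_ofNat _ 2
      simp [h2]
      linear_combination 4 * ha')
  refine ⟨e, ?_, hee⟩
  simp only [Polynomial.IsRoot, Polynomial.eval_sub, Polynomial.eval_pow, Polynomial.eval_X] at he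
  linear_combination he

/-- Over a complete local ring, an element of a finite commutative algebra is, up to an idempotent,
either invertible or nilpotent modulo the maximal ideal. -/
theorem exists_idempotent_pow (O : Type u) [CommRing O] [IsLocalRing O] [IsNoetherianRing O]
    [IsAdicComplete (IsLocalRing.maximalIdeal O) O] {S : Type v} [CommRing S] [Algebra O S]
    [Module.Finite O S] (a : S) :
    ∃ (e y : S) (n : ℕ), e * e = e ∧
      e - a * y ∈ (IsLocalRing.maximalIdeal O).map (algebraMap O S) ∧
      a ^ n * (1 - e) ∈ (IsLocalRing.maximalIdeal O).map (algebraMap O S) := by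
  set I := (IsLocalRing.maximalIdeal O).map (algebraMap O S) with hI
  have hc : IsAdicComplete I S := isAdicComplete_map_algebraMap S
  -- S/I is finite over the residue field.
  have hart : IsArtinianRing (S ⧸ I) := by
    let _ := Ideal.Quotient.field (IsLocalRing.maximalIdeal O)
    have : Module.Finite (O ⧸ IsLocalRing.maximalIdeal O) (S ⧸ I) :=
      Module.Finite.of_restrictScalars_finite O _ _
    exact IsArtinianRing.of_finite (O ⧸ IsLocalRing.maximalIdeal O) _
  obtain ⟨β, n, h1, h2⟩ := exists_idempotent_of_isArtinianRing (Ideal.Quotient.mk I a)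
  obtain ⟨y, rfl⟩ := Ideal.Quotient.mk_surjective β
  obtain ⟨e, he, hee⟩ := exists_idempotent_lift (I := I) (a * y) (by
    rw [← Ideal.Quotient.eq_zero_iff_mem, map_sub, map_mul, map_mul, h1, sub_self])
  refine ⟨e, y, n, he, hee, ?_⟩
  rw [← Ideal.Quotient.eq_zero_iff_mem] at hee ⊢
  rw [map_sub, sub_eq_zero, map_mul] at hee
  rw [map_mul, map_sub, map_pow, map_one, hee, h2]

end CompleteAlgebras

/-! ### Corner rings of primitive idempotents are local. -/

section Corner

variable {R : Type u} [Ring R]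

/-- `a` is invertible in the corner ring `iRi`. -/
def IsCornerUnit (i a : R) : Prop :=
  i * a = a ∧ a * i = a ∧ ∃ c, i * c = c ∧ c * i = c ∧ c * a = i ∧ a * c = i

/-- With c' = ici, the product ac' is an idempotent of iRi, hence 0 or i. It cannot be 0, because i
= (c'a)(c'a) = c'(ac')a. -/
theorem IsPrimitiveIdem.isCornerUnit_of_left {i : R} (hi : IsPrimitiveIdem i) {a c : R}
    (h1 : i * a = a) (h2 : a * i = a) (h : c * a = i) : IsCornerUnit i a := by
  have hc : (i * c * i) * a = i := by
    rw [mul_assoc, h1, mul_assoc, h, hi.idem]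
  have hidem : (a * (i * c * i)) * (a * (i * c * i)) = a * (i * c * i) := by
    calc (a * (i * c * i)) * (a * (i * c * i)) = a * ((i * c * i) * a) * (i * c * i) := by
          simp only [mul_assoc]
      _ = _ := by rw [hc, h2]
  refine ⟨h1, h2, i * c * i, ?_, ?_, hc, ?_⟩
  · rw [← mul_assoc, ← mul_assoc, hi.idem]
  · rw [mul_assoc, hi.idem]
  · refine (hi.prim _ hidem ?_ ?_).resolve_left fun h0 => hi.ne_zero ?_
    · rw [← mul_assoc, h1]
    · simp only [mul_assoc, hi.idem]
    · calc i = (i * c * i) * a * ((i * c * i) * a) := by rw [hc, hi.idem]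
        _ = (i * c * i) * (a * (i * c * i)) * a := by simp only [mul_assoc]
        _ = 0 := by rw [h0, mul_zero, zero_mul]

theorem IsPrimitiveIdem.not_isCornerUnit_zero {i : R} (hi : IsPrimitiveIdem i) :
    ¬ IsCornerUnit i 0 := fun ⟨_, _, c, _, _, h, _⟩ => hi.ne_zero (by rw [← h, mul_zero])

theorem IsPrimitiveIdem.isCornerUnit_self {i : R} (hi : IsPrimitiveIdem i) : IsCornerUnit i i :=
  ⟨hi.idem, hi.idem, i, hi.idem, hi.idem, hi.idem, hi.idem⟩

/-- The corner ring of `i` is local. -/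
def IsLocalIdem (i : R) : Prop :=
  IsPrimitiveIdem i ∧ ∀ a, i * a = a → a * i = a → IsCornerUnit i a ∨ IsCornerUnit i (i - a)

/-- If d inverts a + c, then da + dc = i, so da or dc is invertible. A left inverse suffices by
`IsPrimitiveIdem.isCornerUnit_of_left`. -/
theorem IsLocalIdem.add {i : R} (hi : IsLocalIdem i) {a c : R}
    (ha1 : i * a = a) (ha2 : a * i = a) (hc1 : i * c = c) (hc2 : c * i = c)
    (h : IsCornerUnit i (a + c)) : IsCornerUnit i a ∨ IsCornerUnit i c := by
  obtain ⟨-, -, d, hd1, hd2, hd, -⟩ := h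
  rcases hi.2 (d * a) (by rw [← mul_assoc, hd1]) (by rw [mul_assoc, ha2]) with h | h
  · obtain ⟨-, -, x, -, -, hx, -⟩ := h
    exact Or.inl (hi.1.isCornerUnit_of_left ha1 ha2 (c := x * d) (by rw [mul_assoc, hx]))
  · obtain ⟨-, -, x, -, -, hx, -⟩ := h
    refine Or.inr (hi.1.isCornerUnit_of_left hc1 hc2 (c := x * d) ?_)
    rw [← hx, ← hd, mul_add, add_sub_cancel_left, mul_assoc]

theorem IsLocalIdem.exists_of_sum {i : R} (hi : IsLocalIdem i) {ι : Type*} (s : Finset ι)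
    (f : ι → R) (hf : ∀ x ∈ s, i * f x = f x ∧ f x * i = f x) (h : IsCornerUnit i (∑ x ∈ s, f x)) :
    ∃ x ∈ s, IsCornerUnit i (f x) := by
  classical
  induction s using Finset.induction_on with
  | empty => exact absurd h (by rw [Finset.sum_empty]; exact hi.1.not_isCornerUnit_zero)
  | insert x s hx ih =>
    rw [Finset.sum_insert hx] at h
    have h3 := fun y hy => hf y (Finset.mem_insert_of_mem hy)
    rcases hi.add (hf x (Finset.mem_insert_self _ _)).1 (hf x (Finset.mem_insert_self _ _)).2
      (by rw [Finset.mul_sum]; exact Finset.sum_congr rfl fun y hy => (h3 y hy).1)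
      (by rw [Finset.sum_mul]; exact Finset.sum_congr rfl fun y hy => (h3 y hy).2) h with h | h
    · exact ⟨x, Finset.mem_insert_self _ _, h⟩
    · obtain ⟨y, hy, h⟩ := ih h3 h
      exact ⟨y, Finset.mem_insert_of_mem hy, h⟩

/-- An element congruent to `1` modulo `J(O) R` is left invertible. -/
theorem exists_left_inverse_of_sub_mem {O : Type v} [CommRing O] [IsLocalRing O] [Algebra O R]
    [Module.Finite O R] {x : R} (hx : x - 1 ∈ residueIdeal O R) : ∃ y, y * x = 1 := by
  -- Nakayama's lemma for R = Rx + J(O)R.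
  have h : (⊤ : Submodule O R) ≤ (Ideal.span {x}).restrictScalars O := by
    refine Submodule.le_of_le_smul_of_le_jacobson_bot Module.Finite.fg_top
      (IsLocalRing.maximalIdeal_le_jacobson (⊥ : Ideal O)) ?_
    intro y _
    have hy : y = y * x + -(y * (x - 1)) := by rw [mul_sub, mul_one]; abel
    rw [hy]
    exact Submodule.add_mem_sup (Ideal.mul_mem_left _ _ (Ideal.subset_span rfl))
      (neg_mem (S := Submodule O R) ((residueIdeal O R).mul_mem_left y hx))
  obtain ⟨y, hy⟩ := Submodule.mem_span_singleton.1 (h (show (1 : R) ∈ _ from trivial))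
  exact ⟨y, hy⟩

/-- Adding 1 - i to corner elements turns inversion in iRi into inversion in R. There the product is
1 modulo J(O)R, so Nakayama's lemma applies, and multiplying by i on both sides returns to the
corner. -/
theorem IsPrimitiveIdem.isCornerUnit_of_mod {O : Type v} [CommRing O] [IsLocalRing O] [Algebra O R]
    [Module.Finite O R] {i : R} (hi : IsPrimitiveIdem i) {a c : R} (h1 : i * a = a)
    (h2 : a * i = a) (h : c * a - i ∈ residueIdeal O R) : IsCornerUnit i a := by
  have h3 : (i * c * i + (1 - i)) * (a + (1 - i)) = 1 + i * (c * a - i) := by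
    have e1 : (1 - i) * a = 0 := by rw [sub_mul, one_mul, h1, sub_self]
    have e2 : i * (1 - i) = 0 := by rw [mul_sub, mul_one, hi.idem, sub_self]
    have e3 : (1 - i) * (1 - i) = 1 - i := by rw [sub_mul, one_mul, e2, sub_zero]
    rw [add_mul, mul_add, mul_add, e1, e3, mul_assoc, h1, mul_assoc _ i, e2, mul_zero, mul_sub,
      hi.idem, mul_assoc]
    abel
  obtain ⟨y, hy⟩ := exists_left_inverse_of_sub_mem (O := O) (x := 1 + i * (c * a - i)) (by
    rw [add_sub_cancel_left]; exact Ideal.mul_mem_left _ _ h)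
  refine hi.isCornerUnit_of_left h1 h2 (c := i * (y * (i * c * i + (1 - i)))) ?_
  have h4 : (a + (1 - i)) * i = a := by
    rw [add_mul, h2, sub_mul, one_mul, hi.idem, sub_self, add_zero]
  calc i * (y * (i * c * i + (1 - i))) * a
      = i * (y * ((i * c * i + (1 - i)) * (a + (1 - i)))) * i := by
        conv_lhs => rw [← h4]
        simp only [mul_assoc]
    _ = i := by rw [h3, hy, mul_one, hi.idem]

/-- The commutative algebra O[a] contains an idempotent e splitting a into an invertible and a
nilpotent part modulo J(O). Since e commutes with i, the element ie is an idempotent of iRi, so it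
is 0 or i. If it is i, then a is invertible in the corner; if it is 0, then a is nilpotent modulo
J(O) and i - a is invertible. -/
theorem isLocalIdem_of_isPrimitiveIdem (O : Type v) [CommRing O] [IsLocalRing O]
    [IsNoetherianRing O] [IsAdicComplete (IsLocalRing.maximalIdeal O) O] [Algebra O R]
    [Module.Finite O R] {i : R} (hi : IsPrimitiveIdem i) : IsLocalIdem i := by
  refine ⟨hi, fun a h1 h2 => ?_⟩
  let S := Algebra.adjoin O {a}
  have : IsMulCommutative S := Algebra.isMulCommutative_adjoin O (by
    rintro x rfl y rfl; rfl)
  have : Module.Finite O S :=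
    inferInstanceAs (Module.Finite O (Subalgebra.toSubmodule (Algebra.adjoin O {a})))
  let α : S := ⟨a, Algebra.subset_adjoin rfl⟩
  obtain ⟨e, y, n, he, hy, hn⟩ := exists_idempotent_pow O α
  have hI : ∀ s : S, s ∈ (IsLocalRing.maximalIdeal O).map (algebraMap O S) →
      (s : R) ∈ residueIdeal O R := by
    intro s hs
    have : (IsLocalRing.maximalIdeal O).map (algebraMap O S) ≤
        Ideal.comap S.val.toRingHom (residueIdeal O R) := by
      refine Ideal.map_le_iff_le_comap.2 fun r hr => ?_
      exact algebraMap_mem_residueIdeal (R := R) hr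
    exact this hs
  have hcomm : ∀ s : S, i * (s : R) = s * i := by
    intro s
    have : (Algebra.adjoin O {a}) ≤ Subalgebra.centralizer O {i} := by
      refine Algebra.adjoin_le ?_
      rintro _ rfl
      rw [SetLike.mem_coe, Subalgebra.mem_centralizer_iff]
      rintro _ rfl
      rw [h1, h2]
    exact (Subalgebra.mem_centralizer_iff O).1 (this s.2) i rfl
  have he' : (e : R) * e = e := congrArg Subtype.val he
  have hie : (i * (e : R)) * (i * (e : R)) = i * e := by
    rw [mul_assoc, ← mul_assoc (e : R), ← hcomm, mul_assoc i, he', ← mul_assoc, hi.idem]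
  rcases hi.prim _ hie (by rw [← mul_assoc, hi.idem])
    (by rw [hcomm, mul_assoc, hi.idem]) with h | h
  · right
    have hn' : (a ^ n * (1 - (e : R)) : R) ∈ residueIdeal O R := hI _ hn
    have h3 : i * (a ^ n * (1 - (e : R))) = i * a ^ n := by
      have e1 : i * a ^ n = a ^ n * i := hcomm (α ^ n)
      rw [← mul_assoc, e1, mul_assoc, mul_sub, mul_one, h, sub_zero]
    have h4 : i * a ^ n ∈ residueIdeal O R := by
      rw [← h3]; exact Ideal.mul_mem_left _ _ hn'
    -- The geometric series inverts i - a up to i aⁿ, which lies in J(O)R.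
    refine hi.isCornerUnit_of_mod (O := O) (c := i * ∑ k ∈ Finset.range n, a ^ k)
      (by rw [mul_sub, hi.idem, h1]) (by rw [sub_mul, hi.idem, h2]) ?_
    have h5 : (∑ k ∈ Finset.range n, a ^ k) * (i - a) = i * (1 - a ^ n) := by
      have e1 : i - a = (1 - a) * i := by rw [sub_mul, one_mul, h2]
      have e2 : i * a ^ n = a ^ n * i := hcomm (α ^ n)
      rw [e1, ← mul_assoc, geom_sum_mul_neg, sub_mul, mul_sub, one_mul, mul_one, e2]
    rw [mul_assoc, h5, ← mul_assoc, hi.idem, mul_sub, mul_one, sub_sub_cancel_left]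
    exact neg_mem h4
  · left
    have hy' : (e : R) - a * y ∈ residueIdeal O R := hI _ hy
    refine hi.isCornerUnit_of_mod (O := O) (c := y) h1 h2 ?_
    have e1 : (y : R) * a = a * y := congrArg Subtype.val (mul_comm y α)
    have e2 : (y : R) * a - i = -(i * ((e : R) - a * y)) := by
      rw [mul_sub, h, ← mul_assoc, h1, e1]; abel
    rw [e2]
    exact neg_mem (Ideal.mul_mem_left _ _ hy')

end Corner

/-! ### Points, their maximal ideals, and conjugacy of idempotents. -/

section PointsOfRings

variable {R : Type u} [Ring R]

theorem IsPrimitiveIdem.conj {e : R} (he : IsPrimitiveIdem e) (x : Rˣ) :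
    IsPrimitiveIdem (↑x * e * ↑x⁻¹) where
  idem := by
    calc (↑x * e * ↑x⁻¹ : R) * (↑x * e * ↑x⁻¹) = ↑x * e * (↑x⁻¹ * ↑x) * e * ↑x⁻¹ := by
          simp only [mul_assoc]
      _ = _ := by rw [Units.inv_mul, mul_one, mul_assoc (x : R), he.idem]
  ne_zero h := he.ne_zero (by
    have : (↑x⁻¹ : R) * (↑x * e * ↑x⁻¹) * ↑x = e := by
      simp [mul_assoc]
    rw [← this, h, mul_zero, zero_mul])
  prim f hf h1 h2 := by
    have e1 : e * ((↑x⁻¹ : R) * f * ↑x) = ↑x⁻¹ * f * ↑x := by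
      conv_rhs => rw [← h1]
      simp [mul_assoc]
    have e2 : ((↑x⁻¹ : R) * f * ↑x) * e = ↑x⁻¹ * f * ↑x := by
      conv_rhs => rw [← h2]
      simp [mul_assoc]
    have e3 : ((↑x⁻¹ : R) * f * ↑x) * ((↑x⁻¹ : R) * f * ↑x) = ↑x⁻¹ * f * ↑x := by
      conv_rhs => rw [← hf]
      simp [mul_assoc]
    have e4 : f = ↑x * ((↑x⁻¹ : R) * f * ↑x) * ↑x⁻¹ := by simp [mul_assoc]
    rcases he.prim _ e3 e1 e2 with h | h
    · left; rw [e4, h, mul_zero, zero_mul]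
    · right; rw [e4, h]

theorem IsPoint.isPrimitiveIdem {γ : Set R} (hγ : IsPoint γ) {i : R} (hi : i ∈ γ) :
    IsPrimitiveIdem i := by
  obtain ⟨e, he, rfl⟩ := hγ
  obtain ⟨x, rfl⟩ := hi
  exact he.conj x

theorem IsPoint.mem_iff {γ : Set R} (hγ : IsPoint γ) {i : R} (hi : i ∈ γ) {j : R} :
    j ∈ γ ↔ ∃ x : Rˣ, j = ↑x * i * ↑x⁻¹ := by
  obtain ⟨e, he, rfl⟩ := hγ
  obtain ⟨x, rfl⟩ := hi
  constructor
  · rintro ⟨y, rfl⟩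
    exact ⟨y * x⁻¹, by simp [mul_assoc]⟩
  · rintro ⟨y, rfl⟩
    exact ⟨y * x, by simp [mul_assoc]⟩

theorem IsPoint.subset_iff {γ : Set R} (hγ : IsPoint γ) {i : R} (hi : i ∈ γ) {I : Ideal R}
    [I.IsTwoSided] : γ ⊆ I ↔ i ∈ I := by
  refine ⟨fun h => h hi, fun h j hj => ?_⟩
  obtain ⟨x, rfl⟩ := (hγ.mem_iff hi).1 hj
  exact I.mul_mem_right _ (I.mul_mem_left _ h)

/-- The elements `x` for which no `i a x c i` is invertible in `iRi` form a two-sided ideal. -/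
def IsLocalIdem.ideal {i : R} (hi : IsLocalIdem i) : Ideal R where
  carrier := {x | ∀ a c, ¬ IsCornerUnit i (i * a * x * c * i)}
  add_mem' := fun {x y} hx hy a c h => by
    have h' : i * a * (x + y) * c * i = i * a * x * c * i + i * a * y * c * i := by
      simp only [mul_add, add_mul]
    rw [h'] at h
    rcases hi.add (by simp only [← mul_assoc, hi.1.idem]) (by simp only [mul_assoc, hi.1.idem])
      (by simp only [← mul_assoc, hi.1.idem]) (by simp only [mul_assoc, hi.1.idem]) h with h | h
    · exact hx a c h
    · exact hy a c h
  zero_mem' := fun a c h => hi.1.not_isCornerUnit_zero (by simpa using h)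
  smul_mem' := fun r x hx a c h => hx (a * r) c (by simpa only [smul_eq_mul, mul_assoc] using h)

instance {i : R} (hi : IsLocalIdem i) : hi.ideal.IsTwoSided where
  mul_mem_of_left := fun {x} r hx a c h => hx a (r * c) (by simpa only [mul_assoc] using h)

theorem IsLocalIdem.mem_ideal {i : R} (hi : IsLocalIdem i) {x : R} :
    x ∈ hi.ideal ↔ ∀ a c, ¬ IsCornerUnit i (i * a * x * c * i) := Iff.rfl

/-- A two-sided ideal with an element x such that some i a x c i is invertible in iRi contains i.
Conversely, locality makes the remaining elements an ideal, and it avoids i. So the supremum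
defining m_γ itself avoids γ, and membership becomes a condition in the corner. -/
theorem IsLocalIdem.pointIdeal_eq {i : R} (hi : IsLocalIdem i) {γ : Set R} (hγ : IsPoint γ)
    (hiγ : i ∈ γ) : pointIdeal γ = hi.ideal := by
  refine le_antisymm (sSup_le fun I hI x hx a c h => ?_) (le_sSup ⟨inferInstance, ?_⟩)
  · have := hI.1
    refine hI.2 ((hγ.subset_iff hiγ).2 ?_)
    obtain ⟨-, -, d, -, -, hd, -⟩ := h
    rw [← hd]
    exact I.mul_mem_left _ (I.mul_mem_right _ (I.mul_mem_right _ (I.mul_mem_left _ hx)))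
  · rw [hγ.subset_iff hiγ]
    intro h
    refine hi.mem_ideal.1 h 1 1 ?_
    simp only [mul_one, hi.1.idem]
    exact hi.1.isCornerUnit_self

theorem IsLocalIdem.not_mem_pointIdeal {i : R} (hi : IsLocalIdem i) {γ : Set R} (hγ : IsPoint γ)
    (hiγ : i ∈ γ) : i ∉ pointIdeal γ := by
  rw [hi.pointIdeal_eq hγ hiγ]
  intro h
  refine hi.mem_ideal.1 h 1 1 ?_
  simp only [mul_one, hi.1.idem]
  exact hi.1.isCornerUnit_self

/-- The elements of `Ri` outside `m_γ` have left inverses in the corner ring. -/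
theorem IsLocalIdem.exists_mul_eq_of_not_mem {i : R} (hi : IsLocalIdem i) {γ : Set R}
    (hγ : IsPoint γ) (hiγ : i ∈ γ) {x : R} (h : x * i = x) (hx : x ∉ pointIdeal γ) :
    ∃ d, d * x = i := by
  rw [hi.pointIdeal_eq hγ hiγ, hi.mem_ideal] at hx
  push Not at hx
  obtain ⟨a, c, -, -, e, -, hei, -, he⟩ := hx
  have hxi : ∀ z, x * (i * z) = x * z := fun z => by rw [← mul_assoc, h]
  -- Both factors lie in iRi since xi = x. A one-sided inverse is two-sided there, so the factors
  -- can be exchanged, which brings x to the right end.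
  have hXY : (i * a * x) * (i * c * i * e) = i := by
    simpa only [mul_assoc, hxi] using he
  obtain ⟨-, -, Z, hZ, -, -, hYZ⟩ := hi.1.isCornerUnit_of_left
    (by simp only [← mul_assoc, hi.1.idem]) (by rw [mul_assoc, hei]) hXY
  have hX : i * a * x = Z := by
    calc i * a * x = i * a * x * (i * c * i * e * Z) := by rw [hYZ, mul_assoc _ x, h]
      _ = Z := by rw [← mul_assoc, hXY, hZ]
  exact ⟨i * c * i * e * (i * a), by rw [mul_assoc, hX, hYZ]⟩

/-- Idempotents linked by `z ∈ iRj` and `y ∈ jRi`, here with `z = ij`, are conjugate. -/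
theorem exists_unit_conj {i j y : R} (hi : i * i = i) (hj : j * j = j) (hy1 : j * y = y)
    (hy2 : y * i = y) (h1 : i * j * y = i) (h2 : y * (i * j) = j) :
    ∃ x : Rˣ, j = ↑x * i * ↑x⁻¹ := by
  have hiy : i * y = i := by rw [mul_assoc, hy1] at h1; exact h1
  have hyj : y * j = j := by rw [← mul_assoc, hy2] at h2; exact h2
  have hyy : y * y = y := by rw [← hy2, mul_assoc, ← mul_assoc i, hiy, hi]
  have hji : y * (j * i) = j * i := by rw [← mul_assoc, hyj]
  have hjj : j * (j * i) = j * i := by rw [← mul_assoc, hj]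
  -- This unit conjugates i to j because jx = y = xi. The summand (1 - j)(1 - i) matches the
  -- complementary idempotents.
  let x : Rˣ :=
    { val := y + (1 - j) * (1 - i)
      inv := i * j + 1 - y
      val_inv := by
        have hii : i * (i * j) = i * j := by rw [← mul_assoc, hi]
        simp only [mul_add, add_mul, sub_mul, mul_sub, one_mul, mul_one, mul_assoc, hii, h2, hyy,
          hiy, hy1]
        abel
      inv_val := by
        simp only [mul_add, add_mul, sub_mul, mul_sub, one_mul, mul_one, mul_assoc, hji, hyy, hjj,
          hiy, hy1, hyj, hy2, hj]
        abel }
  refine ⟨x, ?_⟩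
  rw [Units.eq_mul_inv_iff_mul_eq]
  change j * (y + (1 - j) * (1 - i)) = (y + (1 - j) * (1 - i)) * i
  have e1 : j * (1 - j) = 0 := by rw [mul_sub, mul_one, hj, sub_self]
  have e2 : (1 - i) * i = 0 := by rw [sub_mul, one_mul, hi, sub_self]
  rw [mul_add, add_mul, ← mul_assoc j, e1, zero_mul, mul_assoc _ _ i, e2, mul_zero, hy1, hy2]

end PointsOfRings

/-! ### Relative traces and the kernel of the Brauer map. -/

section Traces

variable {O : Type u} {G : Type v} [CommRing O] [Group G] {H : Subgroup G} [H.Normal]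
  {b : InvariantBlock O H}

theorem out_smul_eq {P : Subgroup G} {Q : Subgroup P} {a : BlockExt b}
    (ha : a ∈ fixedSubalgebra b (Q.map P.subtype)) (u : P) :
    (((u : P ⧸ Q).out : P) : G) • a = (u : G) • a := by
  obtain ⟨q, hq⟩ := QuotientGroup.mk_out_eq_mul Q u
  have h := ha.2 _ (Subgroup.mem_map_of_mem P.subtype q.2)
  rw [Subgroup.coe_subtype] at h
  rw [hq, Subgroup.coe_mul, mul_smul, h]

theorem relTrace_mem [Finite G] {P : Subgroup G} {Q : Subgroup P} {a : BlockExt b}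
    (ha : a ∈ fixedSubalgebra b (Q.map P.subtype)) : relTrace b P Q a ∈ fixedSubalgebra b P := by
  have := Fintype.ofFinite (P ⧸ Q)
  rw [relTrace, finsum_eq_sum_of_fintype]
  refine ⟨sum_mem fun c _ => BlockExt.smul_mem_component_one b _ ha.1, fun u hu => ?_⟩
  rw [Finset.smul_sum]
  refine Fintype.sum_equiv (MulAction.toPerm (⟨u, hu⟩ : P)) _ _ fun c => ?_
  obtain ⟨v, rfl⟩ := QuotientGroup.mk_surjective c
  rw [MulAction.toPerm_apply, MulAction.Quotient.smul_mk, out_smul_eq ha, out_smul_eq ha,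
    ← mul_smul]
  rfl

theorem relTrace_top {P : Subgroup G} {a : BlockExt b}
    (ha : a ∈ fixedSubalgebra b P) : relTrace b P ⊤ a = a := by
  have := QuotientGroup.subsingleton_quotient_top (G := P)
  rw [relTrace, finsum_eq_single _ ((1 : P) : P ⧸ (⊤ : Subgroup P))
    fun x hx => absurd (Subsingleton.elim _ _) hx]
  exact ha.2 _ (SetLike.coe_mem _)

theorem mul_relTrace [Finite G] {P : Subgroup G} (Q : Subgroup P) {c : BlockExt b} (a : BlockExt b)
    (hc : c ∈ fixedSubalgebra b P) : c * relTrace b P Q a = relTrace b P Q (c * a) := by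
  have := Fintype.ofFinite (P ⧸ Q)
  rw [relTrace, relTrace, finsum_eq_sum_of_fintype, finsum_eq_sum_of_fintype, Finset.mul_sum]
  refine Finset.sum_congr rfl fun x _ => ?_
  rw [smul_mul', hc.2 _ (SetLike.coe_mem _)]

theorem relTrace_mul [Finite G] {P : Subgroup G} (Q : Subgroup P) {c : BlockExt b} (a : BlockExt b)
    (hc : c ∈ fixedSubalgebra b P) : relTrace b P Q a * c = relTrace b P Q (a * c) := by
  have := Fintype.ofFinite (P ⧸ Q)
  rw [relTrace, relTrace, finsum_eq_sum_of_fintype, finsum_eq_sum_of_fintype, Finset.sum_mul]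
  refine Finset.sum_congr rfl fun x _ => ?_
  rw [smul_mul', hc.2 _ (SetLike.coe_mem _)]

theorem fixedSubalgebra_anti {P Q : Subgroup G} (h : Q ≤ P) :
    fixedSubalgebra b P ≤ fixedSubalgebra b Q :=
  fun _ ha => ⟨ha.1, fun u hu => ha.2 u (h hu)⟩

/-- Elements of B^P pass through relative traces, c Tr(a) = Tr(ca). Together with the version for
right multiplication this makes the kernel absorb B^P on both sides. -/
theorem mul_mem_brauerKer [Finite G] [IsLocalRing O] {P : Subgroup G} {c x : BlockExt b}
    (hc : c ∈ fixedSubalgebra b P) (hx : x ∈ brauerKer b P) : c * x ∈ brauerKer b P := by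
  refine Submodule.span_induction (p := fun x _ => c * x ∈ brauerKer b P) ?_ ?_ ?_ ?_ hx
  · rintro _ (⟨Q, hQ, a, ha, rfl⟩ | ⟨r, hr, a, ha, rfl⟩)
    · rw [mul_relTrace Q a hc]
      exact Submodule.subset_span (Or.inl ⟨Q, hQ, _,
        mul_mem (fixedSubalgebra_anti (Subgroup.map_subtype_le Q) hc) ha, rfl⟩)
    · rw [mul_smul_comm]
      exact Submodule.subset_span (Or.inr ⟨r, hr, _, mul_mem hc ha, rfl⟩)
  · rw [mul_zero]; exact zero_mem _
  · intro x y _ _ hx hy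
    rw [mul_add]; exact add_mem hx hy
  · intro r x _ hx
    rw [mul_smul_comm]; exact Submodule.smul_mem _ r hx

theorem mem_brauerKer_mul [Finite G] [IsLocalRing O] {P : Subgroup G} {c x : BlockExt b}
    (hc : c ∈ fixedSubalgebra b P) (hx : x ∈ brauerKer b P) : x * c ∈ brauerKer b P := by
  refine Submodule.span_induction (p := fun x _ => x * c ∈ brauerKer b P) ?_ ?_ ?_ ?_ hx
  · rintro _ (⟨Q, hQ, a, ha, rfl⟩ | ⟨r, hr, a, ha, rfl⟩)
    · rw [relTrace_mul Q a hc]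
      exact Submodule.subset_span (Or.inl ⟨Q, hQ, _,
        mul_mem ha (fixedSubalgebra_anti (Subgroup.map_subtype_le Q) hc), rfl⟩)
    · rw [smul_mul_assoc]
      exact Submodule.subset_span (Or.inr ⟨r, hr, _, mul_mem ha hc, rfl⟩)
  · rw [zero_mul]; exact zero_mem _
  · intro x y _ _ hx hy
    rw [add_mul]; exact add_mem hx hy
  · intro r x _ hx
    rw [smul_mul_assoc]; exact Submodule.smul_mem _ r hx

/-- A sum over a `P`-set of a `P`-equivariant function is a sum of relative traces over the
orbits. -/
theorem sum_eq_sum_relTrace [Finite G] {P : Subgroup G} {X : Type w} [MulAction P X] [Fintype X]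
    [Fintype (MulAction.orbitRel.Quotient P X)]
    (h : X → BlockExt b) (hh : ∀ (u : P) x, (u : G) • h x = h (u • x)) :
    ∑ x, h x = ∑ ω : MulAction.orbitRel.Quotient P X,
      relTrace b P (MulAction.stabilizer P ω.out) (h ω.out) := by
  have := fun ω : MulAction.orbitRel.Quotient P X =>
    Fintype.ofFinite (P ⧸ MulAction.stabilizer P ω.out)
  rw [← (MulAction.selfEquivSigmaOrbitsQuotientStabilizer P X).symm.sum_comp, Fintype.sum_sigma]
  refine Finset.sum_congr rfl fun ω _ => ?_
  rw [relTrace, finsum_eq_sum_of_fintype]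
  refine Finset.sum_congr rfl fun c _ => ?_
  rw [hh]
  congr 1
  conv_lhs => rw [← c.out_eq']
  rfl

/-- If a local idempotent of `B^P` outside the kernel of the Brauer map is the sum of the values of a
`P`-equivariant function, then the value at some fixed point is invertible in the corner. -/
theorem exists_fixed_isCornerUnit [Finite G] [IsLocalRing O] {P : Subgroup G} {X : Type w}
    [MulAction P X] [Finite X] {i : FixedAlg b P} (hi : IsLocalIdem i)
    (hbr : FixedAlg.val i ∉ brauerKer b P) (h : X → BlockExt b)
    (hh : ∀ (u : P) x, (u : G) • h x = h (u • x)) (h1 : ∀ x, h x ∈ BlockExt.component b 1)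
    (hsum : ∑ᶠ x, h x = FixedAlg.val i) :
    ∃ x, (∀ u : P, u • x = x) ∧ ∃ a : FixedAlg b P, FixedAlg.val a = h x ∧
      IsCornerUnit i (i * a * i) := by
  have := Fintype.ofFinite X
  have := Fintype.ofFinite (MulAction.orbitRel.Quotient P X)
  rw [finsum_eq_sum_of_fintype, sum_eq_sum_relTrace h hh] at hsum
  have hQ : ∀ x, h x ∈ fixedSubalgebra b ((MulAction.stabilizer P x).map P.subtype) := by
    refine fun x => ⟨h1 x, ?_⟩
    rintro _ ⟨u, hu, rfl⟩
    rw [Subgroup.coe_subtype, hh, MulAction.mem_stabilizer_iff.1 hu]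
  let t : MulAction.orbitRel.Quotient P X → FixedAlg b P := fun ω =>
    ⟨relTrace b P (MulAction.stabilizer P ω.out) (h ω.out), relTrace_mem (hQ _)⟩
  have ht : i = ∑ ω, i * t ω * i := by
    have h2 : i = ∑ ω, t ω := by
      refine FixedAlg.val_injective ?_
      rw [← hsum, map_sum]
      rfl
    rw [← Finset.sum_mul, ← Finset.mul_sum, ← h2, hi.1.idem, hi.1.idem]
  -- Here i is the sum of the orbit traces, cut down to the local corner ring, so one summand is
  -- invertible.
  obtain ⟨ω, -, hω⟩ := hi.exists_of_sum Finset.univ (fun ω => i * t ω * i)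
    (fun ω _ => ⟨by simp only [← mul_assoc, hi.1.idem], by simp only [mul_assoc, hi.1.idem]⟩)
    (by rw [← ht]; exact hi.1.isCornerUnit_self)
  by_cases htop : MulAction.stabilizer P ω.out = ⊤
  · refine ⟨ω.out, fun u => ?_, t ω, ?_, hω⟩
    · have : u ∈ MulAction.stabilizer P ω.out := by rw [htop]; trivial
      exact this
    · change relTrace b P _ _ = _
      have h3 := hQ ω.out
      rw [htop] at h3 ⊢
      refine relTrace_top ?_
      simpa [← MonoidHom.range_eq_map] using h3
  -- For a proper stabilizer the orbit trace lies in the Brauer kernel. Its invertible multiple i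
  -- would lie there too.
  · exfalso
    refine hbr ?_
    have h3 : FixedAlg.val (t ω) ∈ brauerKer b P :=
      Submodule.subset_span (Or.inl ⟨_, htop, _, hQ _, rfl⟩)
    obtain ⟨-, -, c, -, -, hc, -⟩ := hω
    rw [← hc, map_mul, map_mul, map_mul]
    exact mul_mem_brauerKer c.2 (mem_brauerKer_mul i.2 (mul_mem_brauerKer i.2 h3))

end Traces

/-! ### The isomorphism between E and F. -/

section Theta

variable {O : Type u} {G : Type v} [CommRing O] [Group G] {H : Subgroup G}

theorem BlockExt.eq_sum_str [Fintype G] {b : InvariantBlock O H} (a : BlockExt b) :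
    a = ∑ g : G, a.val.coeff g • BlockExt.str b g := by
  refine BlockExt.val_injective ?_
  have h1 : (∑ g : G, a.val.coeff g • BlockExt.str b g).val =
      ∑ g : G, a.val.coeff g • (BlockExt.str b g).val :=
    map_sum (Submodule.subtype b.ideal) _ _
  have h2 : a.val = ∑ g : G, a.val.coeff g • MonoidAlgebra.of O G g := by
    ext x
    classical
    simp
  rw [h1, ← BlockExt.block_mul_val a]
  conv_lhs => rw [h2]
  rw [Finset.mul_sum]
  refine Finset.sum_congr rfl fun g _ => ?_
  rw [mul_smul_comm, BlockExt.val_str, BlockExt.block_mul_val]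

theorem coeff_str_mul {b : InvariantBlock O H} (g x : G) (a : BlockExt b) :
    (BlockExt.str b g * a).val.coeff x = a.val.coeff (g⁻¹ * x) := by
  rw [BlockExt.val_mul, BlockExt.val_str, ← b.comm, mul_assoc, BlockExt.block_mul_val,
    MonoidAlgebra.of_apply, MonoidAlgebra.coeff_single_mul_apply, one_mul]

theorem coeff_mul_str {b : InvariantBlock O H} (g x : G) (a : BlockExt b) :
    (a * BlockExt.str b g).val.coeff x = a.val.coeff (x * g⁻¹) := by
  rw [BlockExt.val_mul, BlockExt.val_str, ← mul_assoc, b.comm, BlockExt.block_mul_val,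
    MonoidAlgebra.of_apply, MonoidAlgebra.coeff_mul_single_apply, mul_one]

variable [H.Normal] {b : InvariantBlock O H} {P : Subgroup G}

theorem mem_leftMod {i : FixedAlg b P} (hi : i * i = i) {a : BlockExt b} :
    a ∈ leftMod i ↔ a * FixedAlg.val i = a := by
  rw [leftMod, Submodule.mem_span_singleton]
  constructor
  · rintro ⟨c, rfl⟩
    rw [smul_eq_mul, mul_assoc, ← map_mul, hi]
  · intro h
    exact ⟨a, h⟩

theorem self_mem_leftMod (i : FixedAlg b P) : FixedAlg.val i ∈ leftMod i :=
  Submodule.mem_span_singleton_self _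

variable {i : FixedAlg b P}

/-- `P` permutes `G` through `u · g = φ(u) g u⁻¹`. -/
def twistedConj (φ : MulAut P) : P →* Equiv.Perm G where
  toFun u := (Equiv.mulRight (u : G)⁻¹).trans (Equiv.mulLeft ((φ u : P) : G))
  map_one' := by ext; simp
  map_mul' u v := by ext; simp [mul_assoc]

/-- A fusion yields an invertible element of `iAi` which induces it. -/
theorem IsFusionIso.exists_unit (hii : i * i = i) {φ : MulAut P} {x : G ⧸ H}
    {f : leftMod i ≃ₗ[BlockExt b] leftMod i} (hf : IsFusionIso i φ x f) :
    ∃ r s : BlockExt b, r ∈ BlockExt.component b x ∧ s ∈ BlockExt.component b x⁻¹ ∧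
      s * r = FixedAlg.val i ∧ r * s = FixedAlg.val i ∧
      FixedAlg.val i * s = s ∧ s * FixedAlg.val i = s ∧ FixedAlg.val i * r = r ∧
      r * FixedAlg.val i = r ∧
      (∀ u : P, BlockExt.str b (u : G) * s = s * BlockExt.str b ((φ u : P) : G)) ∧
      ∀ u : P, BlockExt.str b ((φ u : P) : G) * r = r * BlockExt.str b (u : G) := by
  let e : leftMod i := ⟨FixedAlg.val i, self_mem_leftMod i⟩
  have hm : ∀ m : leftMod i, (m : BlockExt b) • e = m := fun m =>
    Subtype.ext ((mem_leftMod hii).1 m.2)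
  have he : FixedAlg.val i • e = e := hm e
  have hfm : ∀ m : leftMod i, (m : BlockExt b) * (f e : BlockExt b) = f m := fun m => by
    conv_rhs => rw [← hm m, map_smul]
    rfl
  have hfm' : ∀ m : leftMod i, (m : BlockExt b) * (f.symm e : BlockExt b) = f.symm m := fun m => by
    conv_rhs => rw [← hm m, map_smul]
    rfl
  have hu : ∀ u : P, rightMul i u e = BlockExt.str b (u : G) • e := fun u =>
    Subtype.ext (FixedAlg.val_mul_str u.2 i)
  have key : ∀ u : P, BlockExt.str b (u : G) • f e = rightMul i (φ u) (f e) := fun u => by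
    rw [← hf.1, hu, map_smul]
  have key' : ∀ u : P, BlockExt.str b ((φ u : P) : G) • f.symm e = rightMul i u (f.symm e) := by
    intro u
    rw [← map_smul, ← hu, LinearEquiv.symm_apply_eq, hf.1, LinearEquiv.apply_symm_apply]
  have hdeg := BlockExt.one_mem_component b (H := H)
  have hi1 : FixedAlg.val i ∈ BlockExt.component b (1 : G ⧸ H) := FixedAlg.val_mem i
  -- An A-linear endomorphism of Ai is right multiplication by the image of i. Thus s = f(i) and r =
  -- f⁻¹(i) are mutually inverse in iAi, and compatibility with P and with degrees is read off at i.
  refine ⟨f.symm e, f e, ?_, ?_, ?_, ?_, ?_, ?_, ?_, ?_, fun u => congrArg Subtype.val (key u),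
    fun u => congrArg Subtype.val (key' u)⟩
  · rw [hf.2, LinearEquiv.apply_symm_apply, mul_inv_cancel]
    exact hi1
  · have := (hf.2 1 e).1 hi1
    rwa [one_mul] at this
  · rw [hfm', LinearEquiv.symm_apply_apply]
  · rw [hfm, LinearEquiv.apply_symm_apply]
  · exact hfm e
  · exact (mem_leftMod hii).1 (f e).2
  · exact hfm' e
  · exact (mem_leftMod hii).1 (f.symm e).2

theorem smul_mem_fixedSubalgebra {g : G} (hg : g ∈ Subgroup.normalizer (P : Set G)) {a : BlockExt b}
    (ha : a ∈ fixedSubalgebra b P) : g • a ∈ fixedSubalgebra b P := by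
  refine ⟨BlockExt.smul_mem_component_one b _ ha.1, fun u hu => ?_⟩
  have h : g⁻¹ * u * g ∈ P := (Subgroup.mem_normalizer_iff''.1 hg u).1 hu
  have h2 : u * g = g * (g⁻¹ * u * g) := by group
  rw [← mul_smul, h2, mul_smul, ha.2 _ h]

/-- The conjugation of `B^P` with an element of the normalizer of `P`. -/
def conjFixed {g : G} (hg : g ∈ Subgroup.normalizer (P : Set G)) :
    FixedAlg b P →+* FixedAlg b P where
  toFun a := ⟨g • FixedAlg.val a, smul_mem_fixedSubalgebra hg a.2⟩
  map_one' := FixedAlg.val_injective (smul_one g)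
  map_mul' a d := FixedAlg.val_injective (smul_mul' g (FixedAlg.val a) (FixedAlg.val d))
  map_zero' := FixedAlg.val_injective (smul_zero g)
  map_add' a d := FixedAlg.val_injective (smul_add g (FixedAlg.val a) (FixedAlg.val d))

variable [IsLocalRing O] (γ : LocalPoint b P)

/-- The conjugation of `P` with the elements of `N_G(P_γ)`. -/
def conjP : normalizerPt γ →* MulAut P :=
  P.normalizerMonoidHom.comp (Subgroup.inclusion inf_le_left)

theorem conjP_apply (n : normalizerPt γ) (u : P) :
    ((conjP γ n u : P) : G) = (n : G) * u * (n : G)⁻¹ := rfl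

variable {γ}

theorem exists_smul_eq (hi : i ∈ γ.carrier) (n : normalizerPt γ) :
    ∃ x : (FixedAlg b P)ˣ, n • i = ↑x * i * ↑x⁻¹ :=
  (γ.isPoint.mem_iff hi).1 (conj_mem_carrier γ n i hi)

theorem str_mul_val (n : normalizerPt γ) (a : FixedAlg b P) :
    BlockExt.str b n * FixedAlg.val a = FixedAlg.val (n • a) * BlockExt.str b n := by
  rw [val_conj, BlockExt.conj_def, mul_assoc, BlockExt.str_inv_mul, mul_one]

theorem val_mul_str_inv (n : normalizerPt γ) (a : FixedAlg b P) :
    FixedAlg.val a * BlockExt.str b (n : G)⁻¹ =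
      BlockExt.str b (n : G)⁻¹ * FixedAlg.val (n • a) := by
  rw [val_conj, BlockExt.conj_def, ← mul_assoc, ← mul_assoc, BlockExt.str_inv_mul, one_mul]

/-- Choose a unit x of B^P with nin⁻¹ = xix⁻¹. The fusion is right multiplication by w = n⁻¹x: it
commutes with i, has degree n̄⁻¹, and satisfies uw = w(nun⁻¹) because x commutes with P. -/
theorem exists_isFusionIso (hi : i ∈ γ.carrier) (n : normalizerPt γ) :
    ∃ f : leftMod i ≃ₗ[BlockExt b] leftMod i, IsFusionIso i (conjP γ n) ((n : G) : G ⧸ H) f := by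
  obtain ⟨x, hx⟩ := exists_smul_eq hi n
  have hii := (γ.isPoint.isPrimitiveIdem hi).idem
  have hxi : ↑x * i = (n • i) * ↑x := by rw [hx, Units.inv_mul_cancel_right]
  have hix : i * ↑x⁻¹ = ↑x⁻¹ * (n • i) := by rw [hx, ← mul_assoc, Units.inv_mul_cancel_left]
  let w := BlockExt.str b (n : G)⁻¹ * FixedAlg.val (x : FixedAlg b P)
  let w' := FixedAlg.val (↑x⁻¹ : FixedAlg b P) * BlockExt.str b (n : G)
  have hw : w * w' = 1 := by
    change BlockExt.str b (n : G)⁻¹ * FixedAlg.val (x : FixedAlg b P) *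
      (FixedAlg.val (↑x⁻¹ : FixedAlg b P) * BlockExt.str b (n : G)) = 1
    rw [mul_assoc, ← mul_assoc (FixedAlg.val _), ← map_mul, Units.mul_inv, map_one, one_mul,
      BlockExt.str_inv_mul]
  have hw' : w' * w = 1 := by
    change FixedAlg.val (↑x⁻¹ : FixedAlg b P) * BlockExt.str b (n : G) *
      (BlockExt.str b (n : G)⁻¹ * FixedAlg.val (x : FixedAlg b P)) = 1
    rw [mul_assoc, ← mul_assoc (BlockExt.str b _), BlockExt.str_mul_inv, one_mul, ← map_mul,
      Units.inv_mul, map_one]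
  have hwi : w * FixedAlg.val i = FixedAlg.val i * w := by
    change BlockExt.str b (n : G)⁻¹ * FixedAlg.val (x : FixedAlg b P) * FixedAlg.val i =
      FixedAlg.val i * (BlockExt.str b (n : G)⁻¹ * FixedAlg.val (x : FixedAlg b P))
    rw [mul_assoc, ← map_mul, hxi, map_mul, ← mul_assoc, ← val_mul_str_inv, mul_assoc]
  have hwi' : w' * FixedAlg.val i = FixedAlg.val i * w' := by
    calc w' * FixedAlg.val i = w' * FixedAlg.val i * (w * w') := by rw [hw, mul_one]
      _ = w' * (FixedAlg.val i * w) * w' := by simp only [mul_assoc]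
      _ = (w' * w) * FixedAlg.val i * w' := by rw [← hwi]; simp only [mul_assoc]
      _ = _ := by rw [hw', one_mul]
  have hmem : ∀ a ∈ leftMod i, a * w ∈ leftMod i := fun a ha => by
    rw [mem_leftMod hii] at ha ⊢
    rw [mul_assoc, hwi, ← mul_assoc, ha]
  have hmem' : ∀ a ∈ leftMod i, a * w' ∈ leftMod i := fun a ha => by
    rw [mem_leftMod hii] at ha ⊢
    rw [mul_assoc, hwi', ← mul_assoc, ha]
  have hwdeg : w ∈ BlockExt.component b (((n : G) : G ⧸ H)⁻¹) := by
    have := BlockExt.mul_mem_component b (BlockExt.str_mem_component b (H := H) (n : G)⁻¹)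
      (FixedAlg.val_mem (x : FixedAlg b P))
    rwa [mul_one, QuotientGroup.mk_inv] at this
  have hwdeg' : w' ∈ BlockExt.component b ((n : G) : G ⧸ H) := by
    have := BlockExt.mul_mem_component b (FixedAlg.val_mem (↑x⁻¹ : FixedAlg b P))
      (BlockExt.str_mem_component b (H := H) (n : G))
    rwa [one_mul] at this
  refine ⟨{ toFun := fun a => ⟨a * w, hmem a a.2⟩
            map_add' := fun x y => Subtype.ext (add_mul (x : BlockExt b) y _)
            map_smul' := fun c x => Subtype.ext (mul_assoc c (x : BlockExt b) _)
            invFun := fun a => ⟨a * w', hmem' a a.2⟩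
            left_inv := fun a => Subtype.ext (by
              change (a : BlockExt b) * w * w' = a
              rw [mul_assoc, hw, mul_one])
            right_inv := fun a => Subtype.ext (by
              change (a : BlockExt b) * w' * w = a
              rw [mul_assoc, hw', mul_one]) }, fun u m => Subtype.ext ?_, fun y m => ⟨fun h => ?_,
                fun h => ?_⟩⟩
  · change (m : BlockExt b) * BlockExt.str b (u : G) *
      (BlockExt.str b (n : G)⁻¹ * FixedAlg.val (x : FixedAlg b P)) =
      (m : BlockExt b) * (BlockExt.str b (n : G)⁻¹ * FixedAlg.val (x : FixedAlg b P)) *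
        BlockExt.str b ((conjP γ n u : P) : G)
    rw [mul_assoc (m : BlockExt b) (BlockExt.str b _ * _), mul_assoc (BlockExt.str b _),
      FixedAlg.val_mul_str (SetLike.coe_mem _), conjP_apply, map_mul, map_mul]
    simp only [mul_assoc]
    rw [← mul_assoc (BlockExt.str b _) (BlockExt.str b (n : G)), BlockExt.str_inv_mul, one_mul]
  · exact BlockExt.mul_mem_component b h hwdeg
  · have h2 := BlockExt.mul_mem_component b h hwdeg'
    rw [inv_mul_cancel_right] at h2
    have h3 : (m : BlockExt b) * w * w' = m := by rw [mul_assoc, hw, mul_one]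
    rw [← h3]
    exact h2

/-- The homomorphism `N_G(P_γ) → F` which maps `g` to the pair of the conjugation with `g` and the
coset of `g`. -/
def thetaHom (hi : i ∈ γ.carrier) : normalizerPt γ →* GroupF i :=
  MonoidHom.codRestrict ((conjP γ).prod ((QuotientGroup.mk' H).comp (normalizerPt γ).subtype))
    (GroupF i) fun n => ⟨fun u => by
      change (((conjP γ n u : P) : G) : G ⧸ H) = ((n : G) : G ⧸ H) * _ * ((n : G) : G ⧸ H)⁻¹
      rw [conjP_apply]; rfl, exists_isFusionIso hi n⟩

theorem thetaHom_fst (hi : i ∈ γ.carrier) (n : normalizerPt γ) :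
    (thetaHom hi n : MulAut P × G ⧸ H).1 = conjP γ n := rfl

theorem thetaHom_snd (hi : i ∈ γ.carrier) (n : normalizerPt γ) :
    (thetaHom hi n : MulAut P × G ⧸ H).2 = ((n : G) : G ⧸ H) := rfl

theorem thetaHom_ker (hi : i ∈ γ.carrier) : (thetaHom hi).ker = centralizerIn γ := by
  ext n
  rw [MonoidHom.mem_ker, centralizerIn, Subgroup.mem_subgroupOf, Subgroup.mem_inf,
    Subgroup.mem_centralizer_iff, Subtype.ext_iff, Prod.ext_iff, thetaHom_fst, thetaHom_snd]
  change conjP γ n = 1 ∧ ((n : G) : G ⧸ H) = 1 ↔ _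
  rw [QuotientGroup.eq_one_iff, and_comm]
  refine and_congr_right fun _ => ⟨fun h u hu => ?_, fun h => ?_⟩
  · have h2 := congrArg Subtype.val (DFunLike.congr_fun h ⟨u, hu⟩)
    rw [conjP_apply] at h2
    change (n : G) * u * (n : G)⁻¹ = u at h2
    exact (mul_inv_eq_iff_eq_mul.1 h2).symm
  · ext u
    rw [conjP_apply, ← h u u.2, mul_inv_cancel_right]
    rfl

theorem smul_image_carrier_subset (hi : i ∈ γ.carrier) {g : G}
    (hg : g ∈ Subgroup.normalizer (P : Set G)) (hx : conjFixed hg i ∈ γ.carrier) :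
    g • (FixedAlg.val '' γ.carrier : Set (BlockExt b)) ⊆ FixedAlg.val '' γ.carrier := by
  rintro _ ⟨_, ⟨j, hj, rfl⟩, rfl⟩
  obtain ⟨w, rfl⟩ := (γ.isPoint.mem_iff hi).1 hj
  refine ⟨conjFixed hg (w * i * (w⁻¹ : (FixedAlg b P)ˣ)), ?_, rfl⟩
  refine (γ.isPoint.mem_iff hx).2 ⟨Units.map (conjFixed hg).toMonoidHom w, ?_⟩
  rw [map_mul, map_mul]
  rfl

/-- Since γ is a single conjugacy class, testing one idempotent is enough. The reverse inclusion is
the same argument for g⁻¹. -/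
theorem mem_normalizerPt (hi : i ∈ γ.carrier) {g : G} (hg : g ∈ Subgroup.normalizer (P : Set G))
    (hx : conjFixed hg i ∈ γ.carrier) : g ∈ normalizerPt γ := by
  refine ⟨hg, MulAction.mem_stabilizer_iff.2 (subset_antisymm
    (smul_image_carrier_subset hi hg hx) ?_)⟩
  have hg' := inv_mem hg
  have h3 : conjFixed hg' i ∈ γ.carrier := by
    obtain ⟨x, hx⟩ := (γ.isPoint.mem_iff hi).1 hx
    refine (γ.isPoint.mem_iff hi).2 ⟨Units.map (conjFixed hg').toMonoidHom x⁻¹, ?_⟩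
    have h4 : i = conjFixed hg' (conjFixed hg i) := FixedAlg.val_injective
      (inv_smul_smul g (FixedAlg.val i)).symm
    rw [hx, map_mul, map_mul] at h4
    set c := conjFixed (b := b) hg'
    have h5 : c ↑x⁻¹ * c ↑x = 1 := by rw [← map_mul, Units.inv_mul, map_one]
    change c i = c ↑x⁻¹ * i * c x
    conv_rhs => rw [h4]
    rw [← mul_assoc, ← mul_assoc, h5, one_mul, mul_assoc, h5, mul_one]
  exact Set.subset_smul_set_iff.2 (smul_image_carrier_subset hi hg' h3)

/-- Let r and s in iAi realize a fusion (φ, x), with sr = i. Expanding r over G gives i = ∑ r_g s g,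
a sum of elements of B that P permutes through g ↦ φ(u) g u⁻¹. Locality of P_γ yields a fixed g
whose term is invertible after cutting by i. Being fixed means φ(u) = gug⁻¹, and invertibility makes
gig⁻¹ conjugate to i in B^P. -/
theorem thetaHom_surjective [Finite G] (hi : i ∈ γ.carrier) (hloc : IsLocalIdem i) :
    Function.Surjective (thetaHom hi) := by
  have := Fintype.ofFinite G
  rintro ⟨⟨φ, x⟩, hφ, f, hf⟩
  have hii := hloc.1.idem
  obtain ⟨r, s, hr, hs, hsr, hrs, his, hsi, hir, hri, hus, hur⟩ := hf.exists_unit hii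
  let h : G → BlockExt b := fun g => r.val.coeff g • (s * BlockExt.str b g)
  let _ : MulAction P G := MulAction.compHom G (twistedConj φ)
  have hact : ∀ (u : P) (g : G), u • g = (φ u : P) * (g * (u : G)⁻¹) := fun u g => rfl
  have hh : ∀ (u : P) g, (u : G) • h g = h (u • g) := by
    intro u g
    have h1 : r.val.coeff (u • g) = r.val.coeff g := by
      have h2 := congrArg (fun a : BlockExt b => a.val.coeff (((φ u : P) : G) * g)) (hur u)
      simp only [coeff_str_mul, coeff_mul_str, inv_mul_cancel_left] at h2
      rw [hact, h2, mul_assoc]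
    change (u : G) • (r.val.coeff g • (s * BlockExt.str b g)) =
      r.val.coeff (u • g) • (s * BlockExt.str b (u • g))
    rw [h1, smul_comm, BlockExt.conj_def, hact, map_mul, map_mul, ← mul_assoc, hus]
    simp only [mul_assoc]
  -- Only g in the coset x have a nonzero coefficient, and s has degree x⁻¹.
  have hdeg : ∀ g, h g ∈ BlockExt.component b (1 : G ⧸ H) := by
    intro g
    by_cases hg : r.val.coeff g = 0
    · change r.val.coeff g • _ ∈ _
      rw [hg, zero_smul]; exact zero_mem _
    · have h2 := BlockExt.mul_mem_component b hs (BlockExt.str_mem_component b (H := H) g)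
      rw [hr g hg, inv_mul_cancel] at h2
      exact Submodule.smul_mem _ _ h2
  have hsum : ∑ᶠ g, h g = FixedAlg.val i := by
    rw [finsum_eq_sum_of_fintype, ← hsr]
    conv_rhs => rw [BlockExt.eq_sum_str r, Finset.mul_sum]
    exact Finset.sum_congr rfl fun g _ => (mul_smul_comm _ _ _).symm
  obtain ⟨g, hfix, a, ha, -, -, c, hic, hci, hca, hac⟩ :=
    exists_fixed_isCornerUnit (i := i) hloc (γ.isLocal i hi) h hh hdeg hsum
  have hconj : ∀ u : P, ((φ u : P) : G) * g = g * u := fun u => by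
    have := hfix u
    rw [hact, ← mul_assoc, mul_inv_eq_iff_eq_mul] at this
    exact this
  have hg0 : r.val.coeff g ≠ 0 := by
    intro h0
    have : a = 0 := FixedAlg.val_injective (by
      rw [ha, map_zero]
      change r.val.coeff g • _ = _
      rw [h0, zero_smul])
    rw [this, mul_zero, zero_mul, mul_zero] at hca
    exact hloc.1.ne_zero hca.symm
  have hgN : g ∈ Subgroup.normalizer (P : Set G) := by
    refine Subgroup.mem_normalizer_iff.2 fun u => ⟨fun hu => ?_, fun hu => ?_⟩
    · rw [← hconj ⟨u, hu⟩, mul_inv_cancel_right]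
      exact SetLike.coe_mem _
    · have h2 := hconj (φ.symm ⟨_, hu⟩)
      rw [MulEquiv.apply_symm_apply] at h2
      change g * u * g⁻¹ * g = _ at h2
      rw [inv_mul_cancel_right] at h2
      rw [mul_left_cancel h2]
      exact SetLike.coe_mem _
  let j : FixedAlg b P := conjFixed hgN i
  have hj : FixedAlg.val j = BlockExt.str b g * FixedAlg.val i * BlockExt.str b g⁻¹ := rfl
  have hjg : FixedAlg.val j * BlockExt.str b g = BlockExt.str b g * FixedAlg.val i := by
    rw [hj, mul_assoc, BlockExt.str_inv_mul, mul_one]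
  set l := r.val.coeff g with hl
  set γg := BlockExt.str b g with hγg
  have ha' : FixedAlg.val a = l • (s * γg) := ha
  have hic' : FixedAlg.val i * FixedAlg.val c = FixedAlg.val c := by rw [← map_mul, hic]
  have hai : l • (s * γg * FixedAlg.val c) = FixedAlg.val i := by
    have h2 := congrArg FixedAlg.val hac
    rw [mul_assoc, hic, map_mul, map_mul, ha', mul_smul_comm, smul_mul_assoc, ← mul_assoc, his] at h2
    exact h2
  have hca' : l • (FixedAlg.val c * s * γg * FixedAlg.val i) = FixedAlg.val i := by
    have h2 := congrArg FixedAlg.val hca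
    rw [← mul_assoc, ← mul_assoc, hci, map_mul, map_mul, ha', mul_smul_comm, smul_mul_assoc,
      ← mul_assoc] at h2
    exact h2
  -- Multiply the relation l s g c = i on the left by r and use rs = i.
  have hr' : l • (FixedAlg.val i * γg * FixedAlg.val c) = r := by
    have h2 := congrArg (r * ·) hai
    simp only [mul_smul_comm, ← mul_assoc, hrs, hri] at h2
    exact h2
  -- With j = gig⁻¹, the elements ij and y link i and j: (ij)y = l i g c s = rs = i, and y(ij) = j
  -- because c inverts l s g in the corner.
  let y : FixedAlg b P := ⟨l • (γg * FixedAlg.val c * s), by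
    refine Submodule.smul_mem _ _ ?_
    have h2 := BlockExt.mul_mem_component b (BlockExt.mul_mem_component b
      (BlockExt.str_mem_component b (H := H) g) (FixedAlg.val_mem c)) hs
    rwa [hr g hg0, mul_one, mul_inv_cancel] at h2, by
    intro v hv
    obtain ⟨u, hu⟩ := φ.surjective ⟨v, hv⟩
    have hv' : v = ((φ u : P) : G) := by rw [hu]
    have h2 : BlockExt.str b v * (γg * FixedAlg.val c * s) =
        γg * FixedAlg.val c * s * BlockExt.str b v := by
      rw [hv', ← mul_assoc, ← mul_assoc, hγg, ← map_mul, hconj, map_mul, mul_assoc (BlockExt.str b g),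
        ← FixedAlg.val_mul_str u.2]
      simp only [mul_assoc]
      rw [hus]
    rw [smul_comm, BlockExt.conj_def, h2, mul_assoc, BlockExt.str_mul_inv, mul_one]⟩
  have hy : FixedAlg.val y = l • (γg * FixedAlg.val c * s) := rfl
  have hjidem : j * j = j := by rw [← map_mul, hii]
  have hjγ : j ∈ γ.carrier := by
    refine (γ.isPoint.mem_iff hi).2 (exists_unit_conj (y := y) hii hjidem ?_ ?_ ?_ ?_)
    all_goals apply FixedAlg.val_injective
    · rw [map_mul, hy, mul_smul_comm, ← mul_assoc, ← mul_assoc, hjg, mul_assoc γg, hic']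
    · rw [map_mul, hy, smul_mul_assoc, mul_assoc _ s, hsi]
    · rw [map_mul, map_mul, hy, mul_smul_comm, ← mul_assoc, ← mul_assoc, mul_assoc _ _ γg, hjg,
        mul_assoc _ (γg * _), mul_assoc γg, hic', ← mul_assoc, ← smul_mul_assoc, hr', hrs]
    · rw [map_mul, map_mul, hy, hj, smul_mul_assoc]
      have h2 : γg * FixedAlg.val c * s * (FixedAlg.val i * (γg * FixedAlg.val i *
          BlockExt.str b g⁻¹)) = γg * (FixedAlg.val c * (s * FixedAlg.val i) * γg *
            FixedAlg.val i) * BlockExt.str b g⁻¹ := by simp only [mul_assoc]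
      rw [h2, hsi, ← smul_mul_assoc, ← mul_smul_comm, hca']
  refine ⟨⟨g, mem_normalizerPt hi hgN hjγ⟩, Subtype.ext (Prod.ext ?_ (hr g hg0))⟩
  ext u
  rw [thetaHom_fst, conjP_apply]
  change g * u * g⁻¹ = _
  rw [← hconj, mul_inv_cancel_right]

end Theta

/-! ### The bimodule Ai ⊗_{OP} C and its endomorphisms. -/

section TensorProducts

variable {O : Type u} {G : Type v} [CommRing O] [Group G] {H : Subgroup G} [H.Normal]
  {b : InvariantBlock O H} {P : Subgroup G} (i : FixedAlg b P)

theorem rightMul_mul (u v : P) (m : leftMod i) :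
    rightMul i (u * v) m = rightMul i v (rightMul i u m) :=
  Subtype.ext (by
    change (m : BlockExt b) * BlockExt.str b ((u : G) * v) = m * _ * _
    rw [map_mul, mul_assoc])

namespace TensorC

/-- The group element `s` of `P ⋊ F` as an element of `C`. -/
abbrev el (s : P ⋊[actF i] GroupF i) : AlgC i := MonoidAlgebra.single s 1

theorem el_mul (s t : P ⋊[actF i] GroupF i) : el i s * el i t = el i (s * t) := by
  rw [MonoidAlgebra.single_mul_single, mul_one]

open Classical in
/-- The `O`-linear map which sends `u ∈ P` to the right multiplication with `u` on `Ai`, and the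
elements of `P ⋊ F` outside `P` to `0`. -/
def coefAux : AlgC i →ₗ[O] leftMod i →ₗ[BlockExt b] leftMod i :=
  (Finsupp.linearCombination O fun s : P ⋊[actF i] GroupF i =>
    if s.right = 1 then rightMul i s.left else 0) ∘ₗ
      (MonoidAlgebra.coeffLinearEquiv O).toLinearMap

open Classical in
theorem coefAux_el (s : P ⋊[actF i] GroupF i) :
    coefAux i (el i s) = if s.right = 1 then rightMul i s.left else 0 := by
  change Finsupp.linearCombination O _ (Finsupp.single s 1) = _
  rw [Finsupp.linearCombination_single, one_smul]

/-- The coefficient of degree `1 ∈ F` of an element of `Ai ⊗_{OP} C`. -/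
def coef : TensorC i →ₗ[BlockExt b] leftMod i :=
  (tensorRel i).liftQ (TensorProduct.AlgebraTensorModule.lift (coefAux i).flip) (by
    classical
    refine Submodule.span_le.2 ?_
    rintro _ ⟨m, u, c, rfl⟩
    rw [SetLike.mem_coe, LinearMap.mem_ker, map_sub, sub_eq_zero]
    change coefAux i c (rightMul i u m) = coefAux i (el i (SemidirectProduct.inl u) * c) m
    induction c using MonoidAlgebra.induction_on with
    | of s =>
      rw [MonoidAlgebra.of_apply, el_mul, coefAux_el, coefAux_el, SemidirectProduct.mul_right,
        SemidirectProduct.right_inl, one_mul, SemidirectProduct.mul_left,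
        SemidirectProduct.left_inl, SemidirectProduct.right_inl]
      split_ifs
      · rw [map_one, MulAut.one_apply, rightMul_mul]
      · rfl
    | add x y hx hy => rw [mul_add, map_add, map_add, LinearMap.add_apply, LinearMap.add_apply, hx, hy]
    | smul r x hx => rw [mul_smul_comm, map_smul, map_smul, LinearMap.smul_apply,
        LinearMap.smul_apply, hx])

open Classical in
theorem coef_tmul (m : leftMod i) (s : P ⋊[actF i] GroupF i) :
    coef i (tmul i m (el i s)) = if s.right = 1 then rightMul i s.left m else 0 := by
  change coefAux i (el i s) m = _
  rw [coefAux_el]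
  split_ifs <;> rfl

theorem rightMul_tmul (u : P) (m : leftMod i) (c : AlgC i) :
    tmul i (rightMul i u m) c = tmul i m (el i (SemidirectProduct.inl u) * c) := by
  refine (Submodule.Quotient.eq _).2 (Submodule.subset_span ⟨m, u, c, rfl⟩)

theorem smul_tmul (a : BlockExt b) (m : leftMod i) (c : AlgC i) :
    a • tmul i m c = tmul i (a • m) c := rfl

theorem tmul_add_left (m m' : leftMod i) (c : AlgC i) :
    tmul i (m + m') c = tmul i m c + tmul i m' c := by
  change (tensorRel i).mkQ _ = _
  rw [TensorProduct.add_tmul, map_add]; rfl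

theorem tmul_smul_left (r : O) (m : leftMod i) (c : AlgC i) :
    tmul i (r • m) c = r • tmul i m c := by
  change (tensorRel i).mkQ _ = _
  rw [← TensorProduct.smul_tmul', LinearMap.map_smul_of_tower]; rfl

theorem tmul_zero_left (c : AlgC i) : tmul i 0 c = 0 := by
  change (tensorRel i).mkQ _ = _
  rw [TensorProduct.zero_tmul, map_zero]; rfl

theorem rightMulC_rightMulC (c d : AlgC i) (t : TensorC i) :
    rightMulC i c (rightMulC i d t) = rightMulC i (d * c) t := by
  induction t using TensorC.induction with
  | h0 => simp
  | hadd x y hx hy => simp only [map_add, hx, hy]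
  | hsmul r x hx => simp only [LinearMap.map_smul_of_tower, hx]
  | htmul m s => simp only [rightMulC_tmul, mul_assoc]

theorem rightMulC_one (t : TensorC i) : rightMulC i (el i 1) t = t := by
  induction t using TensorC.induction with
  | h0 => simp
  | hadd x y hx hy => simp only [map_add, hx, hy]
  | hsmul r x hx => simp only [LinearMap.map_smul_of_tower, hx]
  | htmul m s => rw [rightMulC_tmul, el_mul, mul_one]

theorem rightMulC_el_el (s t : P ⋊[actF i] GroupF i) (x : TensorC i) :
    rightMulC i (el i s) (rightMulC i (el i t) x) = rightMulC i (el i (t * s)) x := by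
  rw [rightMulC_rightMulC, el_mul]

/-- The projections onto the components in terms of the coefficients. -/
theorem proj_eq_tmul (ψ : GroupF i) (t : TensorC i) :
    proj i ψ t = tmul i (coef i (rightMulC i (el i (SemidirectProduct.inr ψ⁻¹)) t))
      (el i (SemidirectProduct.inr ψ)) := by
  classical
  induction t using TensorC.induction with
  | h0 => simp [tmul_zero_left]
  | hadd x y hx hy => simp only [map_add, hx, hy, tmul_add_left]
  | hsmul r x hx => simp only [LinearMap.map_smul_of_tower, hx, tmul_smul_left]
  | htmul m s =>
    rw [proj_tmul, rightMulC_tmul, el_mul, coef_tmul, SemidirectProduct.mul_right,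
      SemidirectProduct.right_inr, SemidirectProduct.mul_left, SemidirectProduct.left_inr, map_one,
      mul_one]
    by_cases h : s.right = ψ
    · rw [if_pos h, if_pos (mul_inv_eq_one.2 h), rightMul_tmul, el_mul, ← h,
        SemidirectProduct.inl_left_mul_inr_right]
    · rw [if_neg h, if_neg (mt mul_inv_eq_one.1 h), tmul_zero_left]

/-- This is where the first condition on F enters: φ(u) and u have degrees conjugate under x,
exactly as the product in P ⋊ F requires. -/
theorem degC_mul (s t : P ⋊[actF i] GroupF i) : degC i (s * t) = degC i s * degC i t := by
  have h := s.right.2.1 t.left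
  rw [degC, degC, degC, SemidirectProduct.mul_left, SemidirectProduct.mul_right, Subgroup.coe_mul,
    QuotientGroup.mk_mul]
  change _ * (((((s.right : MulAut P × G ⧸ H).1 t.left : P) : G) : G ⧸ H)) * _ = _
  rw [h, Subgroup.coe_mul, Prod.snd_mul]
  group

theorem degC_inr (ψ : GroupF i) :
    degC i (SemidirectProduct.inr ψ) = (ψ : MulAut P × G ⧸ H).2 := by
  rw [degC, SemidirectProduct.left_inr, SemidirectProduct.right_inr]
  exact one_mul _

theorem rightMulC_mem_componentG (s : P ⋊[actF i] GroupF i) {x : G ⧸ H} {t : TensorC i}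
    (ht : t ∈ componentG i x) : rightMulC i (el i s) t ∈ componentG i (x * degC i s) := by
  refine Submodule.span_induction
    (p := fun t _ => rightMulC i (el i s) t ∈ componentG i (x * degC i s)) ?_ ?_ ?_ ?_ ht
  · rintro _ ⟨m, y, s', hm, hx, rfl⟩
    rw [rightMulC_tmul, el_mul]
    exact Submodule.subset_span ⟨m, y, s' * s, hm, by rw [degC_mul, ← mul_assoc, hx], rfl⟩
  · rw [map_zero]; exact zero_mem _
  · intro x y _ _ hx hy
    rw [map_add]; exact add_mem hx hy
  · intro r x _ hx
    rw [LinearMap.map_smul_of_tower]; exact Submodule.smul_mem _ r hx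

theorem smul_mem_componentG {a : BlockExt b} {z x : G ⧸ H} (ha : a ∈ BlockExt.component b z)
    {t : TensorC i} (ht : t ∈ componentG i x) : a • t ∈ componentG i (z * x) := by
  refine Submodule.span_induction (p := fun t _ => a • t ∈ componentG i (z * x)) ?_ ?_ ?_ ?_ ht
  · rintro _ ⟨m, y, s, hm, hx, rfl⟩
    rw [smul_tmul]
    exact Submodule.subset_span ⟨a • m, z * y, s, BlockExt.mul_mem_component b ha hm,
      by rw [mul_assoc, hx], rfl⟩
  · rw [smul_zero]; exact zero_mem _
  · intro x y _ _ hx hy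
    rw [smul_add]; exact add_mem hx hy
  · intro r x _ hx
    rw [smul_comm]; exact Submodule.smul_mem _ r hx

theorem coef_mem {x : G ⧸ H} {t : TensorC i} (ht : t ∈ componentG i x) :
    (coef i t : BlockExt b) ∈ BlockExt.component b x := by
  classical
  refine Submodule.span_induction
    (p := fun t _ => (coef i t : BlockExt b) ∈ BlockExt.component b x) ?_ ?_ ?_ ?_ ht
  · rintro _ ⟨m, y, s, hm, hx, rfl⟩
    rw [coef_tmul]
    split_ifs with h
    · rw [degC, h] at hx
      have h2 := BlockExt.mul_mem_component b hm (BlockExt.str_mem_component b (H := H) (s.left : G))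
      rw [← hx]
      change _ ∈ BlockExt.component b (y * (_ * 1))
      rw [mul_one]
      exact h2
    · exact zero_mem _
  · rw [map_zero]; exact zero_mem _
  · intro x y _ _ hx hy
    rw [map_add]; exact add_mem hx hy
  · intro r x _ hx
    rw [LinearMap.map_smul_of_tower]; exact Submodule.smul_mem _ r hx

theorem coef_rightMulC_inl (u : P) (t : TensorC i) :
    coef i (rightMulC i (el i (SemidirectProduct.inl u)) t) = rightMul i u (coef i t) := by
  classical
  induction t using TensorC.induction with
  | h0 => simp
  | hadd x y hx hy => simp only [map_add, hx, hy]
  | hsmul r x hx => simp only [LinearMap.map_smul_of_tower, hx]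
  | htmul m s =>
    rw [rightMulC_tmul, el_mul, coef_tmul, coef_tmul, SemidirectProduct.mul_right,
      SemidirectProduct.right_inl, mul_one, SemidirectProduct.mul_left, SemidirectProduct.left_inl]
    split_ifs with h
    · rw [h, map_one, MulAut.one_apply, rightMul_mul]
    · rw [map_zero]

theorem coef_of_mem_componentF {ψ : GroupF i} (hψ : ψ ≠ 1) {t : TensorC i}
    (ht : t ∈ componentF i ψ) : coef i t = 0 := by
  classical
  refine Submodule.span_induction (p := fun t _ => coef i t = 0) ?_ ?_ ?_ ?_ ht
  · rintro _ ⟨m, s, rfl, rfl⟩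
    rw [coef_tmul, if_neg hψ]
  · rw [map_zero]
  · intro x y _ _ hx hy
    rw [map_add, hx, hy, add_zero]
  · intro r x _ hx
    rw [LinearMap.map_smul_of_tower, hx, smul_zero]

theorem rightMulC_mem_componentF (s : P ⋊[actF i] GroupF i) {ψ : GroupF i} {t : TensorC i}
    (ht : t ∈ componentF i ψ) : rightMulC i (el i s) t ∈ componentF i (ψ * s.right) := by
  refine Submodule.span_induction
    (p := fun t _ => rightMulC i (el i s) t ∈ componentF i (ψ * s.right)) ?_ ?_ ?_ ?_ ht
  · rintro _ ⟨m, s', rfl, rfl⟩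
    rw [rightMulC_tmul, el_mul]
    exact Submodule.subset_span ⟨m, s' * s, rfl, rfl⟩
  · rw [map_zero]; exact zero_mem _
  · intro x y _ _ hx hy
    rw [map_add]; exact add_mem hx hy
  · intro r x _ hx
    rw [LinearMap.map_smul_of_tower]; exact Submodule.smul_mem _ r hx

theorem smul_mem_componentF (a : BlockExt b) {ψ : GroupF i} {t : TensorC i}
    (ht : t ∈ componentF i ψ) : a • t ∈ componentF i ψ := by
  refine Submodule.span_induction (p := fun t _ => a • t ∈ componentF i ψ) ?_ ?_ ?_ ?_ ht
  · rintro _ ⟨m, s, rfl, rfl⟩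
    rw [smul_tmul]
    exact Submodule.subset_span ⟨a • m, s, rfl, rfl⟩
  · rw [smul_zero]; exact zero_mem _
  · intro x y _ _ hx hy
    rw [smul_add]; exact add_mem hx hy
  · intro r x _ hx
    rw [smul_comm]; exact Submodule.smul_mem _ r hx

/-- The elements of degree `1 ∈ G ⧸ H` on which the two actions of `P` coincide; this is a
`B^P`-module. -/
def fixed : Submodule O (TensorC i) where
  carrier := {t | t ∈ componentG i 1 ∧ ∀ u : P, BlockExt.str b (u : G) • t =
    rightMulC i (el i (SemidirectProduct.inl u)) t}
  add_mem' := fun hx hy => ⟨add_mem hx.1 hy.1, fun u => by rw [smul_add, map_add, hx.2, hy.2]⟩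
  zero_mem' := ⟨zero_mem _, fun u => by rw [smul_zero, map_zero]⟩
  smul_mem' := fun r x hx => ⟨Submodule.smul_mem _ r hx.1, fun u => by
    rw [smul_comm, LinearMap.map_smul_of_tower, hx.2]⟩

theorem val_smul_mem_fixed (a : FixedAlg b P) {t : TensorC i} (ht : t ∈ fixed i) :
    FixedAlg.val a • t ∈ fixed i := by
  refine ⟨?_, fun u => ?_⟩
  · have := smul_mem_componentG i (FixedAlg.val_mem a) ht.1
    rwa [mul_one] at this
  · rw [map_smul, ← ht.2, ← mul_smul, ← mul_smul, FixedAlg.val_mul_str u.2]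

/-- The generator `i ⊗ 1`. -/
def gen : TensorC i := tmul i ⟨FixedAlg.val i, self_mem_leftMod i⟩ (el i 1)

theorem gen_mem_fixed : gen i ∈ fixed i := by
  refine ⟨Submodule.subset_span ⟨_, 1, 1, FixedAlg.val_mem i, ?_, rfl⟩, fun u => ?_⟩
  · rw [one_mul]; exact mul_one _
  · rw [gen, rightMulC_tmul, el_mul, one_mul, ← mul_one (SemidirectProduct.inl u), ← el_mul,
      ← rightMul_tmul, smul_tmul]
    congr 1
    exact Subtype.ext (FixedAlg.val_mul_str u.2 i).symm

theorem gen_mem_componentF : gen i ∈ componentF i 1 :=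
  Submodule.subset_span ⟨_, 1, rfl, rfl⟩

theorem coef_gen : (coef i (gen i) : BlockExt b) = FixedAlg.val i := by
  classical
  rw [gen, coef_tmul, if_pos SemidirectProduct.one_right]
  change FixedAlg.val i * BlockExt.str b 1 = _
  rw [map_one, mul_one]

/-- Since m = mi for m in Ai, the bimodule is generated by i ⊗ 1, so its endomorphisms are
determined there. -/
theorem tmul_eq_smul_gen (hi : i * i = i) (m : leftMod i) (s : P ⋊[actF i] GroupF i) :
    tmul i m (el i s) = (m : BlockExt b) • rightMulC i (el i s) (gen i) := by
  rw [gen, rightMulC_tmul, el_mul, one_mul, smul_tmul]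
  congr 1
  exact Subtype.ext ((mem_leftMod hi).1 m.2).symm

/-- The `A`-linear map `m ⊗ c ↦ m t c`. -/
def ofFixed (t : TensorC i) (ht : t ∈ fixed i) : TensorC i →ₗ[BlockExt b] TensorC i :=
  (tensorRel i).liftQ (TensorProduct.AlgebraTensorModule.lift
    { toFun := fun m =>
        { toFun := fun c => (m : BlockExt b) • rightMulC i c t
          map_add' := fun c d => by rw [rightMulC_add, smul_add]
          map_smul' := fun r c => by rw [rightMulC_smul, smul_comm]; rfl }
      map_add' := fun m m' => LinearMap.ext fun c => add_smul (m : BlockExt b) (m' : BlockExt b) _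
      map_smul' := fun a m => LinearMap.ext fun c => mul_smul a (m : BlockExt b) _ }) (by
    refine Submodule.span_le.2 ?_
    rintro _ ⟨m, u, c, rfl⟩
    rw [SetLike.mem_coe, LinearMap.mem_ker, map_sub, sub_eq_zero]
    change ((m : BlockExt b) * BlockExt.str b (u : G)) • rightMulC i c t =
      (m : BlockExt b) • rightMulC i (el i (SemidirectProduct.inl u) * c) t
    rw [mul_smul, ← rightMulC_rightMulC, ← ht.2, map_smul])

theorem ofFixed_tmul (t : TensorC i) (ht : t ∈ fixed i) (m : leftMod i) (c : AlgC i) :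
    ofFixed i t ht (tmul i m c) = (m : BlockExt b) • rightMulC i c t := rfl

end TensorC

namespace FrakF

/-- The endomorphism of the bimodule `Ai ⊗_{OP} C` which maps `i ⊗ 1` to `i t`. -/
def ofFixed (t : TensorC i) (ht : t ∈ TensorC.fixed i) : FrakF i :=
  ⟨MulOpposite.op (TensorC.ofFixed i t ht), by
    constructor
    · intro c x
      change TensorC.ofFixed i t ht _ = TensorC.rightMulC i c (TensorC.ofFixed i t ht x)
      induction x using TensorC.induction with
      | h0 => simp
      | hadd x y hx hy => simp only [map_add, hx, hy]
      | hsmul r x hx => simp only [LinearMap.map_smul_of_tower, hx]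
      | htmul m s =>
        rw [TensorC.rightMulC_tmul, TensorC.ofFixed_tmul, TensorC.ofFixed_tmul, map_smul,
          TensorC.rightMulC_rightMulC]
    · intro x y hy
      change TensorC.ofFixed i t ht y ∈ _
      refine Submodule.span_induction
        (p := fun y _ => TensorC.ofFixed i t ht y ∈ TensorC.componentG i x) ?_ ?_ ?_ ?_ hy
      · rintro _ ⟨m, z, s, hm, rfl, rfl⟩
        rw [TensorC.ofFixed_tmul]
        have h := TensorC.smul_mem_componentG i hm (TensorC.rightMulC_mem_componentG i s ht.1)
        rwa [one_mul] at h
      · rw [map_zero]; exact zero_mem _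
      · intro x y _ _ hx hy
        rw [map_add]; exact add_mem hx hy
      · intro r x _ hx
        rw [LinearMap.map_smul_of_tower]; exact Submodule.smul_mem _ r hx⟩

/-- Together with `ext_gen` and `toEnd_mem_fixed` this identifies 𝓕 with iT, where T is the module
of fixed elements. -/
theorem toEnd_ofFixed_gen (t : TensorC i) (ht : t ∈ TensorC.fixed i) :
    toEnd (ofFixed i t ht) (TensorC.gen i) = FixedAlg.val i • t := by
  change FixedAlg.val i • TensorC.rightMulC i _ t = _
  rw [TensorC.rightMulC_one]

variable {i}

theorem toEnd_rightMulC (f : FrakF i) (c : AlgC i) (t : TensorC i) :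
    toEnd f (TensorC.rightMulC i c t) = TensorC.rightMulC i c (toEnd f t) := f.2.1 c t

theorem toEnd_mem_fixed (f : FrakF i) {t : TensorC i} (ht : t ∈ TensorC.fixed i) :
    toEnd f t ∈ TensorC.fixed i :=
  ⟨f.2.2 1 t ht.1, fun u => by rw [← map_smul, ht.2, toEnd_rightMulC]⟩

theorem ext_gen (hi : i * i = i) {f g : FrakF i}
    (h : toEnd f (TensorC.gen i) = toEnd g (TensorC.gen i)) : f = g := by
  refine Subtype.ext (MulOpposite.unop_injective (LinearMap.ext fun t => ?_))
  change toEnd f t = toEnd g t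
  induction t using TensorC.induction with
  | h0 => simp
  | hadd x y hx hy => simp only [map_add, hx, hy]
  | hsmul r x hx => simp only [LinearMap.map_smul_of_tower, hx]
  | htmul m s =>
    rw [TensorC.tmul_eq_smul_gen i hi, map_smul, map_smul, toEnd_rightMulC, toEnd_rightMulC, h]

end FrakF

end TensorProducts

/-! ### The fixed elements T modulo m_γ T as a module over B(P_γ) * E. -/

section BrauerModule

variable {O : Type u} {G : Type v} [CommRing O] [Group G] {H : Subgroup G} [H.Normal]
  {b : InvariantBlock O H} {P : Subgroup G}

namespace TensorC

variable (i : FixedAlg b P)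

/-- The action of `B^P` on the fixed elements of `Ai ⊗_{OP} C`. -/
def fixedMul : FixedAlg b P →+* Module.End O (fixed i) where
  toFun a :=
    { toFun := fun t => ⟨FixedAlg.val a • (t : TensorC i), val_smul_mem_fixed i a t.2⟩
      map_add' := fun x y => Subtype.ext (smul_add (FixedAlg.val a) (x : TensorC i) y)
      map_smul' := fun r x => Subtype.ext (smul_comm (FixedAlg.val a) r (x : TensorC i)) }
  map_one' := LinearMap.ext fun t => Subtype.ext (one_smul (BlockExt b) (t : TensorC i))
  map_mul' a c := LinearMap.ext fun t =>
    Subtype.ext (mul_smul (FixedAlg.val a) (FixedAlg.val c) (t : TensorC i))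
  map_zero' := LinearMap.ext fun t => Subtype.ext (zero_smul (BlockExt b) (t : TensorC i))
  map_add' a c := LinearMap.ext fun t =>
    Subtype.ext (add_smul (FixedAlg.val a) (FixedAlg.val c) (t : TensorC i))

theorem coe_fixedMul (a : FixedAlg b P) (t : fixed i) :
    (fixedMul i a t : TensorC i) = FixedAlg.val a • (t : TensorC i) := rfl

/-- The coefficient of degree `1 ∈ F` of a fixed element, as an element of `B^P`. -/
def fixedCoef : fixed i →ₗ[O] FixedAlg b P where
  toFun t := ⟨coef i (t : TensorC i), coef_mem i t.2.1, fun u hu => by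
    have h := congrArg (fun x => ((coef i x : leftMod i) : BlockExt b)) (t.2.2 ⟨u, hu⟩)
    simp only [map_smul, coef_rightMulC_inl] at h
    change BlockExt.str b u * (coef i (t : TensorC i) : BlockExt b) =
      (coef i (t : TensorC i) : BlockExt b) * BlockExt.str b u at h
    rw [BlockExt.conj_def, h, mul_assoc, BlockExt.str_mul_inv, mul_one]⟩
  map_add' x y := FixedAlg.val_injective
    (congrArg Subtype.val (map_add (coef i) (x : TensorC i) (y : TensorC i)))
  map_smul' r x := FixedAlg.val_injective
    (congrArg Subtype.val ((coef i).map_smul_of_tower r (x : TensorC i)))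

theorem val_fixedCoef (t : fixed i) :
    FixedAlg.val (fixedCoef i t) = (coef i (t : TensorC i) : BlockExt b) := rfl

theorem fixedCoef_fixedMul (a : FixedAlg b P) (t : fixed i) :
    fixedCoef i (fixedMul i a t) = a * fixedCoef i t := by
  refine FixedAlg.val_injective ?_
  rw [val_fixedCoef, coe_fixedMul, map_smul, map_mul, val_fixedCoef]
  rfl

/-- The action of `𝓕` on the fixed elements of `Ai ⊗_{OP} C`. -/
def fixedEnd (f : FrakF i) : Module.End O (fixed i) :=
  ((FrakF.toEnd f).restrictScalars O).restrict fun _ ht => FrakF.toEnd_mem_fixed f ht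

theorem fixedEnd_fixedMul (f : FrakF i) (a : FixedAlg b P) (t : fixed i) :
    fixedEnd i f (fixedMul i a t) = fixedMul i a (fixedEnd i f t) :=
  Subtype.ext (map_smul (FrakF.toEnd f) (FixedAlg.val a) (t : TensorC i))

variable {i} [IsLocalRing O] {γ : LocalPoint b P}

/-- The twisted action `t ↦ g t θ(g)⁻¹` of `N_G(P_γ)` on `Ai ⊗_{OP} C`. -/
def twist (hi : i ∈ γ.carrier) (n : normalizerPt γ) (t : TensorC i) : TensorC i :=
  BlockExt.str b (n : G) • rightMulC i (el i (SemidirectProduct.inr (thetaHom hi n)⁻¹)) t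

theorem twist_smul (hi : i ∈ γ.carrier) (n : normalizerPt γ) (a : FixedAlg b P) (t : TensorC i) :
    twist hi n (FixedAlg.val a • t) = FixedAlg.val (n • a) • twist hi n t := by
  rw [twist, twist, map_smul, ← mul_smul, ← mul_smul, str_mul_val]

theorem twist_mul (hi : i ∈ γ.carrier) (m n : normalizerPt γ) (t : TensorC i) :
    twist hi (m * n) t = twist hi m (twist hi n t) := by
  rw [twist, twist, twist, map_smul, ← mul_smul, ← map_mul, rightMulC_el_el, ← map_mul, map_mul,
    mul_inv_rev]
  rfl

/-- The degrees of n and θ(n)⁻¹ cancel. For u in P put v = n⁻¹un; then un = nv on the left and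
vθ(n)⁻¹ = θ(n)⁻¹u in P ⋊ F on the right. -/
theorem twist_mem_fixed (hi : i ∈ γ.carrier) (n : normalizerPt γ) {t : TensorC i}
    (ht : t ∈ fixed i) : twist hi n t ∈ fixed i := by
  refine ⟨?_, fun u => ?_⟩
  · have h := smul_mem_componentG i (BlockExt.str_mem_component b (H := H) (n : G))
      (rightMulC_mem_componentG i (SemidirectProduct.inr (thetaHom hi n)⁻¹) ht.1)
    rw [one_mul, degC_inr] at h
    have h2 : ((n : G) : G ⧸ H) * (((thetaHom hi n)⁻¹ : GroupF i) : MulAut P × G ⧸ H).2 = 1 := by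
      change ((n : G) : G ⧸ H) * ((thetaHom hi n : MulAut P × G ⧸ H).2)⁻¹ = 1
      rw [thetaHom_snd, mul_inv_cancel]
    rwa [h2] at h
  · let v : P := (conjP γ n)⁻¹ u
    have hv : conjP γ n v = u := MulAut.apply_inv_self _ _ _
    have hv' : (u : G) * n = n * v := by rw [← hv, conjP_apply, inv_mul_cancel_right]
    have hs : (SemidirectProduct.inl v * SemidirectProduct.inr (thetaHom hi n)⁻¹ :
        P ⋊[actF i] GroupF i) =
        SemidirectProduct.inr (thetaHom hi n)⁻¹ * SemidirectProduct.inl u := by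
      have h : (SemidirectProduct.inl v : P ⋊[actF i] GroupF i) = _ :=
        SemidirectProduct.inl_aut_inv (thetaHom hi n) u
      rw [h, mul_assoc, ← map_mul, mul_inv_cancel, map_one, mul_one]
    rw [twist, map_smul, ← mul_smul, ← map_mul, hv', map_mul, mul_smul, ← map_smul, ht.2,
      rightMulC_el_el, rightMulC_el_el, hs]

theorem twist_mem_componentF (hi : i ∈ γ.carrier) (n : normalizerPt γ) {ψ : GroupF i} {t : TensorC i}
    (ht : t ∈ componentF i ψ) : twist hi n t ∈ componentF i (ψ * (thetaHom hi n)⁻¹) :=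
  smul_mem_componentF i _ (rightMulC_mem_componentF i
    (SemidirectProduct.inr (thetaHom hi n)⁻¹) ht)

theorem toEnd_twist (hi : i ∈ γ.carrier) (n : normalizerPt γ) (f : FrakF i) (t : TensorC i) :
    FrakF.toEnd f (twist hi n t) = twist hi n (FrakF.toEnd f t) := by
  rw [twist, twist, map_smul, FrakF.toEnd_rightMulC]

/-- Since θ is trivial on C_H(P), the twisted action there agrees with the structural map into B^P.
This is the relation defining the crossed product. -/
theorem twist_of_mem (hi : i ∈ γ.carrier) {n : normalizerPt γ} (hn : n ∈ centralizerIn γ)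
    (t : TensorC i) : twist hi n t = BlockExt.str b (n : G) • t := by
  rw [← thetaHom_ker hi, MonoidHom.mem_ker] at hn
  rw [twist, hn, inv_one, map_one, rightMulC_one]

/-- The action of `N_G(P_γ)` on the fixed elements of `Ai ⊗_{OP} C`. -/
def fixedTwist (hi : i ∈ γ.carrier) : normalizerPt γ →* Module.End O (fixed i) where
  toFun n :=
    { toFun := fun t => ⟨twist hi n t, twist_mem_fixed hi n t.2⟩
      map_add' := fun x y => Subtype.ext (by
        change twist hi n ((x : TensorC i) + y) = twist hi n x + twist hi n y
        rw [twist, map_add, smul_add]; rfl)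
      map_smul' := fun r x => Subtype.ext (by
        change twist hi n (r • (x : TensorC i)) = r • twist hi n x
        rw [twist, LinearMap.map_smul_of_tower, smul_comm]; rfl) }
  map_one' := LinearMap.ext fun t => Subtype.ext (by
    change twist hi 1 (t : TensorC i) = t
    rw [twist_of_mem hi (one_mem _)]
    change BlockExt.str b 1 • _ = _
    rw [map_one, one_smul])
  map_mul' m n := LinearMap.ext fun t => Subtype.ext (twist_mul hi m n t)

theorem coe_fixedTwist (hi : i ∈ γ.carrier) (n : normalizerPt γ) (t : fixed i) :
    (fixedTwist hi n t : TensorC i) = twist hi n t := rfl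

theorem fixedTwist_fixedMul (hi : i ∈ γ.carrier) (n : normalizerPt γ) (a : FixedAlg b P)
    (t : fixed i) : fixedTwist hi n (fixedMul i a t) = fixedMul i (n • a) (fixedTwist hi n t) :=
  Subtype.ext (twist_smul hi n a t)

/-- The submodule `m_γ T`, for the `B^P`-module `T` of fixed elements. -/
def radical (_ : i ∈ γ.carrier) : Submodule O (fixed i) :=
  Submodule.span O {t | ∃ a ∈ pointIdeal γ.carrier, ∃ s, t = fixedMul i a s}

theorem radical_le_comap (hi : i ∈ γ.carrier) (g : Module.End O (fixed i))
    (hg : ∀ a ∈ pointIdeal γ.carrier, ∀ s, g (fixedMul i a s) ∈ radical hi) :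
    radical hi ≤ (radical hi).comap g := by
  refine Submodule.span_le.2 ?_
  rintro _ ⟨a, ha, s, rfl⟩
  exact hg a ha s

theorem fixedMul_mem_radical (hi : i ∈ γ.carrier) {a : FixedAlg b P}
    (ha : a ∈ pointIdeal γ.carrier) (s : fixed i) : fixedMul i a s ∈ radical hi :=
  Submodule.subset_span ⟨a, ha, s, rfl⟩

theorem radical_le_comap_mul (hi : i ∈ γ.carrier) (c : FixedAlg b P) :
    radical hi ≤ (radical hi).comap (fixedMul i c) :=
  radical_le_comap hi _ fun a ha s => by
    rw [← Module.End.mul_apply, ← map_mul]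
    exact fixedMul_mem_radical hi (Ideal.mul_mem_left _ _ ha) s

theorem radical_le_comap_twist (hi : i ∈ γ.carrier) (n : normalizerPt γ) :
    radical hi ≤ (radical hi).comap (fixedTwist hi n) :=
  radical_le_comap hi _ fun a ha s => by
    rw [fixedTwist_fixedMul]
    -- The twist is semilinear, and m_γ is stable under the stabilizer of γ.
    exact fixedMul_mem_radical hi (smul_mem_pointIdeal n (conj_mem_carrier γ n) ha) _

theorem radical_le_comap_end (hi : i ∈ γ.carrier) (f : FrakF i) :
    radical hi ≤ (radical hi).comap (fixedEnd i f) :=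
  radical_le_comap hi _ fun a ha s => by
    rw [fixedEnd_fixedMul]
    exact fixedMul_mem_radical hi ha _

end TensorC

open TensorC

variable {i : FixedAlg b P} [IsLocalRing O] {γ : LocalPoint b P}

/-- The `B(P_γ)`-module `T ⧸ m_γ T`, for the `B^P`-module `T` of fixed elements of
`Ai ⊗_{OP} C`. -/
def BrauerMod (hi : i ∈ γ.carrier) : Type (max u v) := fixed i ⧸ radical hi

namespace BrauerMod

variable (hi : i ∈ γ.carrier)

instance : AddCommGroup (BrauerMod hi) := inferInstanceAs (AddCommGroup (fixed i ⧸ radical hi))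
instance : Module O (BrauerMod hi) := inferInstanceAs (Module O (fixed i ⧸ radical hi))

/-- The quotient map `T → T ⧸ m_γ T`. -/
def mk : fixed i →ₗ[O] BrauerMod hi := (radical hi).mkQ

theorem mk_surjective : Function.Surjective (mk hi) := (radical hi).mkQ_surjective

theorem mk_eq_zero {t : fixed i} : mk hi t = 0 ↔ t ∈ radical hi := Submodule.Quotient.mk_eq_zero _

theorem hom_ext {f g : Module.End O (BrauerMod hi)} (h : ∀ t, f (mk hi t) = g (mk hi t)) : f = g :=
  LinearMap.ext fun w => by
    obtain ⟨t, rfl⟩ := mk_surjective hi w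
    exact h t

/-- `B^P` acts on `T ⧸ m_γ T`. -/
def mulFixed : FixedAlg b P →+* Module.End O (BrauerMod hi) where
  toFun a := (radical hi).mapQ (radical hi) (fixedMul i a) (radical_le_comap_mul hi a)
  map_one' := hom_ext hi fun t => by
    change mk hi (fixedMul i 1 t) = mk hi t
    rw [map_one]; rfl
  map_mul' a c := hom_ext hi fun t => by
    change mk hi (fixedMul i (a * c) t) = mk hi (fixedMul i a (fixedMul i c t))
    rw [map_mul]; rfl
  map_zero' := hom_ext hi fun t => by
    change mk hi (fixedMul i 0 t) = 0
    rw [map_zero]; exact map_zero _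
  map_add' a c := hom_ext hi fun t => by
    change mk hi (fixedMul i (a + c) t) = mk hi (fixedMul i a t) + mk hi (fixedMul i c t)
    rw [map_add]; exact map_add (mk hi) _ _

theorem mulFixed_mk (a : FixedAlg b P) (t : fixed i) :
    mulFixed hi a (mk hi t) = mk hi (fixedMul i a t) := rfl

/-- `B(P_γ)` acts on `T ⧸ m_γ T`. -/
def mulQuot : SimpleQuot γ →+* Module.End O (BrauerMod hi) :=
  Ideal.Quotient.lift (pointIdeal γ.carrier) (mulFixed hi) fun a ha => hom_ext hi fun t => by
    rw [mulFixed_mk]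
    exact (mk_eq_zero hi).2 (fixedMul_mem_radical hi ha t)

/-- `N_G(P_γ)` acts on `T ⧸ m_γ T`. -/
def twistHom : normalizerPt γ →* Module.End O (BrauerMod hi) where
  toFun n := (radical hi).mapQ (radical hi) (fixedTwist hi n) (radical_le_comap_twist hi n)
  map_one' := hom_ext hi fun t => by
    change mk hi (fixedTwist hi 1 t) = mk hi t
    rw [map_one]; rfl
  map_mul' m n := hom_ext hi fun t => by
    change mk hi (fixedTwist hi (m * n) t) = mk hi (fixedTwist hi m (fixedTwist hi n t))
    rw [map_mul]; rfl

/-- The skew group algebra of `N_G(P_γ)` over `B(P_γ)` acts on `T ⧸ m_γ T`. -/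
def skewHom : SkewMonoidAlgebra (SimpleQuot γ) (normalizerPt γ) →+* Module.End O (BrauerMod hi) :=
  SkewMonoidAlgebra.liftNCRingHom (mulQuot hi) (twistHom hi) (by
    intro x n
    obtain ⟨a, rfl⟩ := SimpleQuot.mk_surjective γ x
    refine hom_ext hi fun t => ?_
    change mk hi (fixedMul i (n • a) (fixedTwist hi n t)) =
      mk hi (fixedTwist hi n (fixedMul i a t))
    rw [fixedTwist_fixedMul])

theorem skewHom_single (n : normalizerPt γ) (x : SimpleQuot γ) :
    skewHom hi (SkewMonoidAlgebra.single n x) = mulQuot hi x * twistHom hi n :=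
  SkewMonoidAlgebra.liftNC_single _ _ _ _

/-- The crossed product `B(P_γ) * E` acts on `T ⧸ m_γ T`. -/
def crossedHom : CrossedE γ →+* Module.End O (BrauerMod hi) :=
  RingCon.lift _ (skewHom hi) (by
    refine RingCon.ringConGen_le.2 ?_
    rintro _ _ ⟨c, rfl, rfl⟩
    rw [RingCon.ker_apply, skewHom_single, skewHom_single, map_one, map_one, mul_one, one_mul]
    refine hom_ext hi fun t => ?_
    exact congrArg (mk hi) (Subtype.ext (twist_of_mem hi c.2 _).symm))

instance : Module (CrossedE γ) (BrauerMod hi) := Module.compHom _ (crossedHom hi)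

instance : Module (SimpleQuot γ) (BrauerMod hi) := Module.compHom _ (mulQuot hi)

theorem quot_smul_mk (a : FixedAlg b P) (t : fixed i) :
    SimpleQuot.mk γ a • mk hi t = mk hi (fixedMul i a t) := rfl

theorem single_smul_mk (n : normalizerPt γ) (a : FixedAlg b P) (t : fixed i) :
    (CrossedProduct.mk (centralizerIn γ) (SimpleQuot.str γ)
      (SkewMonoidAlgebra.single n (SimpleQuot.mk γ a)) : CrossedE γ) • mk hi t =
      mk hi (fixedMul i a (fixedTwist hi n t)) := by
  change skewHom hi _ (mk hi t) = _
  rw [skewHom_single]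
  rfl

theorem incl_smul (x : SimpleQuot γ) (w : BrauerMod hi) :
    CrossedProduct.incl (centralizerIn γ) (SimpleQuot.str γ) x • w = x • w := by
  obtain ⟨t, rfl⟩ := mk_surjective hi w
  obtain ⟨a, rfl⟩ := SimpleQuot.mk_surjective γ x
  refine (single_smul_mk hi 1 a t).trans ?_
  rw [map_one]
  rfl

theorem crossed_induction {p : CrossedE γ → Prop} (hadd : ∀ x y, p x → p y → p (x + y))
    (hsingle : ∀ (n : normalizerPt γ) (a : FixedAlg b P),
      p (CrossedProduct.mk (centralizerIn γ) (SimpleQuot.str γ)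
        (SkewMonoidAlgebra.single n (SimpleQuot.mk γ a)))) (x : CrossedE γ) : p x := by
  obtain ⟨x, rfl⟩ := RingCon.mk'_surjective _ x
  induction x using SkewMonoidAlgebra.induction_on' with
  | add x y hx hy => rw [map_add]; exact hadd _ _ hx hy
  | single n x =>
    obtain ⟨a, rfl⟩ := SimpleQuot.mk_surjective γ x
    exact hsingle n a

/-- The action of `𝓕` on `T ⧸ m_γ T`, as `O`-linear maps. -/
def frakEndAux (f : FrakF i) : Module.End O (BrauerMod hi) :=
  (radical hi).mapQ (radical hi) (fixedEnd i f) (radical_le_comap_end hi f)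

theorem frakEndAux_mk (f : FrakF i) (t : fixed i) :
    frakEndAux hi f (mk hi t) = mk hi (fixedEnd i f t) := rfl

/-- The action of `𝓕` on `T ⧸ m_γ T`. -/
def frakEnd (f : FrakF i) : Module.End (CrossedE γ) (BrauerMod hi) where
  toFun := frakEndAux hi f
  map_add' := map_add _
  map_smul' x w := by
    obtain ⟨t, rfl⟩ := mk_surjective hi w
    induction x using crossed_induction with
    | hadd x y hx hy =>
      rw [add_smul, map_add, hx, hy]
      exact (add_smul x y _).symm
    | hsingle n a =>
      rw [RingHom.id_apply, single_smul_mk, frakEndAux_mk, frakEndAux_mk, single_smul_mk,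
        fixedEnd_fixedMul]
      congr 2
      exact Subtype.ext (toEnd_twist hi n f t)

theorem frakEnd_mk (f : FrakF i) (t : fixed i) :
    frakEnd hi f (mk hi t) = mk hi (fixedEnd i f t) := rfl

/-- The right action of `𝓕` on `T ⧸ m_γ T`. -/
def frakHom : FrakF i →+* (Module.End (CrossedE γ) (BrauerMod hi))ᵐᵒᵖ where
  toFun f := MulOpposite.op (frakEnd hi f)
  map_one' := MulOpposite.unop_injective (LinearMap.ext fun w => by
    obtain ⟨t, rfl⟩ := mk_surjective hi w; rfl)
  map_mul' f g := MulOpposite.unop_injective (LinearMap.ext fun w => by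
    obtain ⟨t, rfl⟩ := mk_surjective hi w; rfl)
  map_zero' := MulOpposite.unop_injective (LinearMap.ext fun w => by
    obtain ⟨t, rfl⟩ := mk_surjective hi w; rfl)
  map_add' f g := MulOpposite.unop_injective (LinearMap.ext fun w => by
    obtain ⟨t, rfl⟩ := mk_surjective hi w; rfl)

/-- The coefficient of degree `1 ∈ F`, as a map `T ⧸ m_γ T → B(P_γ)`. -/
def coef : BrauerMod hi →+ SimpleQuot γ :=
  (((radical hi).liftQ ((Ideal.Quotient.mkₐ O (pointIdeal γ.carrier)).toLinearMap ∘ₗ fixedCoef i) (by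
    refine Submodule.span_le.2 ?_
    rintro _ ⟨a, ha, s, rfl⟩
    rw [SetLike.mem_coe, LinearMap.mem_ker, LinearMap.comp_apply, fixedCoef_fixedMul]
    exact Ideal.Quotient.eq_zero_iff_mem.2 (Ideal.mul_mem_right _ _ ha))).toAddMonoidHom :
      (fixed i ⧸ radical hi) →+ (FixedAlg b P ⧸ pointIdeal γ.carrier))

theorem coef_mk (t : fixed i) : coef hi (mk hi t) = SimpleQuot.mk γ (fixedCoef i t) := rfl

theorem coef_smul (x : SimpleQuot γ) (w : BrauerMod hi) : coef hi (x • w) = x * coef hi w := by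
  obtain ⟨t, rfl⟩ := mk_surjective hi w
  obtain ⟨a, rfl⟩ := SimpleQuot.mk_surjective γ x
  rw [quot_smul_mk, coef_mk, fixedCoef_fixedMul, map_mul]
  rfl

/-- The component of degree `ψ ∈ F` of `T ⧸ m_γ T`. -/
def component (ψ : GroupF i) : Submodule O (BrauerMod hi) :=
  ((componentF i ψ).comap (fixed i).subtype).map (mk hi)

theorem mk_mem_component {ψ : GroupF i} {t : fixed i} (ht : (t : TensorC i) ∈ componentF i ψ) :
    mk hi t ∈ component hi ψ := ⟨t, ht, rfl⟩

/-- The coefficient map serves as a detector of degree 1. Combined with translations by N_G(P_γ), it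
will separate all components. -/
theorem coef_of_mem {ψ : GroupF i} (hψ : ψ ≠ 1) {w : BrauerMod hi} (hw : w ∈ component hi ψ) :
    coef hi w = 0 := by
  obtain ⟨t, ht, rfl⟩ := hw
  change (t : TensorC i) ∈ componentF i ψ at ht
  rw [coef_mk, show fixedCoef i t = 0 from FixedAlg.val_injective (by
    rw [val_fixedCoef, coef_of_mem_componentF i hψ ht]; rfl), map_zero]

theorem single_smul_mem (n : normalizerPt γ) (x : SimpleQuot γ) {ψ : GroupF i} {w : BrauerMod hi}
    (hw : w ∈ component hi ψ) :
    (CrossedProduct.mk (centralizerIn γ) (SimpleQuot.str γ)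
      (SkewMonoidAlgebra.single n x) : CrossedE γ) • w ∈
      component hi (ψ * (thetaHom hi n)⁻¹) := by
  obtain ⟨t, ht, rfl⟩ := hw
  obtain ⟨a, rfl⟩ := SimpleQuot.mk_surjective γ x
  rw [single_smul_mk]
  exact mk_mem_component hi (smul_mem_componentF i _ (twist_mem_componentF hi n ht))

theorem frakEnd_mem {f : FrakF i} {φ ψ : GroupF i} (hf : f ∈ FrakF.component i φ)
    {w : BrauerMod hi} (hw : w ∈ component hi ψ) : frakEnd hi f w ∈ component hi (φ⁻¹ * ψ) := by
  obtain ⟨t, ht, rfl⟩ := hw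
  exact mk_mem_component hi (hf ψ _ ht)

/-- The class of `i ⊗ 1`. -/
def gen : BrauerMod hi := mk hi ⟨TensorC.gen i, gen_mem_fixed i⟩

theorem gen_mem : gen hi ∈ component hi 1 := mk_mem_component hi (gen_mem_componentF i)

theorem coef_gen : coef hi (gen hi) = SimpleQuot.mk γ i := by
  rw [gen, coef_mk]
  exact congrArg _ (FixedAlg.val_injective (TensorC.coef_gen i))

end BrauerMod

end BrauerModule

/-! ### Simple modules of B(P_γ) and the universal property of induction. -/

section Comparison

namespace Induced

variable {R : Type u} {S : Type v} [Ring R] [Ring S] (ι : S →+* R) (V : Type w)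
  [AddCommGroup V] [Module S V]

theorem tmul_smul (x : R) (s : S) (y : V) : tmul ι V x (s • y) = tmul ι V (x * ι s) y :=
  ((Submodule.Quotient.eq (inducedRel ι V)).2 (Submodule.subset_span ⟨x, s, y, rfl⟩)).symm

theorem tmul_add_right (x : R) (y y' : V) : tmul ι V x (y + y') = tmul ι V x y + tmul ι V x y' := by
  change (inducedRel ι V).mkQ _ = _
  rw [TensorProduct.tmul_add, map_add]; rfl

theorem tmul_zero_right (x : R) : tmul ι V x 0 = 0 := by
  change (inducedRel ι V).mkQ _ = _
  rw [TensorProduct.tmul_zero, map_zero]; rfl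

theorem tmul_eq_smul (x : R) (y : V) : tmul ι V x y = x • tmul ι V 1 y := by
  rw [smul_tmul, mul_one]

theorem induction {p : Induced ι V → Prop} (h0 : p 0) (hadd : ∀ x y, p x → p y → p (x + y))
    (htmul : ∀ x y, p (tmul ι V x y)) (m : Induced ι V) : p m := by
  obtain ⟨t, rfl⟩ := (inducedRel ι V).mkQ_surjective m
  induction t using TensorProduct.induction_on with
  | zero => exact h0
  | add x y hx hy => rw [map_add]; exact hadd _ _ hx hy
  | tmul x y => exact htmul x y

/-- The universal property of the induced module. -/
def lift {W : Type*} [AddCommGroup W] [Module R W] (g : V →+ W)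
    (hg : ∀ (s : S) (y : V), g (s • y) = ι s • g y) : Induced ι V →ₗ[R] W :=
  (inducedRel ι V).liftQ (TensorProduct.AlgebraTensorModule.lift
    (LinearMap.toSpanSingleton R (V →ₗ[ℤ] W) g.toIntLinearMap)) (by
    refine Submodule.span_le.2 ?_
    rintro _ ⟨x, s, y, rfl⟩
    rw [SetLike.mem_coe, LinearMap.mem_ker, map_sub, sub_eq_zero]
    change (x * ι s) • g y = x • g (s • y)
    rw [hg, mul_smul])

theorem lift_tmul {W : Type*} [AddCommGroup W] [Module R W] (g : V →+ W)
    (hg : ∀ (s : S) (y : V), g (s • y) = ι s • g y) (x : R) (y : V) :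
    lift ι V g hg (tmul ι V x y) = x • g y := rfl

end Induced

/-- The homomorphism from a simple module which is given by the image of one nonzero vector. -/
theorem exists_linearMap_of_isSimpleModule {S : Type u} [Ring S] {V : Type v} [AddCommGroup V]
    [Module S V] [IsSimpleModule S V] {W : Type w} [AddCommGroup W] [Module S W] {v₀ : V} (w : W)
    (h₀ : v₀ ≠ 0) (h : ∀ x : S, x • v₀ = 0 → x • w = 0) : ∃ g : V →ₗ[S] W, g v₀ = w := by
  have hs : Function.Surjective (LinearMap.toSpanSingleton S V v₀) :=
    IsSimpleModule.toSpanSingleton_surjective S h₀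
  let e := LinearMap.quotKerEquivOfSurjective _ hs
  let g := (LinearMap.ker (LinearMap.toSpanSingleton S V v₀)).liftQ
    (LinearMap.toSpanSingleton S W w) (fun x hx => h x hx)
  refine ⟨g ∘ₗ e.symm.toLinearMap, ?_⟩
  have : e.symm v₀ = Submodule.Quotient.mk 1 := by
    rw [LinearEquiv.symm_apply_eq]
    exact (one_smul S v₀).symm
  change g (e.symm v₀) = w
  rw [this]
  exact one_smul S w

variable {O : Type u} {G : Type v} [CommRing O] [Group G] {H : Subgroup G} [H.Normal]
  {b : InvariantBlock O H} {P : Subgroup G} {i : FixedAlg b P} [IsLocalRing O] {γ : LocalPoint b P}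

theorem SimpleQuot.mk_eq_zero {a : FixedAlg b P} :
    SimpleQuot.mk γ a = 0 ↔ a ∈ pointIdeal γ.carrier := Ideal.Quotient.eq_zero_iff_mem

theorem SimpleQuot.mk_ne_zero (hi : i ∈ γ.carrier) (hloc : IsLocalIdem i) :
    SimpleQuot.mk γ i ≠ 0 := fun h =>
  hloc.not_mem_pointIdeal γ.isPoint hi (SimpleQuot.mk_eq_zero.1 h)

/-- Every nonzero two-sided ideal of `B(P_γ)` contains the image of `γ`. -/
theorem SimpleQuot.mk_mem_of_ne_bot (hi : i ∈ γ.carrier) {I : Ideal (SimpleQuot γ)}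
    [I.IsTwoSided] (hI : I ≠ ⊥) : SimpleQuot.mk γ i ∈ I := by
  by_contra h
  refine hI (eq_bot_iff.2 fun x hx => ?_)
  obtain ⟨a, rfl⟩ := SimpleQuot.mk_surjective γ x
  refine SimpleQuot.mk_eq_zero.2 ?_
  have h1 : I.comap (SimpleQuot.mk γ) ≤ pointIdeal γ.carrier :=
    le_sSup ⟨inferInstance, fun h2 => h (h2 hi)⟩
  exact h1 hx

/-- The ring is Artinian, being finite over k. A nonzero Jacobson radical would contain the image of
i, but for a nonzero idempotent ī the element 1 - ī kills ī and has no left inverse. -/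
theorem SimpleQuot.isSemisimpleRing [IsNoetherianRing O] [Finite G] (hi : i ∈ γ.carrier)
    (hloc : IsLocalIdem i) : IsSemisimpleRing (SimpleQuot γ) := by
  have h1 : Module.Finite (IsLocalRing.ResidueField O) (SimpleQuot γ) := by
    have h2 : IsScalarTower O (IsLocalRing.ResidueField O) (SimpleQuot γ) :=
      IsScalarTower.of_algebraMap_eq fun r => rfl
    have h3 : Module.Finite O (SimpleQuot γ) :=
      Module.Finite.of_surjective (Ideal.Quotient.mkₐ O (pointIdeal γ.carrier)).toLinearMap
        (SimpleQuot.mk_surjective γ)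
    exact Module.Finite.of_restrictScalars_finite O _ _
  have h2 : IsArtinianRing (SimpleQuot γ) := IsArtinianRing.of_finite (IsLocalRing.ResidueField O) _
  refine IsArtinianRing.isSemisimpleRing_iff_jacobson.2 ?_
  by_contra h
  have h3 : SimpleQuot.mk γ i ∈ Ring.jacobson (SimpleQuot γ) := mk_mem_of_ne_bot hi h
  obtain ⟨y, hy⟩ : ∃ y, y * (1 - SimpleQuot.mk γ i) = 1 := by
    obtain ⟨y, hy⟩ := Ideal.exists_mul_sub_mem_of_sub_one_mem_jacobson (I := ⊥)
      (1 - SimpleQuot.mk γ i) (by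
        rw [Ideal.jacobson_bot, sub_sub_cancel_left]; exact neg_mem h3)
    exact ⟨y, sub_eq_zero.1 hy⟩
  refine mk_ne_zero hi hloc ?_
  calc SimpleQuot.mk γ i = y * (1 - SimpleQuot.mk γ i) * SimpleQuot.mk γ i := by rw [hy, one_mul]
    _ = 0 := by rw [mul_assoc, sub_mul, one_mul, ← map_mul, hloc.1.idem, sub_self, mul_zero]

/-- If ī annihilated V, realized as a left ideal I, then I would lie in the two-sided ideal of all x
with ī B(P_γ) x = 0. That ideal would be nonzero and so contain ī, contradicting ī² = ī ≠ 0. -/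
theorem exists_vector [IsNoetherianRing O] [Finite G] (hi : i ∈ γ.carrier)
    (hloc : IsLocalIdem i) (V : Type w) [AddCommGroup V] [Module (SimpleQuot γ) V]
    [IsSimpleModule (SimpleQuot γ) V] : ∃ v : V, SimpleQuot.mk γ i • v = v ∧ v ≠ 0 := by
  have hss := SimpleQuot.isSemisimpleRing hi hloc
  by_contra hV
  push Not at hV
  have h0 : ∀ v : V, SimpleQuot.mk γ i • v = 0 := fun v =>
    hV _ (by rw [← mul_smul, ← map_mul, hloc.1.idem])
  obtain ⟨I, ⟨e⟩⟩ := IsSemisimpleRing.exists_linearEquiv_ideal_of_isSimpleModule (SimpleQuot γ) V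
  have hI : ∀ x ∈ I, SimpleQuot.mk γ i * x = 0 := fun x hx => by
    have := congrArg (fun z => (e z : SimpleQuot γ)) (h0 (e.symm ⟨x, hx⟩))
    simpa using this
  have hne : I ≠ ⊥ := by
    rintro rfl
    have := IsSimpleModule.nontrivial (SimpleQuot γ) V
    obtain ⟨v, hv⟩ := exists_ne (0 : V)
    exact hv (e.injective (Subsingleton.elim _ _))
  let K : Ideal (SimpleQuot γ) :=
    { carrier := {x | ∀ c, SimpleQuot.mk γ i * c * x = 0}
      add_mem' := fun hx hy c => by rw [mul_add, hx, hy, add_zero]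
      zero_mem' := fun c => mul_zero _
      smul_mem' := fun r x hx c => by rw [smul_eq_mul, ← mul_assoc, mul_assoc _ c, hx] }
  have hK : K.IsTwoSided := ⟨fun {x} c hx d => by rw [← mul_assoc, hx, zero_mul]⟩
  have hIK : I ≤ K := fun x hx c => by rw [mul_assoc, hI _ (I.mul_mem_left c hx)]
  have h1 : SimpleQuot.mk γ i ∈ K :=
    SimpleQuot.mk_mem_of_ne_bot hi fun h => hne (eq_bot_iff.2 (h ▸ hIK))
  have h2 := h1 1
  rw [mul_one, ← map_mul, hloc.1.idem] at h2
  exact SimpleQuot.mk_ne_zero hi hloc h2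

/-- If xī ≠ 0, a lift ai of it lies outside m_γ and has a left inverse d by locality. Then v = īv =
d̄xīv = d̄xv = 0. In effect V is B(P_γ)ī. -/
theorem mul_eq_zero_of_smul_eq_zero (hi : i ∈ γ.carrier) (hloc : IsLocalIdem i) {V : Type w}
    [AddCommGroup V] [Module (SimpleQuot γ) V] {v : V} (hv : SimpleQuot.mk γ i • v = v)
    (hv0 : v ≠ 0) {x : SimpleQuot γ} (hx : x • v = 0) : x * SimpleQuot.mk γ i = 0 := by
  obtain ⟨a, rfl⟩ := SimpleQuot.mk_surjective γ x
  by_contra h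
  rw [← map_mul, SimpleQuot.mk_eq_zero] at h
  obtain ⟨d, hd⟩ := hloc.exists_mul_eq_of_not_mem γ.isPoint hi (by rw [mul_assoc, hloc.1.idem]) h
  refine hv0 ?_
  rw [← hv, ← hd, map_mul, map_mul, mul_smul, mul_smul, hv, hx, smul_zero]

end Comparison

/-! ### From the induced module to T/m_γT. -/

section Comparison

variable {O : Type u} {G : Type v} [CommRing O] [Group G] {H : Subgroup G} [H.Normal]
  {b : InvariantBlock O H} {P : Subgroup G} {i : FixedAlg b P} [IsLocalRing O] {γ : LocalPoint b P}

/-- The element `x ⊗ n` of the crossed product `B(P_γ) * E`. -/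
def crossedEl (n : normalizerPt γ) (x : SimpleQuot γ) : CrossedE γ :=
  CrossedProduct.mk (centralizerIn γ) (SimpleQuot.str γ) (SkewMonoidAlgebra.single n x)

theorem crossedEl_mul (m n : normalizerPt γ) (x y : SimpleQuot γ) :
    crossedEl m x * crossedEl n y = crossedEl (m * n) (x * m • y) := by
  rw [crossedEl, crossedEl, ← map_mul, SkewMonoidAlgebra.single_mul_single]
  rfl

theorem crossedEl_one_one : crossedEl (γ := γ) 1 1 = 1 :=
  map_one (CrossedProduct.mk (centralizerIn γ) (SimpleQuot.str γ))

theorem crossedEl_centralizer (c : centralizerIn γ) :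
    crossedEl (c : normalizerPt γ) 1 = crossedEl 1 (SimpleQuot.str γ c) :=
  (RingCon.eq _).2 (RingConGen.Rel.symm (RingConGen.Rel.of _ _ ⟨c, rfl, rfl⟩))

theorem crossedEl_mem (n : normalizerPt γ) (x : SimpleQuot γ) :
    crossedEl n x ∈ CrossedProduct.component (centralizerIn γ) (SimpleQuot.str γ) n :=
  AddSubgroup.subset_closure ⟨n, x, rfl, rfl⟩

theorem incl_eq_crossedEl (x : SimpleQuot γ) :
    CrossedProduct.incl (centralizerIn γ) (SimpleQuot.str γ) x = crossedEl 1 x := rfl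

theorem crossedEl_mul_centralizer (n : normalizerPt γ) (c : centralizerIn γ) (x : SimpleQuot γ) :
    crossedEl (n * (c : normalizerPt γ)) x = crossedEl n 1 * crossedEl 1 ((n⁻¹ • x) * SimpleQuot.str γ c) := by
  have h : crossedEl (n * (c : normalizerPt γ)) x =
      crossedEl n 1 * (crossedEl 1 (n⁻¹ • x) * crossedEl (c : normalizerPt γ) 1) := by
    rw [crossedEl_mul, crossedEl_mul, one_mul, smul_one, mul_one, smul_inv_smul, one_mul]
  rw [h, crossedEl_centralizer, crossedEl_mul, one_smul, one_mul]

/-! ### Homogeneous components of the induced module. -/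

section Components

variable (V : Type w) [AddCommGroup V] [Module (SimpleQuot γ) V]

/-- The element `1 ⊗ v` of `(B(P_γ) * E) ⊗ V`. -/
def indOne (v : V) : InducedE γ V := Induced.tmul _ V 1 v

theorem tmul_eq_smul_indOne (x : CrossedE γ) (v : V) :
    Induced.tmul (CrossedProduct.incl (centralizerIn γ) (SimpleQuot.str γ)) V x v =
      x • indOne V v := Induced.tmul_eq_smul _ _ _ _

theorem crossedEl_one_smul_indOne (x : SimpleQuot γ) (v : V) :
    crossedEl 1 x • indOne V v = indOne (γ := γ) V (x • v) := by
  rw [indOne, indOne, Induced.tmul_smul, one_mul, Induced.smul_tmul, mul_one, incl_eq_crossedEl]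

theorem crossedEl_smul_indOne_mem (n : normalizerPt γ) (x : SimpleQuot γ) (v : V) :
    crossedEl n x • indOne V v ∈ inducedComponent γ V n :=
  AddSubgroup.subset_closure ⟨_, crossedEl_mem n x, v, (tmul_eq_smul_indOne V _ v).symm⟩

theorem indOne_mem (v : V) : indOne (γ := γ) V v ∈ inducedComponent γ V 1 := by
  have h := crossedEl_smul_indOne_mem V (1 : normalizerPt γ) 1 v
  rwa [crossedEl_one_one, one_smul] at h

theorem indOne_add (v v' : V) : indOne (γ := γ) V (v + v') = indOne V v + indOne V v' :=
  Induced.tmul_add_right _ _ _ _ _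

theorem indOne_zero : indOne (γ := γ) V 0 = 0 := Induced.tmul_zero_right _ _ _

/-- The component of the induced module of degree `n C_H(P)` is `n ⊗ V`. -/
theorem exists_of_mem_inducedComponent (n : normalizerPt γ) {m : InducedE γ V}
    (hm : m ∈ inducedComponent γ V n) : ∃ v, m = crossedEl n 1 • indOne V v := by
  refine AddSubgroup.closure_induction
    (p := fun m _ => ∃ v, m = crossedEl n 1 • indOne V v) ?_ ?_ ?_ ?_ hm
  · rintro _ ⟨x, hx, y, rfl⟩
    rw [tmul_eq_smul_indOne]
    refine AddSubgroup.closure_induction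
      (p := fun x _ => ∃ v, x • indOne V y = crossedEl n 1 • indOne V v) ?_ ?_ ?_ ?_ hx
    · rintro _ ⟨n', a, hn', rfl⟩
      have hc : n⁻¹ * n' ∈ centralizerIn γ := QuotientGroup.eq.1 (Eq.symm hn')
      -- Two representatives of a coset differ by an element of C_H(P), which the crossed product
      -- relation moves into B(P_γ) and hence into V.
      have h : n' = n * ((⟨n⁻¹ * n', hc⟩ : centralizerIn γ) : normalizerPt γ) :=
        (mul_inv_cancel_left n n').symm
      change ∃ v, crossedEl n' a • indOne V y = crossedEl n 1 • indOne (γ := γ) V v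
      rw [h, crossedEl_mul_centralizer, mul_smul, crossedEl_one_smul_indOne]
      exact ⟨_, rfl⟩
    · exact ⟨0, by rw [zero_smul, indOne_zero, smul_zero]⟩
    · rintro x x' _ _ ⟨v, hv⟩ ⟨v', hv'⟩
      exact ⟨v + v', by rw [add_smul, hv, hv', indOne_add, smul_add]⟩
    · rintro x _ ⟨v, hv⟩
      refine ⟨(-1 : SimpleQuot γ) • v, ?_⟩
      rw [neg_smul, hv, neg_smul, one_smul, ← sub_eq_zero, ← neg_add', neg_eq_zero, ← smul_add,
        ← indOne_add, add_neg_cancel, indOne_zero, smul_zero]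
  · exact ⟨0, by rw [indOne_zero, smul_zero]⟩
  · rintro x x' _ _ ⟨v, hv⟩ ⟨v', hv'⟩
    exact ⟨v + v', by rw [hv, hv', indOne_add, smul_add]⟩
  · rintro x _ ⟨v, hv⟩
    refine ⟨-v, ?_⟩
    rw [hv, ← sub_eq_zero, ← neg_add', neg_eq_zero, ← smul_add, ← indOne_add, add_neg_cancel,
      indOne_zero, smul_zero]

/-- The induced module is the sum of its components. -/
theorem exists_sum_inducedComponent [Fintype (GroupE γ)] (m : InducedE γ V) :
    ∃ c : GroupE γ → InducedE γ V, (∀ e, c e ∈ inducedComponent γ V e) ∧ m = ∑ e, c e := by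
  classical
  have hadd : ∀ x y : InducedE γ V,
      (∃ c : GroupE γ → InducedE γ V, (∀ e, c e ∈ inducedComponent γ V e) ∧ x = ∑ e, c e) →
      (∃ c : GroupE γ → InducedE γ V, (∀ e, c e ∈ inducedComponent γ V e) ∧ y = ∑ e, c e) →
      ∃ c : GroupE γ → InducedE γ V, (∀ e, c e ∈ inducedComponent γ V e) ∧ x + y = ∑ e, c e := by
    rintro x y ⟨c, hc, rfl⟩ ⟨d, hd, rfl⟩
    exact ⟨c + d, fun e => add_mem (hc e) (hd e), by simp [Finset.sum_add_distrib]⟩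
  induction m using Induced.induction with
  | h0 => exact ⟨0, fun e => zero_mem _, by simp⟩
  | hadd x y hx hy => exact hadd x y hx hy
  | htmul x v =>
    rw [tmul_eq_smul_indOne]
    induction x using BrauerMod.crossed_induction with
    | hadd x y hx hy => rw [add_smul]; exact hadd _ _ hx hy
    | hsingle n a =>
      refine ⟨Pi.single (n : GroupE γ) (crossedEl n (SimpleQuot.mk γ a) • indOne V v), fun e => ?_,
        ?_⟩
      · by_cases he : e = n
        · subst he
          rw [Pi.single_eq_same]
          exact crossedEl_smul_indOne_mem V n _ v
        · rw [Pi.single_eq_of_ne he]; exact zero_mem _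
      · rw [Finset.sum_pi_single']
        simp
        rfl

end Components

/-- The comparison of the induced module with `T ⧸ m_γ T`. -/
theorem exists_comparison (hi : i ∈ γ.carrier) (hloc : IsLocalIdem i) {V : Type w}
    [AddCommGroup V] [Module (SimpleQuot γ) V] [IsSimpleModule (SimpleQuot γ) V] {v₀ : V}
    (hv : SimpleQuot.mk γ i • v₀ = v₀) (hv0 : v₀ ≠ 0) :
    ∃ f : InducedE γ V →ₗ[CrossedE γ] BrauerMod hi, f (indOne V v₀) = BrauerMod.gen hi := by
  have hgen : SimpleQuot.mk γ i • BrauerMod.gen hi = BrauerMod.gen hi := by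
    rw [BrauerMod.gen, BrauerMod.quot_smul_mk]
    refine congrArg _ (Subtype.ext ?_)
    rw [TensorC.coe_fixedMul]
    change FixedAlg.val i • TensorC.tmul i _ _ = TensorC.tmul i _ _
    rw [TensorC.smul_tmul]
    congr 1
    exact Subtype.ext (congrArg FixedAlg.val hloc.1.idem)
  -- Whatever annihilates v₀ also annihilates the class of i ⊗ 1, since that class is fixed by ī.
  obtain ⟨g, hg⟩ := exists_linearMap_of_isSimpleModule (BrauerMod.gen hi) hv0 fun x hx => by
    rw [← hgen, ← mul_smul, mul_eq_zero_of_smul_eq_zero hi hloc hv hv0 hx, zero_smul]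
  refine ⟨Induced.lift _ V g.toAddMonoidHom fun s y => ?_, ?_⟩
  · rw [BrauerMod.incl_smul]
    exact map_smul g s y
  · rw [indOne, Induced.lift_tmul, one_smul]
    exact hg

end Comparison

/-! ### The comparison is an isomorphism of graded modules. -/

section Equivalence

variable {O : Type u} {G : Type v} [CommRing O] [Group G] {H : Subgroup G} [H.Normal]
  {b : InvariantBlock O H} {P : Subgroup G} {i : FixedAlg b P} [IsLocalRing O] {γ : LocalPoint b P}

/-- The map s e vanishes on every other component and is injective on N e, so nothing nonzero of N e
is a sum of elements of the others. Additivity suffices, and no projection onto N e is needed. Both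
gradings are shown to be direct in this way. -/
theorem iSupIndep_of_separating {K R Y X : Type*} [Ring K] [AddCommGroup R] [Module K R]
    [AddCommGroup Y] (N : X → Submodule K R) (s : X → R →+ Y)
    (h0 : ∀ e e', e ≠ e' → ∀ x ∈ N e', s e x = 0) (h1 : ∀ e, ∀ x ∈ N e, s e x = 0 → x = 0) :
    iSupIndep N := by
  refine iSupIndep_def.2 fun e => Submodule.disjoint_def.2 fun x hx hx' => h1 e x hx ?_
  refine Submodule.iSup_induction (motive := fun x => s e x = 0) _ hx' ?_ (map_zero _) ?_
  · intro e' x hx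
    refine Submodule.iSup_induction (motive := fun x => s e x = 0) _ hx ?_ (map_zero _) ?_
    · intro he x hx
      exact h0 e e' (Ne.symm he) x hx
    · intro x y hx hy
      rw [map_add, hx, hy, add_zero]
  · intro x y hx hy
    rw [map_add, hx, hy, add_zero]

namespace TensorC

variable (i) in
/-- The element `i ⊗ 1`, as a fixed element. -/
def fixedGen : fixed i := ⟨gen i, gen_mem_fixed i⟩

theorem fixedMul_fixedGen (hii : i * i = i) : fixedMul i i (fixedGen i) = fixedGen i :=
  Subtype.ext (by
    rw [coe_fixedMul]
    change FixedAlg.val i • tmul i _ _ = tmul i _ _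
    rw [smul_tmul]
    congr 1
    exact Subtype.ext (congrArg FixedAlg.val hii))

/-- The homogeneous parts of a fixed element, in terms of the twisted action. -/
theorem proj_eq_fixedTwist (hi : i ∈ γ.carrier) (hii : i * i = i) (n : normalizerPt γ)
    (t : fixed i) : proj i (thetaHom hi n)⁻¹ (t : TensorC i) =
      fixedTwist hi n (fixedMul i (fixedCoef i (fixedTwist hi n⁻¹ t)) (fixedGen i)) := by
  have h : FixedAlg.val (fixedCoef i (fixedTwist hi n⁻¹ t)) = BlockExt.str b (n : G)⁻¹ *
      (coef i (rightMulC i (el i (SemidirectProduct.inr (thetaHom hi n))) (t : TensorC i)) :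
        BlockExt b) := by
    rw [val_fixedCoef, coe_fixedTwist, twist, map_smul, map_inv (thetaHom hi), inv_inv]
    rfl
  rw [coe_fixedTwist, coe_fixedMul, twist, map_smul, h, ← mul_smul, ← mul_assoc,
    BlockExt.str_mul_inv, one_mul, proj_eq_tmul, inv_inv, tmul_eq_smul_gen i hii]
  rfl

/-- Every degree in F has the form θ(n)⁻¹ because θ is onto, so `proj_eq_fixedTwist` reaches every
homogeneous part of T. -/
theorem exists_eq_sum_fixedTwist [Fintype (GroupF i)] [Finite G] (hi : i ∈ γ.carrier)
    (hloc : IsLocalIdem i) (t : fixed i) :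
    ∃ (n : GroupF i → normalizerPt γ) (a : GroupF i → FixedAlg b P),
      t = ∑ ψ, fixedTwist hi (n ψ) (fixedMul i (a ψ) (fixedGen i)) := by
  choose n hn using fun ψ => thetaHom_surjective hi hloc (ψ⁻¹)
  refine ⟨n, fun ψ => fixedCoef i (fixedTwist hi (n ψ)⁻¹ t), Subtype.ext ?_⟩
  rw [← Submodule.coe_subtype, map_sum, Submodule.coe_subtype, ← sum_proj i (t : TensorC i)]
  refine Finset.sum_congr rfl fun ψ _ => ?_
  rw [← proj_eq_fixedTwist hi hloc.1.idem, hn, inv_inv]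

end TensorC

theorem BrauerMod.gen_def (hi : i ∈ γ.carrier) :
    BrauerMod.gen hi = BrauerMod.mk hi (TensorC.fixedGen i) := rfl

theorem BrauerMod.crossedEl_smul_mk (hi : i ∈ γ.carrier) (n : normalizerPt γ) (a : FixedAlg b P)
    (t : TensorC.fixed i) : crossedEl n 1 • crossedEl 1 (SimpleQuot.mk γ a) • BrauerMod.mk hi t =
      BrauerMod.mk hi (TensorC.fixedTwist hi n (TensorC.fixedMul i a t)) := by
  rw [← incl_eq_crossedEl, BrauerMod.incl_smul, BrauerMod.quot_smul_mk, crossedEl,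
    ← map_one (SimpleQuot.mk γ), BrauerMod.single_smul_mk, map_one]
  rfl

theorem BrauerMod.crossedEl_smul_mem (hi : i ∈ γ.carrier) (n : normalizerPt γ) (x : SimpleQuot γ)
    {ψ : GroupF i} {w : BrauerMod hi} (hw : w ∈ BrauerMod.component hi ψ) :
    crossedEl n x • w ∈ BrauerMod.component hi (ψ * (thetaHom hi n)⁻¹) :=
  BrauerMod.single_smul_mem hi n x hw

/-- The elements `n ⊗ 1` are invertible. -/
theorem crossedEl_inv_smul {W : Type*} [AddCommGroup W] [Module (CrossedE γ) W]
    (n : normalizerPt γ) (w : W) : crossedEl n⁻¹ 1 • crossedEl n 1 • w = w := by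
  rw [← mul_smul, crossedEl_mul, inv_mul_cancel, smul_one, one_mul, crossedEl_one_one, one_smul]

theorem thetaHom_eq_iff (hi : i ∈ γ.carrier) (m n : normalizerPt γ) :
    thetaHom hi m = thetaHom hi n ↔ (m : GroupE γ) = n := by
  rw [QuotientGroup.eq, ← thetaHom_ker hi, MonoidHom.mem_ker, map_mul, map_inv, inv_mul_eq_one]

section Map

variable {V : Type w} [AddCommGroup V] [Module (SimpleQuot γ) V] [IsSimpleModule (SimpleQuot γ) V]
  (hi : i ∈ γ.carrier) {v₀ : V} (hv0 : v₀ ≠ 0)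
  {f : InducedE γ V →ₗ[CrossedE γ] BrauerMod hi} (hf : f (indOne V v₀) = BrauerMod.gen hi)

include hv0 in
/-- The homogeneous elements of the induced module, in terms of a nonzero vector. -/
theorem exists_eq_crossedEl_smul (n : normalizerPt γ) {m : InducedE γ V}
    (hm : m ∈ inducedComponent γ V n) :
    ∃ x : SimpleQuot γ, m = crossedEl n 1 • crossedEl 1 x • indOne V v₀ := by
  obtain ⟨v, rfl⟩ := exists_of_mem_inducedComponent V n hm
  obtain ⟨x, rfl⟩ := IsSimpleModule.toSpanSingleton_surjective (SimpleQuot γ) hv0 v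
  exact ⟨x, by rw [crossedEl_one_smul_indOne]; rfl⟩

include hv0 hf in
theorem comparison_mem (n : normalizerPt γ) {m : InducedE γ V} (hm : m ∈ inducedComponent γ V n) :
    f m ∈ BrauerMod.component hi (thetaHom hi n)⁻¹ := by
  obtain ⟨x, rfl⟩ := exists_eq_crossedEl_smul hv0 n hm
  rw [map_smul, map_smul, hf]
  have h := BrauerMod.crossedEl_smul_mem hi n 1
    (BrauerMod.crossedEl_smul_mem hi 1 x (BrauerMod.gen_mem hi))
  rwa [map_one, inv_one, one_mul, one_mul] at h

variable (f) in
/-- An additive function which detects the component of degree `n C_H(P)`. -/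
def separate (n : normalizerPt γ) : InducedE γ V →+ SimpleQuot γ :=
  (BrauerMod.coef hi).comp ((DistribSMul.toAddMonoidHom _ (crossedEl n⁻¹ 1 : CrossedE γ)).comp
    f.toAddMonoidHom)

theorem separate_apply (n : normalizerPt γ) (m : InducedE γ V) :
    separate hi f n m = BrauerMod.coef hi (crossedEl n⁻¹ 1 • f m) := rfl

/-- Translation by n⁻¹ moves degree θ(n')⁻¹ to θ(n')⁻¹θ(n), which is not 1 when the cosets differ.
-/
theorem separate_of_map_mem {n n' : normalizerPt γ} (h : (n : GroupE γ) ≠ n') {m : InducedE γ V}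
    (hm : f m ∈ BrauerMod.component hi (thetaHom hi n')⁻¹) : separate hi f n m = 0 := by
  refine BrauerMod.coef_of_mem hi ?_ (BrauerMod.crossedEl_smul_mem hi n⁻¹ 1 hm)
  rw [map_inv, inv_inv, Ne, inv_mul_eq_one, thetaHom_eq_iff]
  exact Ne.symm h

include hv0 hf in
-- For m = n ⊗ xv₀ the separating function returns xī. If this is zero, then xv₀ = xīv₀ = 0.
theorem eq_zero_of_separate (hloc : IsLocalIdem i) (hv : SimpleQuot.mk γ i • v₀ = v₀)
    {n : normalizerPt γ} {m : InducedE γ V} (hm : m ∈ inducedComponent γ V n)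
    (h : separate hi f n m = 0) : m = 0 := by
  obtain ⟨x, rfl⟩ := exists_eq_crossedEl_smul hv0 n hm
  rw [separate_apply, map_smul f, map_smul f, hf, crossedEl_inv_smul, ← incl_eq_crossedEl,
    BrauerMod.incl_smul, BrauerMod.coef_smul, BrauerMod.coef_gen] at h
  rw [crossedEl_one_smul_indOne, ← hv, ← mul_smul, h, zero_smul, indOne_zero, smul_zero]

include hv0 hf in
-- A decomposition of m into components loses those outside S one at a time. An empty S gives
-- injectivity of the comparison; a singleton shows that it reflects degrees.
theorem eq_zero_of_separate_all [Finite G] (hloc : IsLocalIdem i)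
    (hv : SimpleQuot.mk γ i • v₀ = v₀) {S : Set (GroupE γ)} {m : InducedE γ V}
    (h : ∀ n : normalizerPt γ, (n : GroupE γ) ∉ S → separate hi f n m = 0) :
    m ∈ ⨆ e : S, inducedComponent γ V e := by
  classical
  have := Fintype.ofFinite (GroupE γ)
  obtain ⟨c, hc, rfl⟩ := exists_sum_inducedComponent V m
  refine sum_mem fun e _ => ?_
  by_cases he : e ∈ S
  · exact AddSubgroup.mem_iSup_of_mem (⟨e, he⟩ : S) (hc e)
  · obtain ⟨n, rfl⟩ := QuotientGroup.mk_surjective e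
    have h1 := h n he
    rw [map_sum, Finset.sum_eq_single (n : GroupE γ)] at h1
    · rw [eq_zero_of_separate hi hv0 hf hloc hv (hc n) h1]
      exact zero_mem _
    · intro e' _ he'
      obtain ⟨n', rfl⟩ := QuotientGroup.mk_surjective e'
      exact separate_of_map_mem hi (Ne.symm he') (comparison_mem hi hv0 hf n' (hc n'))
    · intro h2; exact absurd (Finset.mem_univ _) h2

include hv0 hf in
theorem mem_of_comparison_mem [Finite G] (hloc : IsLocalIdem i)
    (hv : SimpleQuot.mk γ i • v₀ = v₀) (n : normalizerPt γ) {m : InducedE γ V}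
    (hm : f m ∈ BrauerMod.component hi (thetaHom hi n)⁻¹) : m ∈ inducedComponent γ V n := by
  have h := eq_zero_of_separate_all hi hv0 hf hloc hv (S := {(n : GroupE γ)}) (m := m)
    fun n' hn' => separate_of_map_mem hi hn' hm
  rwa [iSup_unique] at h

include hv0 hf in
theorem comparison_injective [Finite G] (hloc : IsLocalIdem i)
    (hv : SimpleQuot.mk γ i • v₀ = v₀) : Function.Injective f := by
  refine (injective_iff_map_eq_zero f).2 fun m hm => ?_
  have h := eq_zero_of_separate_all hi hv0 hf hloc hv (S := ∅) (m := m) fun n _ => by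
    rw [separate_apply, hm, smul_zero, map_zero]
  rwa [iSup_of_empty, AddSubgroup.mem_bot] at h

include hf in
-- T/m_γT is spanned by the crossed product translates of the class of i ⊗ 1. Surjectivity of θ is
-- indispensable here.
theorem comparison_surjective [Finite G] (hloc : IsLocalIdem i) : Function.Surjective f := by
  have := Fintype.ofFinite (GroupF i)
  refine LinearMap.range_eq_top.1 (eq_top_iff.2 fun w _ => ?_)
  obtain ⟨t, rfl⟩ := BrauerMod.mk_surjective hi w
  obtain ⟨n, a, rfl⟩ := TensorC.exists_eq_sum_fixedTwist hi hloc t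
  rw [map_sum]
  refine sum_mem fun ψ _ => ?_
  rw [← BrauerMod.crossedEl_smul_mk, ← BrauerMod.gen_def, ← hf]
  exact Submodule.smul_mem _ _ (Submodule.smul_mem _ _ ⟨_, rfl⟩)

end Map

/-- An isomorphism of the induced module with `T ⧸ m_γ T`, as graded modules, together with additive
functions which separate the components. -/
structure Comparison (hi : i ∈ γ.carrier) (V : Type w) [AddCommGroup V]
    [Module (SimpleQuot γ) V] where
  /-- A nonzero vector. -/
  vec : V
  vec_ne_zero : vec ≠ 0
  /-- The isomorphism. -/
  equiv : InducedE γ V ≃ₗ[CrossedE γ] BrauerMod hi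
  equiv_vec : equiv (indOne V vec) = BrauerMod.gen hi
  mem_iff : ∀ (n : normalizerPt γ) (m : InducedE γ V), m ∈ inducedComponent γ V n ↔
    equiv m ∈ BrauerMod.component hi (thetaHom hi n)⁻¹
  /-- The separating functions. -/
  sep : GroupE γ → InducedE γ V →+ SimpleQuot γ
  sep_of_ne : ∀ e e', e ≠ e' → ∀ m ∈ inducedComponent γ V e', sep e m = 0
  eq_zero_of_sep : ∀ e, ∀ m ∈ inducedComponent γ V e, sep e m = 0 → m = 0

theorem nonempty_comparison [IsNoetherianRing O] [Finite G] (hi : i ∈ γ.carrier)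
    (hloc : IsLocalIdem i) (V : Type w) [AddCommGroup V] [Module (SimpleQuot γ) V]
    [IsSimpleModule (SimpleQuot γ) V] : Nonempty (Comparison hi V) := by
  obtain ⟨v₀, hv, hv0⟩ := exists_vector hi hloc V
  obtain ⟨f, hf⟩ := exists_comparison hi hloc hv hv0
  refine ⟨⟨v₀, hv0, LinearEquiv.ofBijective f ⟨comparison_injective hi hv0 hf hloc hv,
    comparison_surjective hi hf hloc⟩, hf, fun n m =>
    ⟨comparison_mem hi hv0 hf n, mem_of_comparison_mem hi hv0 hf hloc hv n⟩,
    fun e => separate hi f e.out, ?_, ?_⟩⟩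
  · intro e e' he m hm
    obtain ⟨n, rfl⟩ := QuotientGroup.mk_surjective e'
    refine separate_of_map_mem hi ?_ (comparison_mem hi hv0 hf n hm)
    rwa [QuotientGroup.out_eq']
  · intro e m hm h
    refine eq_zero_of_separate hi hv0 hf hloc hv ?_ h
    rwa [QuotientGroup.out_eq']

end Equivalence

/-! ### The homomorphism from 𝓕 to Ē, its kernel, and the gradings. -/

section Main

variable {O : Type u} {G : Type v} [CommRing O] [Group G] {H : Subgroup G} [H.Normal]
  {b : InvariantBlock O H} {P : Subgroup G} {i : FixedAlg b P}

theorem FrakF.one_mem_component : (1 : FrakF i) ∈ FrakF.component i 1 := fun ψ t ht => by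
  rw [inv_one, one_mul]
  exact ht

theorem FrakF.mul_mem_component {φ φ' : GroupF i} {f g : FrakF i} (hf : f ∈ FrakF.component i φ)
    (hg : g ∈ FrakF.component i φ') : f * g ∈ FrakF.component i (φ * φ') := fun ψ t ht => by
  rw [mul_inv_rev, mul_assoc]
  exact hg _ _ (hf ψ t ht)

variable [IsLocalRing O] {γ : LocalPoint b P}

/-- The isomorphism `E ≃ F`. -/
def thetaEquiv [Finite G] (hi : i ∈ γ.carrier) (hloc : IsLocalIdem i) : GroupE γ ≃* GroupF i :=
  (QuotientGroup.quotientMulEquivOfEq (thetaHom_ker hi).symm).trans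
    (QuotientGroup.quotientKerEquivOfSurjective (thetaHom hi) (thetaHom_surjective hi hloc))

theorem thetaEquiv_coe [Finite G] (hi : i ∈ γ.carrier) (hloc : IsLocalIdem i)
    (n : normalizerPt γ) : thetaEquiv hi hloc (n : GroupE γ) = thetaHom hi n := rfl

/-- A homogeneous element of `𝓕` which does not map `i ⊗ 1` into `m_γ T` has a left inverse. -/
theorem FrakF.exists_mul_eq_one [Finite G] (hi : i ∈ γ.carrier) (hloc : IsLocalIdem i)
    {n : normalizerPt γ} {f : FrakF i} (hf : f ∈ FrakF.component i (thetaHom hi n))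
    (h : BrauerMod.frakEnd hi f (BrauerMod.gen hi) ≠ 0) : ∃ f' : FrakF i, f' * f = 1 := by
  classical
  let t := TensorC.fixedEnd i f (TensorC.fixedGen i)
  let c := TensorC.fixedCoef i (TensorC.fixedTwist hi n⁻¹ t)
  -- The image t of i ⊗ 1 is homogeneous of degree θ(n)⁻¹, so it equals its projection to that
  -- degree.
  have ht : t = TensorC.fixedTwist hi n (TensorC.fixedMul i c (TensorC.fixedGen i)) := by
    refine Subtype.ext ?_
    rw [← TensorC.proj_eq_fixedTwist hi hloc.1.idem]
    have h1 := hf 1 _ (TensorC.gen_mem_componentF i)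
    rw [mul_one] at h1
    have h2 := TensorC.proj_of_mem i (thetaHom hi n)⁻¹ _ h1
    rw [if_pos rfl] at h2
    exact h2.symm
  have hci : c * i = c := FixedAlg.val_injective (by
    rw [map_mul]
    exact (mem_leftMod hloc.1.idem).1 (TensorC.coef i _).2)
  have hc : c ∉ pointIdeal γ.carrier := fun hc => h (by
    rw [BrauerMod.gen_def, BrauerMod.frakEnd_mk]
    change BrauerMod.mk hi t = 0
    rw [ht, ← BrauerMod.crossedEl_smul_mk, SimpleQuot.mk_eq_zero.2 hc, ← incl_eq_crossedEl,
      map_zero, zero_smul, smul_zero])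
  obtain ⟨d, hd⟩ := hloc.exists_mul_eq_of_not_mem γ.isPoint hi hci hc
  -- Undoing the twist and using dc = i, this element is sent by f to i ⊗ 1. As multiplication is
  -- opposite to composition, i ⊗ 1 ↦ is defines a left inverse of f.
  let s := TensorC.fixedTwist hi n⁻¹ (TensorC.fixedMul i (n • d) (TensorC.fixedGen i))
  have hs : TensorC.fixedEnd i f s = TensorC.fixedGen i := by
    have h1 : TensorC.fixedEnd i f s =
        TensorC.fixedTwist hi n⁻¹ (TensorC.fixedMul i (n • d) t) := by
      rw [← TensorC.fixedEnd_fixedMul]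
      exact Subtype.ext (TensorC.toEnd_twist hi n⁻¹ f _)
    rw [h1, ht, TensorC.fixedTwist_fixedMul, inv_smul_smul, ← Module.End.mul_apply (_ : Module.End O _)
      (TensorC.fixedTwist hi n), ← map_mul, inv_mul_cancel, map_one, Module.End.one_apply,
      ← Module.End.mul_apply, ← map_mul, hd, TensorC.fixedMul_fixedGen hloc.1.idem]
  refine ⟨FrakF.ofFixed i s s.2, FrakF.ext_gen hloc.1.idem ?_⟩
  rw [FrakF.toEnd_mul, LinearMap.comp_apply, FrakF.toEnd_ofFixed_gen, map_smul]
  have h2 := congrArg (fun x : TensorC.fixed i => FixedAlg.val i • (x : TensorC i)) hs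
  have h3 := congrArg Subtype.val (TensorC.fixedMul_fixedGen hloc.1.idem)
  exact h2.trans h3

variable {V : Type w} [AddCommGroup V] [Module (SimpleQuot γ) V] {hi : i ∈ γ.carrier}

namespace Comparison

variable (κ : Comparison hi V)

/-- The induced module is generated by 1 ⊗ v₀. This is the counterpart of `FrakF.ext_gen`. -/
theorem barE_ext [IsSimpleModule (SimpleQuot γ) V] {g h : BarE γ V}
    (hgh : g.unop (indOne V κ.vec) = h.unop (indOne V κ.vec)) : g = h := by
  refine MulOpposite.unop_injective (LinearMap.ext fun m => ?_)
  induction m using Induced.induction with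
  | h0 => rw [map_zero, map_zero]
  | hadd x y hx hy => rw [map_add, map_add, hx, hy]
  | htmul x v =>
    obtain ⟨y, rfl⟩ :=
      IsSimpleModule.toSpanSingleton_surjective (SimpleQuot γ) κ.vec_ne_zero v
    rw [LinearMap.toSpanSingleton_apply, tmul_eq_smul_indOne, ← crossedEl_one_smul_indOne,
      map_smul, map_smul, map_smul, map_smul, hgh]

/-- The homomorphism `𝓕 → Ē`. -/
def barHom : FrakF i →+* BarE γ V where
  toFun f := MulOpposite.op (κ.equiv.symm.toLinearMap ∘ₗ BrauerMod.frakEnd hi f ∘ₗ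
    κ.equiv.toLinearMap)
  map_one' := MulOpposite.unop_injective (LinearMap.ext fun m => by
    have h := congrArg MulOpposite.unop (map_one (BrauerMod.frakHom hi))
    change BrauerMod.frakEnd hi 1 = 1 at h
    change κ.equiv.symm (BrauerMod.frakEnd hi 1 (κ.equiv m)) = m
    rw [h, Module.End.one_apply, LinearEquiv.symm_apply_apply])
  map_mul' f g := MulOpposite.unop_injective (LinearMap.ext fun m => by
    have h := congrArg MulOpposite.unop (map_mul (BrauerMod.frakHom hi) f g)
    change BrauerMod.frakEnd hi (f * g) = BrauerMod.frakEnd hi g * BrauerMod.frakEnd hi f at h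
    change κ.equiv.symm (BrauerMod.frakEnd hi (f * g) (κ.equiv m)) = κ.equiv.symm
      (BrauerMod.frakEnd hi g (κ.equiv (κ.equiv.symm (BrauerMod.frakEnd hi f (κ.equiv m)))))
    rw [h, LinearEquiv.apply_symm_apply, Module.End.mul_apply])
  map_zero' := MulOpposite.unop_injective (LinearMap.ext fun m => by
    have h := congrArg MulOpposite.unop (map_zero (BrauerMod.frakHom hi))
    change BrauerMod.frakEnd hi 0 = 0 at h
    change κ.equiv.symm (BrauerMod.frakEnd hi 0 (κ.equiv m)) = 0
    rw [h, LinearMap.zero_apply, map_zero])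
  map_add' f g := MulOpposite.unop_injective (LinearMap.ext fun m => by
    have h := congrArg MulOpposite.unop (map_add (BrauerMod.frakHom hi) f g)
    change BrauerMod.frakEnd hi (f + g) = BrauerMod.frakEnd hi f + BrauerMod.frakEnd hi g at h
    change κ.equiv.symm (BrauerMod.frakEnd hi (f + g) (κ.equiv m)) =
      κ.equiv.symm (BrauerMod.frakEnd hi f (κ.equiv m)) +
        κ.equiv.symm (BrauerMod.frakEnd hi g (κ.equiv m))
    rw [h, LinearMap.add_apply, map_add])

theorem equiv_barHom (f : FrakF i) (m : InducedE γ V) :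
    κ.equiv ((κ.barHom f).unop m) = BrauerMod.frakEnd hi f (κ.equiv m) :=
  LinearEquiv.apply_symm_apply _ _

theorem barHom_eq_zero_iff [IsSimpleModule (SimpleQuot γ) V] (f : FrakF i) :
    κ.barHom f = 0 ↔ BrauerMod.frakEnd hi f (BrauerMod.gen hi) = 0 := by
  rw [← κ.equiv_vec, ← κ.equiv_barHom]
  constructor
  · intro h
    rw [h]
    exact map_zero _
  · intro h
    exact κ.barE_ext (κ.equiv.injective (h.trans (map_zero _).symm))

/-- Lift the image of 1 ⊗ v₀ to some t in T and take i ⊗ 1 ↦ it in 𝓕. Passing from t to it is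
harmless, because ī fixes 1 ⊗ v₀ and therefore its image under any endomorphism. -/
theorem barHom_surjective [IsSimpleModule (SimpleQuot γ) V] (hii : i * i = i) :
    Function.Surjective κ.barHom := by
  intro g
  obtain ⟨t, ht⟩ := BrauerMod.mk_surjective hi (κ.equiv (g.unop (indOne V κ.vec)))
  have hvec : crossedEl 1 (SimpleQuot.mk γ i) • indOne V κ.vec = indOne (γ := γ) V κ.vec := by
    refine κ.equiv.injective ?_
    rw [map_smul, κ.equiv_vec, ← incl_eq_crossedEl, BrauerMod.incl_smul, BrauerMod.gen_def,
      BrauerMod.quot_smul_mk, TensorC.fixedMul_fixedGen hii]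
  refine ⟨FrakF.ofFixed i t t.2, κ.barE_ext (κ.equiv.injective ?_)⟩
  have h1 : BrauerMod.frakEnd hi (FrakF.ofFixed i t t.2) (BrauerMod.gen hi) =
      crossedEl 1 (SimpleQuot.mk γ i) • BrauerMod.mk hi t := by
    rw [← incl_eq_crossedEl, BrauerMod.incl_smul, BrauerMod.quot_smul_mk, BrauerMod.gen_def,
      BrauerMod.frakEnd_mk]
    exact congrArg _ (Subtype.ext (FrakF.toEnd_ofFixed_gen i t t.2))
  rw [equiv_barHom, κ.equiv_vec, h1, ht, ← map_smul, ← map_smul, hvec]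

/-- The separating functions on `Ē`. -/
def barSep (e : GroupE γ) : BarE γ V →+ SimpleQuot γ where
  toFun g := κ.sep e (g.unop (indOne V κ.vec))
  map_zero' := map_zero _
  map_add' _ _ := map_add _ _ _

section Noetherian

variable [IsNoetherianRing O] [Finite G]

/-- Degree e in M corresponds to θ(e)⁻¹, so the left shift by θ(n)⁻¹ becomes the right shift by n:
θ(n)⁻¹θ(n')⁻¹ = θ(n'n)⁻¹. -/
theorem barHom_mem {n : normalizerPt γ} {f : FrakF i}
    (hf : f ∈ FrakF.component i (thetaHom hi n)) : κ.barHom f ∈ barEComponent γ V n := by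
  intro e m hm
  obtain ⟨n', rfl⟩ := QuotientGroup.mk_surjective e
  rw [← QuotientGroup.mk_mul, κ.mem_iff, equiv_barHom, map_mul, mul_inv_rev]
  exact BrauerMod.frakEnd_mem hi hf ((κ.mem_iff n' m).1 hm)

theorem unop_vec_mem {e : GroupE γ} {g : BarE γ V} (hg : g ∈ barEComponent γ V e) :
    g.unop (indOne V κ.vec) ∈ inducedComponent γ V e := by
  have h := hg 1 _ (indOne_mem V κ.vec)
  rwa [one_mul] at h

theorem barSep_of_ne {e e' : GroupE γ} (h : e ≠ e') {g : BarE γ V}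
    (hg : g ∈ barEComponent γ V e') : κ.barSep e g = 0 :=
  κ.sep_of_ne e e' h _ (κ.unop_vec_mem hg)

variable [IsSimpleModule (SimpleQuot γ) V]

theorem eq_zero_of_barSep {e : GroupE γ} {g : BarE γ V} (hg : g ∈ barEComponent γ V e)
    (h : κ.barSep e g = 0) : g = 0 :=
  κ.barE_ext (κ.eq_zero_of_sep e _ (κ.unop_vec_mem hg) h)

theorem barHom_part [Fintype (GroupF i)] (hloc : IsLocalIdem i) (f : FrakF i) (e : GroupE γ) :
    κ.barHom (FrakF.part i (thetaEquiv hi hloc e) f) ∈ barEComponent γ V e := by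
  obtain ⟨n, rfl⟩ := QuotientGroup.mk_surjective e
  exact κ.barHom_mem (FrakF.part_mem i _ f)

theorem barHom_eq_sum [Fintype (GroupF i)] [Fintype (GroupE γ)] (hloc : IsLocalIdem i)
    (f : FrakF i) :
    κ.barHom f = ∑ e, κ.barHom (FrakF.part i (thetaEquiv hi hloc e) f) := by
  conv_lhs => rw [← FrakF.sum_part i f, map_sum]
  exact (Equiv.sum_comp (thetaEquiv hi hloc).toEquiv
    fun φ => κ.barHom (FrakF.part i φ f)).symm

/-- The separating function of degree e sees only the part of f of degree θ(e), and it is injective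
on that part's image. -/
theorem barHom_part_eq_zero [Fintype (GroupF i)] (hloc : IsLocalIdem i) {f : FrakF i}
    {e : GroupE γ} (h : κ.barSep e (κ.barHom f) = 0) :
    κ.barHom (FrakF.part i (thetaEquiv hi hloc e) f) = 0 := by
  have := Fintype.ofFinite (GroupE γ)
  refine κ.eq_zero_of_barSep (κ.barHom_part hloc f e) ?_
  rw [κ.barHom_eq_sum hloc, map_sum, Finset.sum_eq_single e] at h
  · exact h
  · exact fun e' _ he' => κ.barSep_of_ne (Ne.symm he') (κ.barHom_part hloc f e')
  · exact fun he => absurd (Finset.mem_univ e) he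

theorem isAlgebraGrading_barE (κ : Comparison hi V) (hloc : IsLocalIdem i) :
    IsAlgebraGrading (barEComponent γ V) where
  one_mem e m hm := by rwa [mul_one]
  mul_mem x y a ha c hc e m hm := by
    rw [← mul_assoc]
    exact hc _ _ (ha e m hm)
  iSup_eq_top := by
    have := Fintype.ofFinite (GroupF i)
    have := Fintype.ofFinite (GroupE γ)
    refine eq_top_iff.2 fun g _ => ?_
    obtain ⟨f, rfl⟩ := κ.barHom_surjective hloc.1.idem g
    rw [κ.barHom_eq_sum hloc]
    exact sum_mem fun e _ => Submodule.mem_iSup_of_mem e (κ.barHom_part hloc f e)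
  indep := iSupIndep_of_separating _ κ.barSep (fun _ _ h _ hg => κ.barSep_of_ne h hg)
    fun _ _ hg => κ.eq_zero_of_barSep hg

theorem barHom_one_ne_zero (hloc : IsLocalIdem i) : κ.barHom 1 ≠ 0 := by
  rw [Ne, κ.barHom_eq_zero_iff]
  intro h
  have h1 : BrauerMod.coef hi (BrauerMod.gen hi) = 0 := (congrArg _ h).trans (map_zero _)
  rw [BrauerMod.coef_gen] at h1
  exact SimpleQuot.mk_ne_zero hi hloc h1

/-- Every proper graded left ideal of `𝓕` is contained in the kernel of `𝓕 → Ē`. -/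
theorem le_ker (hloc : IsLocalIdem i) {J : Ideal (FrakF i)}
    (hJ : IsGradedLeftIdeal (FrakF.component i) J) (hJ' : J ≠ ⊤) : J ≤ RingHom.ker κ.barHom := by
  intro f hf
  refine Submodule.iSup_induction _ (motive := fun f => f ∈ RingHom.ker κ.barHom) (hJ hf) ?_
    (zero_mem _) fun _ _ hx hy => add_mem hx hy
  rintro φ f ⟨hfJ, hfφ⟩
  obtain ⟨n, rfl⟩ := thetaHom_surjective hi hloc φ
  by_contra h
  rw [RingHom.mem_ker, κ.barHom_eq_zero_iff] at h
  obtain ⟨f', hf'⟩ := FrakF.exists_mul_eq_one hi hloc hfφ h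
  exact hJ' ((Ideal.eq_top_iff_one J).2 (hf' ▸ J.mul_mem_left f' hfJ))

theorem isGradedLeftIdeal_ker (hloc : IsLocalIdem i) :
    IsGradedLeftIdeal (FrakF.component i) (RingHom.ker κ.barHom) := by
  intro f hf
  have := Fintype.ofFinite (GroupF i)
  rw [← FrakF.sum_part i f]
  refine sum_mem fun φ _ => Submodule.mem_iSup_of_mem φ ⟨?_, FrakF.part_mem i φ f⟩
  obtain ⟨e, rfl⟩ := (thetaEquiv hi hloc).surjective φ
  have hf0 : κ.barHom f = 0 := hf
  exact κ.barHom_part_eq_zero hloc (by rw [hf0, map_zero])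

/-- By `le_ker` the kernel is the largest proper graded left ideal, hence the only maximal one.
Being two-sided, it is the annihilator of its quotient, the unique graded simple module in the
intersection. -/
theorem gradedJacobson_eq (hloc : IsLocalIdem i) :
    gradedJacobson (FrakF.component i) = RingHom.ker κ.barHom := by
  have hne : RingHom.ker κ.barHom ≠ ⊤ := fun h =>
    κ.barHom_one_ne_zero hloc ((Ideal.eq_top_iff_one _).1 h)
  have hgr := κ.isGradedLeftIdeal_ker hloc
  refine le_antisymm (fun r hr => ?_) fun r hr 𝔪 h𝔪 s => ?_
  · rw [← mul_one r]
    exact hr _ ⟨⟨hgr, hne⟩, fun J hJ _ => κ.le_ker hloc hJ.1 hJ.2⟩ 1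
  · exact h𝔪.le_of_ge ⟨hgr, hne⟩ (κ.le_ker hloc h𝔪.prop.1 h𝔪.prop.2) (Ideal.mul_mem_right s _ hr)

theorem barHom_algebraMap (r : O) : κ.barHom (algebraMap O (FrakF i) r) =
    algebraMap (IsLocalRing.ResidueField O) (BarE γ V) (IsLocalRing.residue O r) := by
  refine κ.barE_ext (κ.equiv.injective ?_)
  have h : ((algebraMap (IsLocalRing.ResidueField O) (BarE γ V)
      (IsLocalRing.residue O r)).unop (indOne V κ.vec)) =
      crossedEl 1 (SimpleQuot.mk γ (algebraMap O (FixedAlg b P) r)) • indOne V κ.vec := rfl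
  rw [equiv_barHom, h, map_smul, κ.equiv_vec, ← incl_eq_crossedEl, BrauerMod.incl_smul,
    BrauerMod.gen_def, BrauerMod.quot_smul_mk, BrauerMod.frakEnd_mk]
  refine congrArg _ (Subtype.ext ?_)
  rw [TensorC.coe_fixedMul]
  change r • (TensorC.fixedGen i : TensorC i) = _
  rw [← algebraMap_smul (BlockExt b) r (TensorC.fixedGen i : TensorC i)]
  rfl

/-- The homomorphism `F̄ → Ē`. -/
def barLift (hloc : IsLocalIdem i) : BarF i →+* BarE γ V :=
  Ideal.Quotient.lift _ κ.barHom fun f hf => by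
    rwa [κ.gradedJacobson_eq hloc] at hf

theorem barF_mk_surjective : Function.Surjective (BarF.mk i) := Ideal.Quotient.mk_surjective

theorem barLift_bijective (hloc : IsLocalIdem i) : Function.Bijective (κ.barLift hloc) := by
  constructor
  · refine (injective_iff_map_eq_zero _).2 fun x hx => ?_
    obtain ⟨f, rfl⟩ := barF_mk_surjective x
    refine Ideal.Quotient.eq_zero_iff_mem.2 ?_
    rw [κ.gradedJacobson_eq hloc]
    exact hx
  · intro g
    obtain ⟨f, rfl⟩ := κ.barHom_surjective hloc.1.idem g
    exact ⟨BarF.mk i f, rfl⟩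

/-- The isomorphism of `k`-algebras `F̄ ≃ Ē`. -/
def barEquiv (hloc : IsLocalIdem i) : BarF i ≃ₐ[IsLocalRing.ResidueField O] BarE γ V :=
  AlgEquiv.ofBijective
    ({ κ.barLift hloc with
        commutes' := fun c => by
          obtain ⟨r, rfl⟩ := IsLocalRing.residue_surjective c
          exact κ.barHom_algebraMap r } :
      BarF i →ₐ[IsLocalRing.ResidueField O] BarE γ V) (κ.barLift_bijective hloc)

theorem barEquiv_mk (hloc : IsLocalIdem i) (f : FrakF i) :
    κ.barEquiv hloc (BarF.mk i f) = κ.barHom f := rfl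

theorem barEquiv_mem_iff (hloc : IsLocalIdem i) (e : GroupE γ) (x : BarF i) :
    κ.barEquiv hloc x ∈ barEComponent γ V e ↔ x ∈ BarF.component i (thetaEquiv hi hloc e) := by
  constructor
  · intro hx
    have := Fintype.ofFinite (GroupF i)
    have := Fintype.ofFinite (GroupE γ)
    obtain ⟨f, rfl⟩ := barF_mk_surjective x
    rw [barEquiv_mk] at hx
    -- The representative f need not be homogeneous; its part of degree θ(e) has the same image,
    -- since the other parts are killed.
    refine ⟨_, FrakF.part_mem i (thetaEquiv hi hloc e) f, (κ.barEquiv hloc).injective ?_⟩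
    rw [barEquiv_mk, barEquiv_mk, κ.barHom_eq_sum hloc f, Finset.sum_eq_single e]
    · exact fun e' _ he' => κ.barHom_part_eq_zero hloc (κ.barSep_of_ne he' hx)
    · exact fun he => absurd (Finset.mem_univ e) he
  · rintro ⟨f, hf, rfl⟩
    obtain ⟨n, rfl⟩ := QuotientGroup.mk_surjective e
    exact κ.barHom_mem hf

theorem isAlgebraGrading_barF (κ : Comparison hi V) (hloc : IsLocalIdem i) :
    IsAlgebraGrading (BarF.component i) where
  one_mem := ⟨1, FrakF.one_mem_component, map_one _⟩
  mul_mem := by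
    rintro x y _ ⟨f, hf, rfl⟩ _ ⟨g, hg, rfl⟩
    exact ⟨f * g, FrakF.mul_mem_component hf hg, map_mul _ _ _⟩
  iSup_eq_top := by
    have := Fintype.ofFinite (GroupF i)
    refine eq_top_iff.2 fun x _ => ?_
    obtain ⟨f, rfl⟩ := barF_mk_surjective x
    rw [← FrakF.sum_part i f, map_sum]
    exact sum_mem fun φ _ => Submodule.mem_iSup_of_mem φ ⟨_, FrakF.part_mem i φ f, rfl⟩
  indep := by
    -- Independence is pulled back from Ē along the isomorphism F̄ ≃ Ē.
    refine iSupIndep_of_separating _ (fun φ => (κ.barSep ((thetaEquiv hi hloc).symm φ)).comp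
      (κ.barEquiv hloc : BarF i →+ BarE γ V)) ?_ ?_
    · intro φ φ' h x hx
      rw [← (thetaEquiv hi hloc).apply_symm_apply φ', ← κ.barEquiv_mem_iff] at hx
      exact κ.barSep_of_ne (fun h' => h ((thetaEquiv hi hloc).symm.injective h')) hx
    · intro φ x hx h
      rw [← (thetaEquiv hi hloc).apply_symm_apply φ, ← κ.barEquiv_mem_iff] at hx
      exact (κ.barEquiv hloc).injective ((κ.eq_zero_of_barSep hx h).trans (map_zero _).symm)

end Noetherian

end Comparison

end Main

end BlockExtension

end

theorem mainTheorem6 {O : Type*} [CommRing O] [IsDomain O] [IsDiscreteValuationRing O]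
    [IsAdicComplete (IsLocalRing.maximalIdeal O) O]
    (p : ℕ) [Fact p.Prime] [CharP (IsLocalRing.ResidueField O) p]
    {G : Type*} [Group G] [Finite G] (H : Subgroup G) [H.Normal]
    (b : BlockExtension.InvariantBlock O H)
    (P : Subgroup G) (hP : IsPGroup p P)
    (γ : BlockExtension.LocalPoint b P)
    (i : BlockExtension.FixedAlg b P) (hi : i ∈ γ.carrier)
    (V : Type*) [AddCommGroup V] [Module (BlockExtension.SimpleQuot γ) V]
    [IsSimpleModule (BlockExtension.SimpleQuot γ) V] :
    BlockExtension.IsAlgebraGrading (BlockExtension.barEComponent γ V) ∧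
    BlockExtension.IsAlgebraGrading (BlockExtension.BarF.component i) ∧
    ∃ θ : BlockExtension.GroupE γ ≃* BlockExtension.GroupF i,
      (∀ n : BlockExtension.normalizerPt γ,
        (∀ u : P, (((θ (n : BlockExtension.GroupE γ) : MulAut P × G ⧸ H).1 u : P) : G) =
          (n : G) * (u : G) * (n : G)⁻¹) ∧
        (θ (n : BlockExtension.GroupE γ) : MulAut P × G ⧸ H).2 = ((n : G) : G ⧸ H)) ∧
      ∃ Φ : BlockExtension.BarE γ V ≃ₐ[IsLocalRing.ResidueField O] BlockExtension.BarF i,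
        ∀ e : BlockExtension.GroupE γ,
          (BlockExtension.barEComponent γ V e).map (Φ : BlockExtension.BarE γ V →ₗ[IsLocalRing.ResidueField O] BlockExtension.BarF i) =
            BlockExtension.BarF.component i (θ e) := by
  -- This is the point where completeness of O is used.
  have hloc : BlockExtension.IsLocalIdem i :=
    BlockExtension.isLocalIdem_of_isPrimitiveIdem O (γ.isPoint.isPrimitiveIdem hi)
  obtain ⟨κ⟩ := BlockExtension.nonempty_comparison hi hloc V
  refine ⟨κ.isAlgebraGrading_barE hloc, κ.isAlgebraGrading_barF hloc,
    BlockExtension.thetaEquiv hi hloc, fun n => ⟨fun u => ?_, rfl⟩, (κ.barEquiv hloc).symm,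
    fun e => ?_⟩
  · rw [BlockExtension.thetaEquiv_coe, BlockExtension.thetaHom_fst, BlockExtension.conjP_apply]
  · ext x
    rw [← κ.barEquiv_mem_iff hloc]
    constructor
    · rintro ⟨g, hg, rfl⟩
      change κ.barEquiv hloc ((κ.barEquiv hloc).symm g) ∈ _
      rwa [AlgEquiv.apply_symm_apply]
    · exact fun hx => ⟨_, hx, (κ.barEquiv hloc).symm_apply_apply x⟩
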